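/- **Setting.** Let $f:\mathbb R^m\times\mathbb R^d\to\mathbb R^m$, let $\mathcal C:\mathbb R^m\to\mathbb R$ be a polynomial of degree at most two, $\Gamma:=\|\nabla_{yy}\mathcal C\|$, $T>0$. Consider the unconstrained problem of minimizing $\mathcal C(y(T))$ subject to $y'=f(y,u)$, $y(0)=y_0$. Let $T^*>T$ and let $(y^\star,p^\star,u^\star)$ satisfy the optimality system $$y'=f(y,u),\quad y(0)=y_0,\qquad p'=-\nabla_yf(y,u)^{\sf T}p,\quad p(T)=\nabla\mathcal C(y(T))^{\sf T},\qquad \nabla_uf(y,u)^{\sf T}p=0,$$ with the differential equations and the last condition holding on $[0,T^*]$. **Triplet.** A Peer triplet with $s$ stages consists of nodes $\mathbf c=(c_1,\dots,c_s)$, $c_i\ge0$, vectors $a,w\in\mathbb R^s$ and $s\times s$ matrices $(A_0,K_0)$, $(A,B,K)$, $(A_N,B_N,K_N)$ with $A_0,A,A_N$ non-singular, $A$ lower triangular and $K$ diagonal. Put $(A_n,B_n,K_n)=(A,B,K)$ for $1\le n\le N-1$. With $h=T/(N+1)$, $t_{ni}=(n+c_i)h$ and $F(Y_n,U_n)=(f(Y_{ni},U_{ni}))_{i}$,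 its discrete optimality system is $$A_0Y_0=a\otimes y_0+hK_0F(Y_0,U_0),\qquad A_nY_n=B_nY_{n-1}+hK_nF(Y_n,U_n)\ (1\le n\le N),$$ $$A_N^{\sf T}P_N=w\otimes\nabla\mathcal C\big((w^{\sf T}\otimes I)Y_N\big)^{\sf T}+h\nabla_YF(Y_N,U_N)^{\sf T}K_N^{\sf T}P_N,$$ $$A_n^{\sf T}P_n=B_{n+1}^{\sf T}P_{n+1}+h\nabla_YF(Y_n,U_n)^{\sf T}K_n^{\sf T}P_n\ (0\le n<N),\qquad \nabla_UF(Y_n,U_n)^{\sf T}K_n^{\sf T}P_n=0\ (0\le n\le N).$$ A stage $j$ of step $n$ is *blind* if the column sum $(\mathbb 1^{\sf T}K_n)_j$ vanishes; its control $U_{nj}$ does not enter the system and is discarded. **Order conditions.** Let $2\le q\le r\le s$ and $q<s$. Let $V_k=(\mathbb 1,\mathbf c,\dots,\mathbf c^{k-1})$, $\mathcal P_k=\big(\binom{j-1}{i-1}\big)_{i,j=1}^k$, $\tilde E_k=(i\,\delta_{i+1,j})_{i,j=1}^k$, $C=\operatorname{diag}(c_i)$. The triplet is assumed to satisfy: *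 $A_0V_r=ae_1^{\sf T}+K_0V_r\tilde E_r$; $\;A_nV_r=B_nV_r\mathcal P_r^{-1}+K_nV_r\tilde E_r$ $(1\le n\le N)$; $\;w^{\sf T}V_r=\mathbb 1^{\sf T}$; $\;A_n^{\sf T}V_q=B_{n+1}^{\sf T}V_q\mathcal P_q-K_n^{\sf T}V_q\tilde E_q$ $(0\le n\le N-1)$; $\;A_N^{\sf T}V_q=w\mathbb 1^{\sf T}-K_N^{\sf T}V_q\tilde E_q$; * $(\mathbf c^{l-1})^{\sf T}K_n=\mathbb 1^{\sf T}K_nC^{l-1}$ for $l=2,\dots,q$ and $n\in\{0,N\}$; * $\mathbb 1^{\sf T}K_0>0$, $\mathbb 1^{\sf T}K_N>0$, $\mathbb 1^{\sf T}K\ge0$, where as an exception the first row and the first column of $K_0$ may vanish (then $(\mathbb 1^{\sf T}K_0)_1=0$); * superconvergence: $\mathbb 1^{\sf T}\big(A\mathbf c^r-B(\mathbf c-\mathbb 1)^r-rK\mathbf c^{r-1}\big)=0$ and $\mathbb 1^{\sf T}\big(A^{\sf T}\mathbf c^q-B^{\sf T}(\mathbf c+\mathbb 1)^q+qK\mathbf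 c^{q-1}\big)=0$; * for some $\gamma<1$ all eigenvalues of $A^{-1}B$ except one (counted with multiplicity) have modulus $\le\gamma$; and for $n\in\{0,N\}$ all complex roots of $\lambda\mapsto\det(A_n-\lambda K_n)$ (the eigenvalues of $K_n^{-1}A_n$ if $K_n$ is non-singular) have positive real part. **Claim.** There are positive constants $\zeta_1^P,\zeta_2^P,\zeta_c^P,\zeta_1^U,\zeta_2^U,\zeta_c^U$, depending on the triplet only, such that the following holds for every problem as above. Assume $y^\star,p^\star\in C^{q+1}[0,T^*]$, $u^\star\in C^q[0,T^*]$. Assume that in a tubular neighbourhood of $z^\star=(y^\star,p^\star,u^\star)$ over $[0,T^*]$ the functions $f$ and $\nabla_uf$ are twice continuously differentiable and, with $z=(y,p,u)$, $$\|\nabla_zf\|\le\Lambda_1,\qquad(1+\|z\|)\|\nabla_{zz}f\|\le\Lambda_2,\qquad\|\langle p,\nabla_{uzz}f\rangle\|\le\Lambda_3.$$ Assume that for some $\epsilon\in(0,1)$ and $\omega$ one has $\|\langle\tilde p,\nabla_{uu}f(y^\star(t),u^\star(t))\rangle^{-1}\|\le\omega$ for all $t\in[0,T^*]$ and all $\tilde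 p$ with $\|\tilde p-p^\star(t)\|\le\epsilon$. Assume finally $$(\zeta_1^P\Lambda_1+\zeta_2^P\Lambda_2+\zeta_c^P\Gamma\Lambda_1)\,T\le\tfrac23,\qquad(\zeta_1^U\Lambda_1+\zeta_2^U\Lambda_2+\zeta_c^U\Gamma\Lambda_1)\,\Lambda_1\,\omega\,T\le\tfrac13 .$$ Then there are $h_0,\delta,c>0$ such that for every $N$ with $h=T/(N+1)\le h_0$ the discrete optimality system has one and only one solution $(Y,P,U)$ (blind controls discarded) with $$\max_{n,i}\{\|Y_{ni}-y^\star(t_{ni})\|,\|P_{ni}-p^\star(t_{ni})\|,\|U_{ni}-u^\star(t_{ni})\|\}\le\delta,$$ and this maximum, over $0\le n\le N$ and $1\le i\le s$, blind controls excluded, is then at most $c\,h^q$. Norms are Euclidean on $\mathbb R^m,\mathbb R^d$, with the maximum over the components $y,p,u$ of $z$, and operator norms for derivatives. -/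

import Mathlib

open scoped Matrix InnerProductSpace

noncomputable section

/-- The Vandermonde matrix `V_k = (𝟙, c, c², …, c^{k-1})` of a node vector. -/
def vandermondeV {s : ℕ} (c : Fin s → ℝ) (k : ℕ) : Matrix (Fin s) (Fin k) ℝ :=
  Matrix.of fun i j => c i ^ (j : ℕ)

/-- The upper triangular Pascal matrix `P_k` (entry `(i, j)` is `j choose i`, indices from `0`). -/
def pascalP (k : ℕ) : Matrix (Fin k) (Fin k) ℝ :=
  Matrix.of fun i j => (Nat.choose (j : ℕ) (i : ℕ) : ℝ)

/-- The nilpotent matrix `E_k` with superdiagonal `1, 2, …, k-1`, so that column `j` of `V_k E_k`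
is `j c^{j-1}` (indices from `0`). -/
def nilpotentE (k : ℕ) : Matrix (Fin k) (Fin k) ℝ :=
  Matrix.of fun i j => if (i : ℕ) + 1 = (j : ℕ) then ((j : ℕ) : ℝ) else 0

/-- The column sums `𝟙ᵀ K`. -/
def colSum {s : ℕ} (K : Matrix (Fin s) (Fin s) ℝ) (j : Fin s) : ℝ := ∑ i, K i j

/-- The one-leg conditions `(c^{l-1})ᵀ K = 𝟙ᵀ K C^{l-1}`, `l = 2, …, q`, `C = diag c`. -/
def OneLeg {s : ℕ} (c : Fin s → ℝ) (q : ℕ) (K : Matrix (Fin s) (Fin s) ℝ) : Prop :=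
  ∀ l : ℕ, 2 ≤ l → l ≤ q → ∀ j, ∑ i, c i ^ (l - 1) * K i j = colSum K j * c j ^ (l - 1)

/-- The data of an `s`-stage Peer triplet: nodes `c`, starting vector `a`, end vector `w`, starting
step `(A₀, K₀)`, standard step `(A, B, K)` and last step `(AN, BN, KN)`. -/
structure PeerTriplet (s : ℕ) where
  c : Fin s → ℝ
  a : Fin s → ℝ
  w : Fin s → ℝ
  A₀ : Matrix (Fin s) (Fin s) ℝ
  K₀ : Matrix (Fin s) (Fin s) ℝ
  A : Matrix (Fin s) (Fin s) ℝ
  B : Matrix (Fin s) (Fin s) ℝ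
  K : Matrix (Fin s) (Fin s) ℝ
  AN : Matrix (Fin s) (Fin s) ℝ
  BN : Matrix (Fin s) (Fin s) ℝ
  KN : Matrix (Fin s) (Fin s) ℝ

namespace PeerTriplet

variable {s : ℕ} (M : PeerTriplet s)

/-- Structural requirements: nodes are not negative, the matrices `A₀, A, AN` are non-singular, `A`
is lower triangular and `K` is diagonal. -/
structure Structural : Prop where
  nodes_nonneg : ∀ i, 0 ≤ M.c i
  det_A₀ : M.A₀.det ≠ 0
  det_A : M.A.det ≠ 0
  det_AN : M.AN.det ≠ 0
  lower_A : ∀ i j, i < j → M.A i j = 0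
  diag_K : ∀ i j, i ≠ j → M.K i j = 0

/-- The order conditions, of order `r` for the forward and order `q` for the adjoint scheme. -/
structure OrderConditions (q r : ℕ) : Prop where
  start_forward :
    M.A₀ * vandermondeV M.c r =
      (Matrix.of fun i (j : Fin r) => if (j : ℕ) = 0 then M.a i else 0)
        + M.K₀ * vandermondeV M.c r * nilpotentE r
  start_adjoint :
    M.A₀ᵀ * vandermondeV M.c q =
      M.Bᵀ * vandermondeV M.c q * pascalP q - M.K₀ᵀ * vandermondeV M.c q * nilpotentE q
  standard_forward :
    M.A * vandermondeV M.c r =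
      M.B * vandermondeV M.c r * (pascalP r)⁻¹ + M.K * vandermondeV M.c r * nilpotentE r
  standard_adjoint :
    M.Aᵀ * vandermondeV M.c q =
      M.Bᵀ * vandermondeV M.c q * pascalP q - M.Kᵀ * vandermondeV M.c q * nilpotentE q
  last_forward :
    M.AN * vandermondeV M.c r =
      M.BN * vandermondeV M.c r * (pascalP r)⁻¹ + M.KN * vandermondeV M.c r * nilpotentE r
  last_adjoint :
    M.Aᵀ * vandermondeV M.c q =
      M.BNᵀ * vandermondeV M.c q * pascalP q - M.Kᵀ * vandermondeV M.c q * nilpotentE q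
  end_forward : ∀ j, ∑ i, M.w i * vandermondeV M.c r i j = 1
  end_adjoint :
    M.ANᵀ * vandermondeV M.c q =
      (Matrix.of fun i (_ : Fin q) => M.w i) - M.KNᵀ * vandermondeV M.c q * nilpotentE q
  oneLeg_start : OneLeg M.c q M.K₀
  oneLeg_end : OneLeg M.c q M.KN

/-- Positivity of the column sums. In the starting step the first stage may be a blind one
(first row and first column of `K₀` vanish), as it is for triplets of FSAL type. -/
structure Positivity : Prop where
  start : ∀ j, 0 < colSum M.K₀ j ∨
    ((j : ℕ) = 0 ∧ (∀ i, M.K₀ i j = 0) ∧ (∀ i, M.K₀ j i = 0))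
  standard : ∀ j, 0 ≤ colSum M.K j
  last : ∀ j, 0 < colSum M.KN j

/-- The superconvergence conditions of the standard scheme, forward and adjoint. -/
structure Superconvergence (q r : ℕ) : Prop where
  forward :
    ∑ i, (M.A *ᵥ (fun k => M.c k ^ r) - M.B *ᵥ (fun k => (M.c k - 1) ^ r)
      - (r : ℝ) • (M.K *ᵥ fun k => M.c k ^ (r - 1))) i = 0
  adjoint :
    ∑ i, (M.Aᵀ *ᵥ (fun k => M.c k ^ q) - M.Bᵀ *ᵥ (fun k => (M.c k + 1) ^ q)
      + (q : ℝ) • (M.K *ᵥ fun k => M.c k ^ (q - 1))) i = 0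

/-- `|λ₂(A⁻¹B)| ≤ γ < 1`: counted with algebraic multiplicity, all complex eigenvalues of `A⁻¹B`
except one have modulus at most `γ`. -/
def Damping : Prop :=
  ∃ γ : ℝ, γ < 1 ∧ ∃ (lam : ℂ) (S : Multiset ℂ),
    ((M.A⁻¹ * M.B).map (algebraMap ℝ ℂ)).charpoly.roots = lam ::ₘ S ∧ ∀ z ∈ S, ‖z‖ ≤ γ

/-- All eigenvalues `z` of the pencil `A₀ - z K₀`, i.e. of `K₀⁻¹ A₀` if `K₀` is non-singular, have
positive real part, and the same for the last step. -/
def BoundaryEigenvalues : Prop :=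
  (∀ z : ℂ, (M.A₀.map (algebraMap ℝ ℂ) - z • M.K₀.map (algebraMap ℝ ℂ)).det = 0 → 0 < z.re) ∧
  (∀ z : ℂ, (M.AN.map (algebraMap ℝ ℂ) - z • M.KN.map (algebraMap ℝ ℂ)).det = 0 → 0 < z.re)

/-- `A_n`, `0 ≤ n ≤ N`. -/
def coefA (N n : ℕ) : Matrix (Fin s) (Fin s) ℝ :=
  if n = 0 then M.A₀ else if n = N then M.AN else M.A

/-- `B_n`, `1 ≤ n ≤ N`. -/
def coefB (N n : ℕ) : Matrix (Fin s) (Fin s) ℝ :=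
  if n = N then M.BN else M.B

/-- `K_n`, `0 ≤ n ≤ N`. -/
def coefK (N n : ℕ) : Matrix (Fin s) (Fin s) ℝ :=
  if n = 0 then M.K₀ else if n = N then M.KN else M.K

/-- Stage `j` of step `n` is active if the `j`-th column sum of `K_n` is not zero. A stage that is
not active is blind: its control does not enter the discrete problem. -/
def Active (N n : ℕ) (j : Fin s) : Prop := colSum (M.coefK N n) j ≠ 0

/-- The off-step points `t_{ni} = t_n + c_i h`, `t_n = n h`. -/
def node (h : ℝ) (n : ℕ) (i : Fin s) : ℝ := (n : ℝ) * h + M.c i * h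

end PeerTriplet

/-- `(A ⊗ I) Y`. -/
def kronApply {s m : ℕ} (A : Matrix (Fin s) (Fin s) ℝ) (Y : Fin s → EuclideanSpace ℝ (Fin m)) :
    Fin s → EuclideanSpace ℝ (Fin m) :=
  fun i => ∑ j, A i j • Y j

section Problem

variable {m d : ℕ}
  (f : EuclideanSpace ℝ (Fin m) × EuclideanSpace ℝ (Fin d) → EuclideanSpace ℝ (Fin m))
  (C : EuclideanSpace ℝ (Fin m) → ℝ)

/-- `∇_y f (y, u)`. -/
def jacY (y : EuclideanSpace ℝ (Fin m)) (u : EuclideanSpace ℝ (Fin d)) :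
    EuclideanSpace ℝ (Fin m) →L[ℝ] EuclideanSpace ℝ (Fin m) :=
  fderiv ℝ (fun v => f (v, u)) y

/-- `∇_u f (y, u)`. -/
def jacU (y : EuclideanSpace ℝ (Fin m)) (u : EuclideanSpace ℝ (Fin d)) :
    EuclideanSpace ℝ (Fin d) →L[ℝ] EuclideanSpace ℝ (Fin m) :=
  fderiv ℝ (fun v => f (y, v)) u

/-- `∇_y f (y, u)ᵀ p`. -/
def adjY (y p : EuclideanSpace ℝ (Fin m)) (u : EuclideanSpace ℝ (Fin d)) :
    EuclideanSpace ℝ (Fin m) :=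
  ContinuousLinearMap.adjoint (jacY f y u) p

/-- `∇_u f (y, u)ᵀ p`, the gradient in `u` of the Hamiltonian `pᵀ f (y, u)`. -/
def adjU (y p : EuclideanSpace ℝ (Fin m)) (u : EuclideanSpace ℝ (Fin d)) :
    EuclideanSpace ℝ (Fin d) :=
  ContinuousLinearMap.adjoint (jacU f y u) p

/-- `⟨p, ∇_{uu} f (y, u)⟩`, the Hessian in `u` of the Hamiltonian, as a linear operator. -/
def hessUU (y p : EuclideanSpace ℝ (Fin m)) (u : EuclideanSpace ℝ (Fin d)) :
    EuclideanSpace ℝ (Fin d) →L[ℝ] EuclideanSpace ℝ (Fin d) :=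
  fderiv ℝ (fun v => adjU f y p v) u

/-- `C` is a polynomial of degree at most two. -/
def IsQuadraticObjective : Prop :=
  ∃ (H : EuclideanSpace ℝ (Fin m) →L[ℝ] EuclideanSpace ℝ (Fin m))
    (g : EuclideanSpace ℝ (Fin m)) (e : ℝ), ∀ y, C y = e + ⟪g, y⟫_ℝ + ⟪H y, y⟫_ℝ

/-- `(y, p, u)` solves the first order optimality system of the unconstrained problem
`min C(y(T))`, `y' = f(y, u)`, `y(0) = y₀`, with the differential equations and the control
condition holding up to time `Tstar ≥ T`. -/
structure IsContinuousKKT (y₀ : EuclideanSpace ℝ (Fin m)) (T Tstar : ℝ)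
    (y p : ℝ → EuclideanSpace ℝ (Fin m)) (u : ℝ → EuclideanSpace ℝ (Fin d)) : Prop where
  state : ∀ t ∈ Set.Icc 0 Tstar, HasDerivWithinAt y (f (y t, u t)) (Set.Icc 0 Tstar) t
  init : y 0 = y₀
  adjoint : ∀ t ∈ Set.Icc 0 Tstar,
    HasDerivWithinAt p (-adjY f (y t) (p t) (u t)) (Set.Icc 0 Tstar) t
  final : p T = gradient C (y T)
  control : ∀ t ∈ Set.Icc 0 Tstar, adjU f (y t) (p t) (u t) = 0

/-- In a tubular neighbourhood of radius `ρ` of the curve `(y, p, u)` over `[0, Tstar]`, the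
functions `f` and `∇_u f` are twice continuously differentiable and, for `z = (y, p, u)`,
`‖∇_z f‖ ≤ Λ₁`, `(1 + ‖z‖) ‖∇_{zz} f‖ ≤ Λ₂`, `‖⟨p, ∇_{uzz} f⟩‖ ≤ Λ₃`. -/
structure SmoothnessBounds (Tstar : ℝ)
    (y p : ℝ → EuclideanSpace ℝ (Fin m)) (u : ℝ → EuclideanSpace ℝ (Fin d))
    (ρ Λ₁ Λ₂ Λ₃ : ℝ) : Prop where
  smooth_f : ContDiffOn ℝ 2 f {x | ∃ t ∈ Set.Icc 0 Tstar, dist x (y t, u t) < ρ}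
  smooth_fu : ContDiffOn ℝ 2
    (fun x : EuclideanSpace ℝ (Fin m) × EuclideanSpace ℝ (Fin d) => jacU f x.1 x.2)
    {x | ∃ t ∈ Set.Icc 0 Tstar, dist x (y t, u t) < ρ}
  bound₁ : ∀ t ∈ Set.Icc 0 Tstar, ∀ η π ν, dist (η, π, ν) (y t, p t, u t) < ρ →
    ‖fderiv ℝ f (η, ν)‖ ≤ Λ₁
  bound₂ : ∀ t ∈ Set.Icc 0 Tstar, ∀ η π ν, dist (η, π, ν) (y t, p t, u t) < ρ →
    (1 + ‖(η, π, ν)‖) * ‖fderiv ℝ (fderiv ℝ f) (η, ν)‖ ≤ Λ₂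
  bound₃ : ∀ t ∈ Set.Icc 0 Tstar, ∀ η π ν, dist (η, π, ν) (y t, p t, u t) < ρ →
    ‖fderiv ℝ (fderiv ℝ
      (fun x : EuclideanSpace ℝ (Fin m) × EuclideanSpace ℝ (Fin d) => adjU f x.1 π x.2))
      (η, ν)‖ ≤ Λ₃

/-- For all `t ∈ [0, Tstar]` and all `π` with `‖π - p(t)‖ ≤ ε`, the operator
`⟨π, ∇_{uu} f (y(t), u(t))⟩` has an inverse of norm at most `ω`. -/
def ControlHessianBound (Tstar : ℝ)
    (y p : ℝ → EuclideanSpace ℝ (Fin m)) (u : ℝ → EuclideanSpace ℝ (Fin d)) (ε ω : ℝ) : Prop :=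
  ∀ t ∈ Set.Icc 0 Tstar, ∀ π, ‖π - p t‖ ≤ ε →
    ∃ R : EuclideanSpace ℝ (Fin d) →L[ℝ] EuclideanSpace ℝ (Fin d),
      (hessUU f (y t) π (u t)).comp R = ContinuousLinearMap.id ℝ _ ∧
      R.comp (hessUU f (y t) π (u t)) = ContinuousLinearMap.id ℝ _ ∧ ‖R‖ ≤ ω

/-- `(Y, P, U)` solves the discrete first order optimality system (unconstrained case) with step
size `h` and steps `n = 0, …, N`. -/
structure IsDiscreteKKT {s : ℕ} (M : PeerTriplet s) (y₀ : EuclideanSpace ℝ (Fin m))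
    (h : ℝ) (N : ℕ)
    (Y P : Fin (N + 1) → Fin s → EuclideanSpace ℝ (Fin m))
    (U : Fin (N + 1) → Fin s → EuclideanSpace ℝ (Fin d)) : Prop where
  start : ∀ i, kronApply (M.coefA N 0) (Y 0) i =
    M.a i • y₀ + h • kronApply (M.coefK N 0) (fun j => f (Y 0 j, U 0 j)) i
  state : ∀ (n : Fin N) (i : Fin s),
    kronApply (M.coefA N (n + 1)) (Y n.succ) i =
      kronApply (M.coefB N (n + 1)) (Y n.castSucc) i
        + h • kronApply (M.coefK N (n + 1)) (fun j => f (Y n.succ j, U n.succ j)) i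
  adjoint_end : ∀ i,
    kronApply (M.coefA N N)ᵀ (P (Fin.last N)) i =
      M.w i • gradient C (∑ k, M.w k • Y (Fin.last N) k)
        + h • adjY f (Y (Fin.last N) i) (kronApply (M.coefK N N)ᵀ (P (Fin.last N)) i)
            (U (Fin.last N) i)
  adjoint : ∀ (n : Fin N) (i : Fin s),
    kronApply (M.coefA N n)ᵀ (P n.castSucc) i =
      kronApply (M.coefB N (n + 1))ᵀ (P n.succ) i
        + h • adjY f (Y n.castSucc i) (kronApply (M.coefK N n)ᵀ (P n.castSucc) i)
            (U n.castSucc i)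
  control : ∀ (n : Fin (N + 1)) (i : Fin s),
    adjU f (Y n i) (kronApply (M.coefK N n)ᵀ (P n) i) (U n i) = 0

/-- The maximum over all steps and stages of the errors in state, adjoint and control is at most
`δ` (controls of active stages only; blind ones are not part of the discrete problem). -/
structure ErrorLE {s : ℕ} (M : PeerTriplet s)
    (y p : ℝ → EuclideanSpace ℝ (Fin m)) (u : ℝ → EuclideanSpace ℝ (Fin d))
    (h : ℝ) (N : ℕ)
    (Y P : Fin (N + 1) → Fin s → EuclideanSpace ℝ (Fin m))
    (U : Fin (N + 1) → Fin s → EuclideanSpace ℝ (Fin d)) (δ : ℝ) : Prop where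
  state : ∀ (n : Fin (N + 1)) (i : Fin s), ‖Y n i - y (M.node h n i)‖ ≤ δ
  adjoint : ∀ (n : Fin (N + 1)) (i : Fin s), ‖P n i - p (M.node h n i)‖ ≤ δ
  control : ∀ (n : Fin (N + 1)) (i : Fin s), M.Active N n i →
    ‖U n i - u (M.node h n i)‖ ≤ δ

end Problem

end

/-!
The discrete optimality system is a perturbation of a linear one: moving `h K_n F` and its transposed
counterpart to the right-hand side leaves the two linear recursions `A_n Y_n - B_n Y_{n-1} = ρ_n` and
`A_nᵀ P_n - B_{n+1}ᵀ P_{n+1} = ρ_n`, and the control equation is solved by a simplified Newton step with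
the inverse Hessians of the Hamiltonian along the continuous solution. In this form the system is a
fixed point equation, and the theorem follows from Banach's theorem in a box around the restriction of
`(y, p, u)` to the grid (`existsUnique_discreteKKT_of_contraction`). The ingredients are the following.

*Stability.* The order conditions of lowest order say that `A⁻¹ B` has the right eigenvector `𝟙` and
the left eigenvector `𝟙ᵀ A`, normalized by `𝟙ᵀ A 𝟙 = 1`. Deflating this eigenvalue leaves a matrix
`A⁻¹ B - 𝟙 𝟙ᵀ A` of spectral radius less than `1`, whose powers are summable. Hence, in the standard
steps, only the sums `𝟙ᵀ ρ_n` of the residuals accumulate, whereas the residuals themselves enter with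
a bounded factor (`StableStep.exists_bound`). The adjoint recursion is governed by the transposed
matrices and runs backwards in time.

*Consistency.* The order conditions are equalities of moments. A linear functional of the values of a
function and its derivative at the nodes whose moments of order at most `q` agree has a residual
`O(h^(q+1))` by Taylor's formula (`exists_functional_bound`). The stage residuals are `O(h^q)`, and by
superconvergence the sums `𝟙ᵀ ρ_n` gain one power of `h`; so the accumulated error is `O(h^q)`. By the
one-leg conditions the averages of the adjoint stages in the control equation are accurate of order
`q`, too.

*Contraction.* The maps have Lipschitz constants of size `T Λ₁` for the state, `T Λ₁`, `T Λ₂` and `Γ`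
for the adjoint, and `ω Λ₁`, `ω Λ₂` for the control. The first assumption on
`T` makes `T Λ₁` small. The other constants need not be small, but by the second assumption their
products along the cycles `Y → U → Y` and `Y → P → U → Y` are. In norms with suitable weights
`w₁, w₂, 1` of the components the map then contracts by `1 / 2` (`exists_weights`,
`weightedLE_fixedPointMap`).

*Blind stages.* If a column sum of `K_n` vanishes then so does the whole column, since `K` is diagonal
and the exceptional column of `K₀` is zero. The control of such a stage has no influence; it is
prescribed in the fixed point map.
-/

noncomputable section

/-! ### Sequences governed by a power bounded matrix -/

/-- The sum of the moduli of the entries, used as a matrix norm. -/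
def absSum {s : ℕ} (A : Matrix (Fin s) (Fin s) ℝ) : ℝ := ∑ i, ∑ j, |A i j|

section Kron

variable {s m : ℕ}

lemma absSum_nonneg (A : Matrix (Fin s) (Fin s) ℝ) : 0 ≤ absSum A :=
  Finset.sum_nonneg fun _ _ => Finset.sum_nonneg fun _ _ => abs_nonneg _

lemma sum_abs_row_le_absSum (A : Matrix (Fin s) (Fin s) ℝ) (i : Fin s) :
    ∑ j, |A i j| ≤ absSum A :=
  Finset.single_le_sum (f := fun i => ∑ j, |A i j|)
    (fun _ _ => Finset.sum_nonneg fun _ _ => abs_nonneg _) (Finset.mem_univ i)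

lemma absSum_mul_le (A B : Matrix (Fin s) (Fin s) ℝ) :
    absSum (A * B) ≤ absSum A * absSum B := by
  calc absSum (A * B) ≤ ∑ i, ∑ j, ∑ k, |A i k| * |B k j| := by
        refine Finset.sum_le_sum fun i _ => Finset.sum_le_sum fun j _ => ?_
        rw [Matrix.mul_apply]
        refine (Finset.abs_sum_le_sum_abs _ _).trans (le_of_eq ?_)
        exact Finset.sum_congr rfl fun k _ => abs_mul _ _
    _ = ∑ i, ∑ k, |A i k| * ∑ j, |B k j| := by
        refine Finset.sum_congr rfl fun i _ => ?_
        rw [Finset.sum_comm]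
        exact Finset.sum_congr rfl fun k _ => (Finset.mul_sum _ _ _).symm
    _ ≤ ∑ i, ∑ k, |A i k| * absSum B :=
        Finset.sum_le_sum fun i _ => Finset.sum_le_sum fun k _ =>
          mul_le_mul_of_nonneg_left (sum_abs_row_le_absSum B k) (abs_nonneg _)
    _ = absSum A * absSum B := by
        simp only [absSum, Finset.sum_mul]

lemma absSum_transpose (A : Matrix (Fin s) (Fin s) ℝ) : absSum Aᵀ = absSum A :=
  Finset.sum_comm

lemma kronApply_mul (A B : Matrix (Fin s) (Fin s) ℝ) (Y : Fin s → EuclideanSpace ℝ (Fin m)) :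
    kronApply (A * B) Y = kronApply A (kronApply B Y) := by
  funext i
  simp only [kronApply, Matrix.mul_apply, Finset.sum_smul, Finset.smul_sum, smul_smul]
  exact Finset.sum_comm

lemma kronApply_one (Y : Fin s → EuclideanSpace ℝ (Fin m)) :
    kronApply (1 : Matrix (Fin s) (Fin s) ℝ) Y = Y := by
  funext i
  simp [kronApply, Matrix.one_apply, ite_smul]

lemma kronApply_add (A : Matrix (Fin s) (Fin s) ℝ) (Y Z : Fin s → EuclideanSpace ℝ (Fin m)) :
    kronApply A (Y + Z) = kronApply A Y + kronApply A Z := by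
  funext i
  simp [kronApply, Finset.sum_add_distrib]

lemma kronApply_sub (A : Matrix (Fin s) (Fin s) ℝ) (Y Z : Fin s → EuclideanSpace ℝ (Fin m)) :
    kronApply A (Y - Z) = kronApply A Y - kronApply A Z := by
  funext i
  simp [kronApply, smul_sub, Finset.sum_sub_distrib]

lemma kronApply_smul (A : Matrix (Fin s) (Fin s) ℝ) (t : ℝ)
    (Y : Fin s → EuclideanSpace ℝ (Fin m)) :
    kronApply A (t • Y) = t • kronApply A Y := by
  funext i
  simp [kronApply, Finset.smul_sum, smul_comm t]

lemma kronApply_sub_matrix (A B : Matrix (Fin s) (Fin s) ℝ)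
    (Y : Fin s → EuclideanSpace ℝ (Fin m)) :
    kronApply (A - B) Y = kronApply A Y - kronApply B Y := by
  funext i
  simp [kronApply, sub_smul, Finset.sum_sub_distrib]

lemma norm_sum_smul_le {ι F : Type*} [NormedAddCommGroup F] [NormedSpace ℝ F]
    (t : Finset ι) (α : ι → ℝ) (v : ι → F) (b : ℝ) (hv : ∀ i ∈ t, ‖v i‖ ≤ b) :
    ‖∑ i ∈ t, α i • v i‖ ≤ (∑ i ∈ t, |α i|) * b := by
  rw [Finset.sum_mul]
  refine (norm_sum_le _ _).trans (Finset.sum_le_sum fun i hi => ?_)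
  rw [norm_smul, Real.norm_eq_abs]
  exact mul_le_mul_of_nonneg_left (hv i hi) (abs_nonneg _)

lemma norm_kronApply_apply_le (A : Matrix (Fin s) (Fin s) ℝ)
    (Y : Fin s → EuclideanSpace ℝ (Fin m)) {b : ℝ} (hb : 0 ≤ b) (hY : ∀ j, ‖Y j‖ ≤ b)
    (i : Fin s) : ‖kronApply A Y i‖ ≤ absSum A * b :=
  (norm_sum_smul_le _ _ _ b fun j _ => hY j).trans
    (mul_le_mul_of_nonneg_right (sum_abs_row_le_absSum A i) hb)

lemma norm_kronApply_le (A : Matrix (Fin s) (Fin s) ℝ)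
    (Y : Fin s → EuclideanSpace ℝ (Fin m)) : ‖kronApply A Y‖ ≤ absSum A * ‖Y‖ :=
  (pi_norm_le_iff_of_nonneg (mul_nonneg (absSum_nonneg A) (norm_nonneg Y))).2 fun i =>
    norm_kronApply_apply_le A Y (norm_nonneg _) (norm_le_pi_norm Y) i

end Kron

/-- The standard step `A Z_k = B Z_{k-1} + R_k` of a recursion is *stable*: it preserves constants,
forward and adjoint, is normalised, and after removal of the eigenvalue `1` of `A⁻¹ B`, with
right eigenvector `𝟙` and left eigenvector `𝟙ᵀ A`, the powers are summable. -/
structure StableStep {s : ℕ} (A B : Matrix (Fin s) (Fin s) ℝ) : Prop where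
  det_ne : A.det ≠ 0
  row_sum : ∀ i, ∑ j, A i j = ∑ j, B i j
  col_sum : ∀ j, ∑ i, A i j = ∑ i, B i j
  total : ∑ i, ∑ j, A i j = 1
  summable : Summable fun k : ℕ => absSum ((A⁻¹ * B - Matrix.of fun _ j => ∑ i, A i j) ^ k)

/-- If `Q 𝟙 = 𝟙` and `vᵀ 𝟙 = 1`, then `Q - 𝟙 vᵀ` has the eigenvalue `0` in place of the eigenvalue `1`
of `Q`. This follows from `z - Q + 𝟙 vᵀ = (z - Q) (1 + (z - 1)⁻¹ 𝟙 vᵀ)` by taking determinants. -/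
lemma eval_charpoly_deflate {s : ℕ} (Q : Matrix (Fin s) (Fin s) ℂ) (v : Fin s → ℂ)
    (hQ : ∀ i, ∑ j, Q i j = 1) (hv : ∑ j, v j = 1) (z : ℂ) (hz : z ≠ 1) :
    (Q - Matrix.of fun _ j => v j).charpoly.eval z * (z - 1) = z * Q.charpoly.eval z := by
  have hz' : z - 1 ≠ 0 := sub_ne_zero.2 hz
  have key : Matrix.scalar (Fin s) z - (Q - Matrix.of fun _ j => v j) =
      (Matrix.scalar (Fin s) z - Q) *
        (1 + Matrix.replicateCol Unit (fun _ : Fin s => (z - 1)⁻¹) * Matrix.replicateRow Unit v) := by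
    rw [mul_add, mul_one]
    ext i j
    have h1 : ((Matrix.scalar (Fin s) z - Q) *
        (Matrix.replicateCol Unit (fun _ : Fin s => (z - 1)⁻¹) *
          Matrix.replicateRow Unit v)) i j = v j := by
      simp only [Matrix.mul_apply, Matrix.sub_apply, Matrix.replicateCol_apply,
        Matrix.replicateRow_apply, Finset.univ_unique, Finset.sum_singleton, sub_mul,
        Finset.sum_sub_distrib, ← Finset.sum_mul, hQ, Matrix.scalar_apply, Matrix.diagonal_apply]
      simp
      field_simp
    rw [Matrix.add_apply, h1]
    simp
    ring
  rw [Matrix.eval_charpoly, Matrix.eval_charpoly, key, Matrix.det_mul,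
    Matrix.det_one_add_replicateCol_mul_replicateRow]
  have : v ⬝ᵥ (fun _ : Fin s => (z - 1)⁻¹) = (z - 1)⁻¹ := by
    simp [dotProduct, ← Finset.sum_mul, hv]
  rw [this]
  field_simp
  ring

lemma charpoly_deflate {s : ℕ} (Q : Matrix (Fin s) (Fin s) ℂ) (v : Fin s → ℂ)
    (hQ : ∀ i, ∑ j, Q i j = 1) (hv : ∑ j, v j = 1) :
    (Q - Matrix.of fun _ j => v j).charpoly * (Polynomial.X - Polynomial.C 1) =
      Polynomial.X * Q.charpoly := by
  refine Polynomial.eq_of_infinite_eval_eq _ _ ((Set.finite_singleton (1 : ℂ)).infinite_compl.mono ?_)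
  intro z hz
  simp only [Set.mem_ofPred_eq, Polynomial.eval_mul, Polynomial.eval_sub, Polynomial.eval_X,
    Polynomial.eval_C]
  exact eval_charpoly_deflate Q v hQ hv z hz

section Gelfand

attribute [local instance] Matrix.linftyOpNormedRing Matrix.linftyOpNormedAlgebra

/-- A complex matrix whose eigenvalues lie in the open unit disc has summable powers, by Gelfand's
formula. -/
lemma summable_norm_pow_of_spectrum {s : ℕ} (G : Matrix (Fin s) (Fin s) ℂ)
    (hG : ∀ z ∈ spectrum ℂ G, ‖z‖ < 1) (i j : Fin s) :
    Summable fun k : ℕ => ‖(G ^ k) i j‖ := by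
  have : Nonempty (Fin s) := ⟨i⟩
  have : CompleteSpace (Matrix (Fin s) (Fin s) ℂ) := FiniteDimensional.complete ℂ _
  have h1 : spectralRadius ℂ G < (1 : NNReal) :=
    spectrum.spectralRadius_lt_of_forall_lt G fun z hz => by
      exact_mod_cast hG z hz
  obtain ⟨θ, hθ1, hθ2⟩ := ENNReal.lt_iff_exists_nnreal_btwn.1 h1
  have hθ : θ < 1 := by exact_mod_cast hθ2
  have h2 := spectrum.pow_nnnorm_pow_one_div_tendsto_nhds_spectralRadius G
  have h3 := h2.eventually (gt_mem_nhds hθ1)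
  have h4 : ∀ᶠ n : ℕ in Filter.atTop, ‖‖(G ^ n) i j‖‖ ≤ (θ : ℝ) ^ n := by
    filter_upwards [h3, Filter.eventually_ge_atTop 1] with n hn hn1
    have hn0 : (n : ℝ) ≠ 0 := by positivity
    have h5 : (‖G ^ n‖₊ : ENNReal) ≤ (θ : ENNReal) ^ n := by
      have := ENNReal.rpow_le_rpow hn.le (Nat.cast_nonneg n : (0 : ℝ) ≤ n)
      rwa [← ENNReal.rpow_mul, one_div, inv_mul_cancel₀ hn0, ENNReal.rpow_one,
        ENNReal.rpow_natCast] at this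
    have h6 : ‖G ^ n‖₊ ≤ θ ^ n := by exact_mod_cast h5
    have h7 : ‖G ^ n‖ ≤ (θ : ℝ) ^ n := by exact_mod_cast h6
    rw [norm_norm]
    refine le_trans ?_ h7
    rw [Matrix.linfty_opNorm_def]
    refine le_trans ?_ (NNReal.coe_le_coe.2 (Finset.le_sup (Finset.mem_univ i)))
    push_cast
    exact Finset.single_le_sum (f := fun j => ‖(G ^ n) i j‖) (fun _ _ => norm_nonneg _)
      (Finset.mem_univ j)
  exact Summable.of_norm_bounded_eventually_nat
    (summable_geometric_of_lt_one θ.2 (by exact_mod_cast hθ)) h4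

end Gelfand

/-- If all eigenvalues of `Q` except one, with right eigenvector `𝟙`, have modulus at most `γ < 1`, then
the excepted eigenvalue is `1`, and after its deflation the powers are summable. -/
lemma summable_absSum_pow {s : ℕ} (Q : Matrix (Fin s) (Fin s) ℝ) (v : Fin s → ℝ)
    (hQ : ∀ i, ∑ j, Q i j = 1) (hv : ∑ j, v j = 1) {γ : ℝ} (hγ : γ < 1) (lam : ℂ)
    (S : Multiset ℂ) (hroots : (Q.map (algebraMap ℝ ℂ)).charpoly.roots = lam ::ₘ S)
    (hS : ∀ z ∈ S, ‖z‖ ≤ γ) :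
    Summable fun k : ℕ => absSum ((Q - Matrix.of fun _ j => v j) ^ k) := by
  set QC := Q.map (algebraMap ℝ ℂ) with hQC
  set G := QC - Matrix.of fun _ j => (v j : ℂ) with hGdef
  have hpoly := charpoly_deflate QC (fun j => (v j : ℂ))
    (fun i => by simpa [hQC] using congrArg (fun x : ℝ => (x : ℂ)) (hQ i))
    (by simpa using congrArg (fun x : ℝ => (x : ℂ)) hv)
  have hG0 : G.charpoly ≠ 0 := G.charpoly_monic.ne_zero
  have hQ0 : QC.charpoly ≠ 0 := QC.charpoly_monic.ne_zero
  have hr := congrArg Polynomial.roots hpoly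
  rw [Polynomial.roots_mul (mul_ne_zero hG0 (Polynomial.X_sub_C_ne_zero _)),
    Polynomial.roots_mul (mul_ne_zero Polynomial.X_ne_zero hQ0), Polynomial.roots_X_sub_C,
    Polynomial.roots_X, hroots] at hr
  have h1S : (1 : ℂ) ∉ S := fun h => by
    have := hS 1 h
    rw [norm_one] at this
    linarith
  have hr' : G.charpoly.roots + {1} = {0} + S + {lam} := by
    rw [hr, add_assoc, ← Multiset.singleton_add, add_comm {lam} S]
  have hlam : lam = 1 := by
    have h1 : (1 : ℂ) ∈ ({0} + S + {lam} : Multiset ℂ) := by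
      rw [← hr']; simp
    simp only [Multiset.mem_add, Multiset.mem_singleton, one_ne_zero, false_or] at h1
    exact (h1.resolve_left h1S).symm
  rw [hlam] at hr'
  have hr2 : G.charpoly.roots = {0} + S := add_right_cancel hr'
  have hspec : ∀ z ∈ spectrum ℂ G, ‖z‖ < 1 := by
    intro z hz
    rw [Matrix.mem_spectrum_iff_isRoot_charpoly, ← Polynomial.mem_roots hG0, hr2] at hz
    rcases Multiset.mem_add.1 hz with h | h
    · rw [Multiset.mem_singleton.1 h]; simp
    · exact (hS z h).trans_lt hγ
  have hmap : G = (Q - Matrix.of fun _ j => v j).map (algebraMap ℝ ℂ) := by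
    ext i j; simp [hGdef, hQC]
  refine summable_sum fun i _ => summable_sum fun j _ => ?_
  refine (summable_norm_pow_of_spectrum G hspec i j).congr fun k => ?_
  rw [hmap, ← Matrix.map_pow, Matrix.map_apply]
  simp

/-- The step with transposed matrices, which governs the adjoint recursion, is stable, too. -/
lemma StableStep.transpose {s : ℕ} {A B : Matrix (Fin s) (Fin s) ℝ} (h : StableStep A B) :
    StableStep Aᵀ Bᵀ := by
  have hu : IsUnit A.det := isUnit_iff_ne_zero.2 h.det_ne
  have hut : IsUnit Aᵀ.det := by rwa [Matrix.det_transpose]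
  refine ⟨by rw [Matrix.det_transpose]; exact h.det_ne, h.col_sum, h.row_sum, ?_, ?_⟩
  · rw [← h.total]; exact Finset.sum_comm
  set G := A⁻¹ * B - Matrix.of fun _ j => ∑ i, A i j with hG
  have hconj : ∀ k : ℕ, (Aᵀ⁻¹ * Bᵀ - Matrix.of fun _ j => ∑ i, Aᵀ i j) ^ k =
      Aᵀ⁻¹ * (G ^ k)ᵀ * Aᵀ := by
    have h1 : (Aᵀ⁻¹ * Bᵀ - Matrix.of fun _ j => ∑ i, Aᵀ i j) = Aᵀ⁻¹ * Gᵀ * Aᵀ := by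
      have e1 : Gᵀ * Aᵀ = Bᵀ - Matrix.of fun i j => (∑ k, A k i) * (∑ k, A j k) := by
        rw [← Matrix.transpose_mul, hG, mul_sub, ← mul_assoc, Matrix.mul_nonsing_inv A hu, one_mul]
        ext i j
        simp [Matrix.mul_apply, ← Finset.sum_mul, mul_comm]
      have e2 : (Matrix.of fun i j => (∑ k, A k i) * (∑ k, A j k)) =
          Aᵀ * Matrix.of fun _ j => ∑ i, Aᵀ i j := by
        ext i j
        simp [Matrix.mul_apply, ← Finset.sum_mul]
      rw [mul_assoc, e1, mul_sub, e2, ← mul_assoc, Matrix.nonsing_inv_mul _ hut, one_mul]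
    intro k
    induction k with
    | zero => simp [Matrix.nonsing_inv_mul _ hut]
    | succ k ih =>
      rw [pow_succ, ih, h1, pow_succ', Matrix.transpose_mul]
      calc Aᵀ⁻¹ * (G ^ k)ᵀ * Aᵀ * (Aᵀ⁻¹ * Gᵀ * Aᵀ)
          = Aᵀ⁻¹ * (G ^ k)ᵀ * (Aᵀ * Aᵀ⁻¹) * Gᵀ * Aᵀ := by simp only [mul_assoc]
        _ = Aᵀ⁻¹ * ((G ^ k)ᵀ * Gᵀ) * Aᵀ := by
            rw [Matrix.mul_nonsing_inv _ hut, mul_one]; simp only [mul_assoc]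
  refine Summable.of_nonneg_of_le (fun _ => absSum_nonneg _) (fun k => ?_)
    ((h.summable.mul_left (absSum Aᵀ⁻¹)).mul_right (absSum Aᵀ))
  rw [hconj k]
  refine (absSum_mul_le _ _).trans (mul_le_mul_of_nonneg_right ?_ (absSum_nonneg _))
  refine (absSum_mul_le _ _).trans (le_of_eq ?_)
  rw [absSum_transpose]

/-! ### Stability of the linear recursion -/

/-- Powers of `G` applied to the iterates of `x_{k+1} = G x_k + r_k`; the bound is set up such that
the induction over `k` closes for all powers simultaneously. -/
lemma norm_kronApply_pow_recursion_le {s m : ℕ} (G : Matrix (Fin s) (Fin s) ℝ)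
    (x r : ℕ → Fin s → EuclideanSpace ℝ (Fin m)) {b : ℝ} {K : ℕ}
    (hx : ‖x 0‖ ≤ b) (hr : ∀ k < K, ‖r k‖ ≤ b)
    (hrec : ∀ k < K, x (k + 1) = kronApply G (x k) + r k) (k : ℕ) (hk : k ≤ K) (j : ℕ) :
    ‖kronApply (G ^ j) (x k)‖ ≤ (∑ l ∈ Finset.Ico j (j + k + 1), absSum (G ^ l)) * b := by
  have hpow : ∀ (j : ℕ) (y : Fin s → EuclideanSpace ℝ (Fin m)), ‖y‖ ≤ b →
      ‖kronApply (G ^ j) y‖ ≤ absSum (G ^ j) * b := fun j y hy =>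
    (norm_kronApply_le _ _).trans (mul_le_mul_of_nonneg_left hy (absSum_nonneg _))
  induction k generalizing j with
  | zero => simpa using hpow j _ hx
  | succ k ih =>
    rw [hrec k hk, kronApply_add, ← kronApply_mul, ← pow_succ,
      Finset.sum_eq_sum_Ico_succ_bot (by omega), add_mul, add_comm (_ * b)]
    refine (norm_add_le _ _).trans (add_le_add ?_ (hpow j _ (hr k hk)))
    have := ih (by omega) (j + 1)
    rwa [show j + (k + 1) + 1 = j + 1 + k + 1 by ring]

lemma kronApply_inv_of_eq {s m : ℕ} {A : Matrix (Fin s) (Fin s) ℝ} (hA : A.det ≠ 0)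
    {Y R : Fin s → EuclideanSpace ℝ (Fin m)} (h : kronApply A Y = R) :
    Y = kronApply A⁻¹ R := by
  rw [← h, ← kronApply_mul, Matrix.nonsing_inv_mul _ (isUnit_iff_ne_zero.2 hA), kronApply_one]

set_option maxHeartbeats 800000 in
/-- Stability of a recursion whose standard step is stable and whose first and last steps are
arbitrary. The component along `𝟙` only accumulates the sums `𝟙ᵀ R_k`, since `𝟙ᵀ A` is a left
eigenvector of `A⁻¹ B`; the remainder is damped, so that the `R_k` themselves enter without
accumulation. -/
theorem StableStep.exists_bound {s : ℕ} {A B : Matrix (Fin s) (Fin s) ℝ} (h : StableStep A B)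
    {As Bs Ae : Matrix (Fin s) (Fin s) ℝ} (hAs : As.det ≠ 0) (hAe : Ae.det ≠ 0)
    (Be : Matrix (Fin s) (Fin s) ℝ) :
    ∃ κ : ℝ, 0 < κ ∧ ∀ (m N : ℕ), 2 ≤ N → ∀ (Z R : ℕ → Fin s → EuclideanSpace ℝ (Fin m))
      (ρ σ : ℝ), kronApply As (Z 0) = R 0 → kronApply A (Z 1) = kronApply Bs (Z 0) + R 1 →
      (∀ k, 2 ≤ k → k < N → kronApply A (Z k) = kronApply B (Z (k - 1)) + R k) →
      kronApply Ae (Z N) = kronApply Be (Z (N - 1)) + R N →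
      (∀ k ≤ N, ‖R k‖ ≤ ρ) → ∑ k ∈ Finset.Ico 2 N, ‖∑ i, R k i‖ ≤ σ →
      ∀ k ≤ N, ‖Z k‖ ≤ κ * (ρ + σ) := by
  set G := A⁻¹ * B - Matrix.of fun _ j => ∑ i, A i j with hG
  set D := A⁻¹ - Matrix.of (fun _ _ : Fin s => (1 : ℝ)) with hD
  set g := ∑' k, absSum (G ^ k) with hg
  have hg0 : 0 ≤ g := tsum_nonneg fun _ => absSum_nonneg _
  -- bounds for `Z 0`, `Z 1`, the component along `𝟙` and all inner `Z k`
  set c0 := absSum As⁻¹ with hc0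
  set c1 := absSum A⁻¹ * (absSum Bs * c0 + 1) with hc1
  set c2 := s * (absSum A * c1) with hc2
  set c3 := g * (c1 + c2 + absSum D) + c2 + 1 with hc3
  set c4 := absSum Ae⁻¹ * (absSum Be * c3 + 1) with hc4
  have p0 : 0 ≤ c0 := absSum_nonneg _
  have pA := absSum_nonneg A
  have pD := absSum_nonneg D
  have pBe := absSum_nonneg Be
  have pAe := absSum_nonneg Ae⁻¹
  have p1 : 0 ≤ c1 := mul_nonneg (absSum_nonneg _)
    (add_nonneg (mul_nonneg (absSum_nonneg _) p0) zero_le_one)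
  have p2 : 0 ≤ c2 := by positivity
  have p3 : 0 ≤ c3 := by positivity
  have p4 : 0 ≤ c4 := by positivity
  refine ⟨c0 + c1 + c3 + c4 + 1, by positivity, ?_⟩
  intro m N hN Z R ρ σ h0 h1 hstd hend hR hσ
  have hρ : 0 ≤ ρ := (norm_nonneg _).trans (hR 0 (Nat.zero_le _))
  have hσ0 : 0 ≤ σ := (Finset.sum_nonneg fun _ _ => norm_nonneg _).trans hσ
  have hZ0 : ‖Z 0‖ ≤ c0 * ρ := by
    rw [kronApply_inv_of_eq hAs h0]
    exact (norm_kronApply_le _ _).trans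
      (mul_le_mul_of_nonneg_left (hR 0 (Nat.zero_le _)) (absSum_nonneg _))
  have hZ1 : ‖Z 1‖ ≤ c1 * ρ := by
    rw [kronApply_inv_of_eq h.det_ne h1, hc1, mul_assoc]
    refine (norm_kronApply_le _ _).trans (mul_le_mul_of_nonneg_left ?_ (absSum_nonneg _))
    refine (norm_add_le _ _).trans ?_
    rw [add_mul, one_mul, mul_assoc]
    exact add_le_add ((norm_kronApply_le _ _).trans
      (mul_le_mul_of_nonneg_left hZ0 (absSum_nonneg _))) (hR 1 (by omega))
  -- the component along `𝟙`
  set S : (Fin s → EuclideanSpace ℝ (Fin m)) → EuclideanSpace ℝ (Fin m) :=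
    fun Y => ∑ j, (∑ i, A i j) • Y j with hS
  have hSA : ∀ Y, S Y = ∑ i, kronApply A Y i := fun Y => by
    simp only [hS, kronApply, Finset.sum_smul]
    exact Finset.sum_comm
  have hSB : ∀ Y, ∑ i, kronApply B Y i = S Y := fun Y => by
    simp only [hS, h.col_sum, kronApply, Finset.sum_smul]
    exact Finset.sum_comm
  have hSstep : ∀ k, 2 ≤ k → k < N → S (Z k) = S (Z (k - 1)) + ∑ i, R k i := by
    intro k hk hkN
    rw [hSA, hstd k hk hkN, ← hSB]
    simp [Finset.sum_add_distrib]
  have hS1 : ‖S (Z 1)‖ ≤ c2 * ρ := by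
    rw [hSA]
    refine (norm_sum_le_of_le _ (f := fun i => kronApply A (Z 1) i)
      (n := fun _ => absSum A * (c1 * ρ)) fun i _ => ?_).trans (le_of_eq ?_)
    · exact norm_kronApply_apply_le A _ (by positivity)
        (fun j => (norm_le_pi_norm _ j).trans hZ1) i
    · simp [hc2]; ring
  have hSk : ∀ k, 1 ≤ k → k < N → ‖S (Z k)‖ ≤ c2 * ρ + ∑ l ∈ Finset.Ico 2 (k + 1), ‖∑ i, R l i‖ := by
    intro k hk
    induction k, hk using Nat.le_induction with
    | base => intro _; simpa using hS1
    | succ k hk ih =>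
      intro hkN
      rw [hSstep (k + 1) (by omega) hkN, Finset.sum_Ico_succ_top (by omega), ← add_assoc]
      refine (norm_add_le _ _).trans (add_le_add ?_ le_rfl)
      simpa using ih (by omega)
  have hSk' : ∀ k, 1 ≤ k → k < N → ‖S (Z k)‖ ≤ c2 * ρ + σ := fun k hk hkN =>
    (hSk k hk hkN).trans (add_le_add le_rfl (le_trans
      (Finset.sum_le_sum_of_subset_of_nonneg (Finset.Ico_subset_Ico le_rfl hkN)
        fun _ _ _ => norm_nonneg _) hσ))
  -- the damped remainder
  set x : ℕ → Fin s → EuclideanSpace ℝ (Fin m) := fun k => Z (k + 1) - fun _ => S (Z (k + 1)) with hx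
  have hconst : ∀ (Q : Matrix (Fin s) (Fin s) ℝ) (t : EuclideanSpace ℝ (Fin m)),
      kronApply Q (fun _ => t) = fun i => (∑ j, Q i j) • t := fun Q t => by
    funext i; simp [kronApply, Finset.sum_smul]
  have hu : IsUnit A.det := isUnit_iff_ne_zero.2 h.det_ne
  have hGconst : ∀ t : EuclideanSpace ℝ (Fin m), kronApply G (fun _ => t) = 0 := by
    intro t
    have hAB : kronApply B (fun _ => t) = kronApply A (fun _ => t) := by
      rw [hconst, hconst]; funext i; rw [h.row_sum]
    have htot : ∑ j, ∑ i, A i j = 1 := by rw [Finset.sum_comm]; exact h.total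
    rw [hG, kronApply_sub_matrix, kronApply_mul, hAB, ← kronApply_mul,
      Matrix.nonsing_inv_mul _ hu, kronApply_one, hconst]
    funext i
    simp [htot]
  have hxrec : ∀ k < N - 2, x (k + 1) = kronApply G (x k) + kronApply D (R (k + 2)) := by
    intro k hk
    have e1 : Z (k + 2) = kronApply A⁻¹ (kronApply B (Z (k + 1)) + R (k + 2)) :=
      kronApply_inv_of_eq h.det_ne (hstd (k + 2) (by omega) (by omega))
    have e2 : S (Z (k + 2)) = S (Z (k + 1)) + ∑ i, R (k + 2) i :=
      hSstep (k + 2) (by omega) (by omega)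
    simp only [hx]
    rw [kronApply_sub, hGconst, sub_zero, e2]
    conv_lhs => rw [e1]
    rw [hG, hD, kronApply_sub_matrix, kronApply_sub_matrix, kronApply_add, kronApply_mul]
    funext i
    simp only [Pi.sub_apply, Pi.add_apply]
    have e3 : kronApply (Matrix.of fun _ j => ∑ i, A i j) (Z (k + 1)) i = S (Z (k + 1)) := rfl
    have e4 : kronApply (Matrix.of fun _ _ : Fin s => (1 : ℝ)) (R (k + 2)) i = ∑ i, R (k + 2) i := by
      simp [kronApply]
    rw [e3, e4]
    abel
  have hinner : ∀ k, 1 ≤ k → k < N → ‖Z k‖ ≤ c3 * (ρ + σ) := by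
    intro k hk hkN
    obtain ⟨l, rfl⟩ : ∃ l, k = l + 1 := ⟨k - 1, by omega⟩
    have hb := norm_kronApply_pow_recursion_le G x (fun k => kronApply D (R (k + 2)))
      (b := (c1 + c2 + absSum D) * ρ) (K := N - 2) ?_ ?_ hxrec l (by omega) 0
    · rw [pow_zero, kronApply_one] at hb
      have hsum : ∑ l ∈ Finset.Ico 0 (0 + l + 1), absSum (G ^ l) ≤ g :=
        h.summable.sum_le_tsum _ fun _ _ => absSum_nonneg _
      have hxl : ‖x l‖ ≤ g * ((c1 + c2 + absSum D) * ρ) :=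
        hb.trans (mul_le_mul_of_nonneg_right hsum (by positivity))
      have hsplit : Z (l + 1) = x l + fun _ => S (Z (l + 1)) := by simp [hx]
      have hcst : ‖(fun _ : Fin s => S (Z (l + 1)))‖ ≤ c2 * ρ + σ :=
        (pi_norm_le_iff_of_nonneg (by positivity)).2 fun _ => hSk' (l + 1) hk hkN
      calc ‖Z (l + 1)‖ ≤ ‖x l‖ + ‖(fun _ : Fin s => S (Z (l + 1)))‖ := by
            conv_lhs => rw [hsplit]
            exact norm_add_le _ _
        _ ≤ g * ((c1 + c2 + absSum D) * ρ) + (c2 * ρ + σ) := add_le_add hxl hcst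
        _ ≤ c3 * (ρ + σ) := by
            have h5 : 0 ≤ (g * (c1 + c2 + absSum D) + c2) * σ := by positivity
            have h6 : c3 * (ρ + σ) = g * ((c1 + c2 + absSum D) * ρ) + c2 * ρ + ρ
                + (g * (c1 + c2 + absSum D) + c2) * σ + σ := by rw [hc3]; ring
            linarith
    · simp only [hx]
      refine (norm_sub_le _ _).trans ?_
      have hcst : ‖(fun _ : Fin s => S (Z (0 + 1)))‖ ≤ c2 * ρ :=
        (pi_norm_le_iff_of_nonneg (by positivity)).2 fun _ => hS1
      have : 0 ≤ absSum D * ρ := by positivity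
      calc _ ≤ c1 * ρ + c2 * ρ := add_le_add hZ1 hcst
        _ ≤ _ := by linarith
    · intro k hk
      refine (norm_kronApply_le _ _).trans ?_
      have := mul_le_mul_of_nonneg_left (hR (k + 2) (by omega)) pD
      have : 0 ≤ (c1 + c2) * ρ := by positivity
      linarith
  have hρσ : 0 ≤ ρ + σ := by positivity
  have hZN : ‖Z N‖ ≤ c4 * (ρ + σ) := by
    rw [kronApply_inv_of_eq hAe hend, hc4, mul_assoc]
    refine (norm_kronApply_le _ _).trans (mul_le_mul_of_nonneg_left ?_ (absSum_nonneg _))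
    refine (norm_add_le _ _).trans ?_
    rw [add_mul, one_mul, mul_assoc]
    exact add_le_add ((norm_kronApply_le _ _).trans
      (mul_le_mul_of_nonneg_left (hinner (N - 1) (by omega) (by omega)) (absSum_nonneg _)))
      ((hR N le_rfl).trans (by linarith))
  have mono : ∀ {c t : ℝ}, t ≤ c * (ρ + σ) → c ≤ c0 + c1 + c3 + c4 + 1 →
      t ≤ (c0 + c1 + c3 + c4 + 1) * (ρ + σ) := fun ht hc =>
    ht.trans (mul_le_mul_of_nonneg_right hc hρσ)
  intro k hk
  rcases Nat.eq_zero_or_pos k with rfl | hk0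
  · exact mono (hZ0.trans (mul_le_mul_of_nonneg_left (by linarith) p0)) (by linarith)
  rcases hk.lt_or_eq with hlt | rfl
  · exact mono (hinner k hk0 hlt) (by linarith)
  · exact mono hZN (by linarith)

/-! ### Order conditions as moment conditions -/

section Moments

variable {s : ℕ}

lemma vandermondeV_mul_nilpotentE (c : Fin s → ℝ) (k : ℕ) (i : Fin s) (l : Fin k) :
    (vandermondeV c k * nilpotentE k) i l = (l : ℕ) * c i ^ ((l : ℕ) - 1) := by
  simp only [Matrix.mul_apply, vandermondeV, nilpotentE, Matrix.of_apply]
  rcases Nat.eq_zero_or_pos (l : ℕ) with h | h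
  · simp [h]
  · rw [Finset.sum_eq_single (⟨(l : ℕ) - 1, by omega⟩ : Fin k)]
    · simp [Nat.sub_add_cancel h, mul_comm]
    · intro b _ hb
      rw [if_neg, mul_zero]
      intro hb'
      exact hb (Fin.ext (by simp; omega))
    · simp

lemma vandermondeV_mul_pascalP (c : Fin s → ℝ) (k : ℕ) :
    vandermondeV c k * pascalP k = vandermondeV (fun i => c i + 1) k := by
  ext i l
  simp only [Matrix.mul_apply, vandermondeV, pascalP, Matrix.of_apply, add_pow, one_pow, mul_one]
  rw [Fin.sum_univ_eq_sum_range (fun x => c i ^ x * (((l : ℕ).choose x : ℕ) : ℝ)) k]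
  refine (Finset.sum_subset (Finset.range_mono l.2) fun x _ hx => ?_).symm
  rw [Nat.choose_eq_zero_of_lt (by simpa using hx)]
  simp

lemma isUnit_det_pascalP (k : ℕ) : IsUnit (pascalP k).det := by
  rw [Matrix.det_of_isUpperTriangular]
  · simp [pascalP]
  · intro i j hij
    simp only [pascalP, Matrix.of_apply]
    rw [Nat.choose_eq_zero_of_lt (by simpa using hij)]
    simp

lemma vandermondeV_mul_pascalP_inv (c : Fin s → ℝ) (k : ℕ) :
    vandermondeV c k * (pascalP k)⁻¹ = vandermondeV (fun i => c i - 1) k := by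
  have h := vandermondeV_mul_pascalP (fun i => c i - 1) k
  simp only [sub_add_cancel] at h
  rw [← h, Matrix.mul_assoc, Matrix.mul_nonsing_inv _ (isUnit_det_pascalP k), Matrix.mul_one]

lemma moment_of_forward {A B K : Matrix (Fin s) (Fin s) ℝ} {c : Fin s → ℝ} {r : ℕ}
    (h : A * vandermondeV c r =
      B * vandermondeV c r * (pascalP r)⁻¹ + K * vandermondeV c r * nilpotentE r)
    {l : ℕ} (hl : l < r) (i : Fin s) :
    ∑ j, A i j * c j ^ l =
      ∑ j, B i j * (c j - 1) ^ l + l * ∑ j, K i j * c j ^ (l - 1) := by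
  rw [Matrix.mul_assoc, vandermondeV_mul_pascalP_inv, Matrix.mul_assoc] at h
  have h2 := congrFun (congrFun h i) ⟨l, hl⟩
  rw [Matrix.add_apply, Matrix.mul_apply, Matrix.mul_apply, Matrix.mul_apply] at h2
  simp only [vandermondeV_mul_nilpotentE] at h2
  simp only [vandermondeV, Matrix.of_apply] at h2
  rw [h2, Finset.mul_sum]
  congr 1
  exact Finset.sum_congr rfl fun _ _ => by ring

lemma moment_of_adjoint {A B K : Matrix (Fin s) (Fin s) ℝ} {c : Fin s → ℝ} {q : ℕ}
    (h : Aᵀ * vandermondeV c q =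
      Bᵀ * vandermondeV c q * pascalP q - Kᵀ * vandermondeV c q * nilpotentE q)
    {l : ℕ} (hl : l < q) (i : Fin s) :
    ∑ j, A j i * c j ^ l =
      ∑ j, B j i * (c j + 1) ^ l - l * ∑ j, K j i * c j ^ (l - 1) := by
  rw [Matrix.mul_assoc, vandermondeV_mul_pascalP, Matrix.mul_assoc] at h
  have h2 := congrFun (congrFun h i) ⟨l, hl⟩
  rw [Matrix.sub_apply, Matrix.mul_apply, Matrix.mul_apply, Matrix.mul_apply] at h2
  simp only [vandermondeV_mul_nilpotentE] at h2
  simp only [vandermondeV, Matrix.of_apply, Matrix.transpose_apply] at h2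
  rw [h2, Finset.mul_sum]
  congr 1
  exact Finset.sum_congr rfl fun _ _ => by ring

end Moments

lemma OneLeg.moment {s q : ℕ} {c : Fin s → ℝ} {K : Matrix (Fin s) (Fin s) ℝ} (hK : OneLeg c q K)
    {l : ℕ} (hl : l < q) (i : Fin s) :
    ∑ j, K j i * c j ^ l = colSum K i * c i ^ l := by
  rcases Nat.eq_zero_or_pos l with rfl | hl0
  · simp [colSum]
  have := hK (l + 1) (by omega) (by omega) i
  rw [Nat.add_sub_cancel] at this
  rw [← this]
  exact Finset.sum_congr rfl fun _ _ => mul_comm _ _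

namespace PeerTriplet

variable {s q r : ℕ} {M : PeerTriplet s}

lemma moment_start (hord : M.OrderConditions q r) {l : ℕ} (hl : l < r) (i : Fin s) :
    ∑ j, M.A₀ i j * M.c j ^ l = M.a i * 0 ^ l + l * ∑ j, M.K₀ i j * M.c j ^ (l - 1) := by
  have h := hord.start_forward
  rw [Matrix.mul_assoc M.K₀] at h
  have h2 := congrFun (congrFun h i) ⟨l, hl⟩
  rw [Matrix.add_apply, Matrix.mul_apply, Matrix.mul_apply] at h2
  simp only [vandermondeV_mul_nilpotentE] at h2
  simp only [vandermondeV, Matrix.of_apply] at h2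
  rw [h2, Finset.mul_sum]
  congr 1
  · by_cases hl0 : l = 0 <;> simp [hl0]
  · exact Finset.sum_congr rfl fun _ _ => by ring

lemma moment_end_adjoint (hord : M.OrderConditions q r) {l : ℕ} (hl : l < q) (i : Fin s) :
    ∑ j, M.AN j i * M.c j ^ l = M.w i - l * ∑ j, M.KN j i * M.c j ^ (l - 1) := by
  have h := hord.end_adjoint
  rw [Matrix.mul_assoc M.KNᵀ] at h
  have h2 := congrFun (congrFun h i) ⟨l, hl⟩
  rw [Matrix.sub_apply, Matrix.mul_apply, Matrix.mul_apply] at h2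
  simp only [vandermondeV_mul_nilpotentE] at h2
  simp only [vandermondeV, Matrix.of_apply, Matrix.transpose_apply] at h2
  rw [h2, Finset.mul_sum]
  congr 1
  exact Finset.sum_congr rfl fun _ _ => by ring

lemma moment_end_forward (hord : M.OrderConditions q r) {l : ℕ} (hl : l < r) :
    ∑ i, M.w i * M.c i ^ l = 1 := hord.end_forward ⟨l, hl⟩

/-- The standard step is stable. That `𝟙ᵀ A 𝟙 = 1` is inherited from the end condition
`𝟙ᵀ AN 𝟙 = wᵀ 𝟙 = 1` through `𝟙ᵀ A 𝟙 = 𝟙ᵀ BN 𝟙 = 𝟙ᵀ AN 𝟙`. -/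
lemma stableStep (hq : 1 ≤ q) (hr : 1 ≤ r) (hM : M.Structural) (hord : M.OrderConditions q r)
    (hdamp : M.Damping) : StableStep M.A M.B := by
  have hrow : ∀ i, ∑ j, M.A i j = ∑ j, M.B i j := fun i => by
    simpa using moment_of_forward hord.standard_forward hr i
  have hcol : ∀ j, ∑ i, M.A i j = ∑ i, M.B i j := fun j => by
    simpa using moment_of_adjoint hord.standard_adjoint hq j
  have htot : ∑ i, ∑ j, M.A i j = 1 := by
    have h1 : ∀ j, ∑ i, M.A i j = ∑ i, M.BN i j := fun j => by
      simpa using moment_of_adjoint hord.last_adjoint hq j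
    have h2 : ∀ i, ∑ j, M.AN i j = ∑ j, M.BN i j := fun i => by
      simpa using moment_of_forward hord.last_forward hr i
    have h3 : ∀ j, ∑ i, M.AN i j = M.w j := fun j => by
      simpa using moment_end_adjoint hord hq j
    have h4 : ∑ i, M.w i = 1 := by simpa using moment_end_forward hord hr
    calc ∑ i, ∑ j, M.A i j = ∑ j, ∑ i, M.A i j := Finset.sum_comm
      _ = ∑ j, ∑ i, M.BN i j := Finset.sum_congr rfl fun j _ => h1 j
      _ = ∑ i, ∑ j, M.BN i j := Finset.sum_comm
      _ = ∑ i, ∑ j, M.AN i j := Finset.sum_congr rfl fun i _ => (h2 i).symm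
      _ = ∑ j, ∑ i, M.AN i j := Finset.sum_comm
      _ = 1 := by rw [← h4]; exact Finset.sum_congr rfl fun j _ => h3 j
  obtain ⟨γ, hγ, lam, S, hroots, hS⟩ := hdamp
  have hu : IsUnit M.A.det := isUnit_iff_ne_zero.2 hM.det_A
  refine ⟨hM.det_A, hrow, hcol, htot, summable_absSum_pow _ _ ?_ ?_ hγ lam S hroots hS⟩
  · have hB : M.B *ᵥ (fun _ => 1) = M.A *ᵥ (fun _ => 1) := by
      funext i
      simpa [Matrix.mulVec, dotProduct] using (hrow i).symm
    have : (M.A⁻¹ * M.B) *ᵥ (fun _ => 1) = fun _ => 1 := by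
      rw [← Matrix.mulVec_mulVec, hB, Matrix.mulVec_mulVec, Matrix.nonsing_inv_mul _ hu,
        Matrix.one_mulVec]
    intro i
    simpa [Matrix.mulVec, dotProduct] using congrFun this i
  · rw [Finset.sum_comm]; exact htot

/-- A diagonal matrix satisfies the one-leg conditions. -/
lemma oneLeg_K (hM : M.Structural) (q : ℕ) : OneLeg M.c q M.K := by
  intro l _ _ j
  rw [colSum, Finset.sum_eq_single j (fun i _ hi => by rw [hM.diag_K i j hi, mul_zero]) (by simp),
    Finset.sum_eq_single j (fun i _ hi => hM.diag_K i j hi) (by simp), mul_comm]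

lemma coefK_eq_zero_of_not_active (hM : M.Structural) (hpos : M.Positivity) {N n : ℕ} {j : Fin s}
    (h : ¬ M.Active N n j) (i : Fin s) : M.coefK N n i j = 0 := by
  have h' : colSum (M.coefK N n) j = 0 := not_not.1 h
  unfold coefK at h' ⊢
  split_ifs at h' ⊢
  · rcases hpos.start j with h1 | h1
    · exact absurd h' h1.ne'
    · exact h1.2.1 i
  · exact absurd h' (hpos.last j).ne'
  · by_cases hij : i = j
    · subst hij
      rwa [colSum, Finset.sum_eq_single i (fun k _ hk => hM.diag_K k i hk) (by simp)] at h'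
    · exact hM.diag_K i j hij

/-- Superconvergence: the sum of the forward residuals of a standard step has one more vanishing
moment. If `q < r`, this is already an order condition. -/
lemma moment_forward_sum (hqr : q ≤ r) (hord : M.OrderConditions q r)
    (hsup : M.Superconvergence q r) {l : ℕ} (hl : l < q + 1) :
    ∑ j, (∑ i, M.A i j) * M.c j ^ l = ∑ j, (∑ i, M.B i j) * (M.c j - 1) ^ l
      + l * ∑ j, (∑ i, M.K i j) * M.c j ^ (l - 1) := by
  have key : ∑ i, ∑ j, M.A i j * M.c j ^ l = ∑ i, (∑ j, M.B i j * (M.c j - 1) ^ l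
      + l * ∑ j, M.K i j * M.c j ^ (l - 1)) := by
    rcases lt_or_ge l r with h | h
    · exact Finset.sum_congr rfl fun i _ => moment_of_forward hord.standard_forward h i
    · obtain rfl : l = r := by omega
      rw [← sub_eq_zero, ← Finset.sum_sub_distrib, ← hsup.forward]
      refine Finset.sum_congr rfl fun i _ => ?_
      simp only [Pi.sub_apply, Pi.smul_apply, Matrix.mulVec, dotProduct, smul_eq_mul]
      ring
  rw [Finset.sum_add_distrib, ← Finset.mul_sum] at key
  simp only [Finset.sum_mul]
  rw [Finset.sum_comm, key, Finset.sum_comm]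
  congr 2
  exact Finset.sum_comm

/-- The adjoint counterpart of `moment_forward_sum`. The superconvergence condition is stated with `K`
instead of `Kᵀ`; both agree since `K` is diagonal. -/
lemma moment_adjoint_sum (hM : M.Structural) (hord : M.OrderConditions q r)
    (hsup : M.Superconvergence q r) {l : ℕ} (hl : l < q + 1) :
    ∑ j, (∑ i, M.A j i) * M.c j ^ l = ∑ j, (∑ i, M.B j i) * (M.c j + 1) ^ l
      - l * ∑ j, colSum M.K j * M.c j ^ (l - 1) := by
  have hcol : ∀ j, colSum M.K j = ∑ i, M.K j i := fun j => by
    rw [colSum, Finset.sum_eq_single j (fun i _ hi => hM.diag_K i j hi) (by simp),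
      Finset.sum_eq_single j (fun i _ hi => hM.diag_K j i hi.symm) (by simp)]
  simp only [hcol]
  have key : ∑ i, ∑ j, M.A j i * M.c j ^ l = ∑ i, (∑ j, M.B j i * (M.c j + 1) ^ l
      - l * ∑ j, M.K j i * M.c j ^ (l - 1)) := by
    rcases Nat.lt_succ_iff_lt_or_eq.1 hl with h | h
    · exact Finset.sum_congr rfl fun i _ => moment_of_adjoint hord.standard_adjoint h i
    · subst h
      have hK : M.Kᵀ = M.K := by
        ext i j
        rw [Matrix.transpose_apply]
        rcases eq_or_ne i j with rfl | hij
        · rfl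
        · rw [hM.diag_K i j hij, hM.diag_K j i hij.symm]
      have h3 := hsup.adjoint
      rw [← hK] at h3
      rw [← sub_eq_zero, ← Finset.sum_sub_distrib, ← h3]
      refine Finset.sum_congr rfl fun i _ => ?_
      simp only [Pi.sub_apply, Pi.add_apply, Pi.smul_apply, Matrix.mulVec, dotProduct, smul_eq_mul,
        Matrix.transpose_apply]
      ring
  rw [Finset.sum_sub_distrib, ← Finset.mul_sum] at key
  simp only [Finset.sum_mul]
  rw [Finset.sum_comm, key, Finset.sum_comm]
  congr 2
  exact Finset.sum_comm

end PeerTriplet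

/-! ### Consistency of linear functionals -/

section Taylor

variable {F : Type*} [NormedAddCommGroup F] [NormedSpace ℝ F]

/-- Taylor's formula for a tower of successive derivatives, with the base point anywhere in the
interval. -/
lemma norm_sub_taylor_le {a b : ℝ} {M : ℝ} (k : ℕ) (D : ℕ → ℝ → F)
    (hD : ∀ l < k, ∀ t ∈ Set.Icc a b, HasDerivWithinAt (D l) (D (l + 1) t) (Set.Icc a b) t)
    (hM : ∀ t ∈ Set.Icc a b, ‖D k t‖ ≤ M) {x₀ x : ℝ} (hx₀ : x₀ ∈ Set.Icc a b)
    (hx : x ∈ Set.Icc a b) :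
    ‖D 0 x - ∑ l ∈ Finset.range k, ((x - x₀) ^ l / (l.factorial : ℝ)) • D l x₀‖
      ≤ M * |x - x₀| ^ k := by
  have hM0 : 0 ≤ M := (norm_nonneg _).trans (hM x hx)
  induction k generalizing D x with
  | zero => simpa using hM x hx
  | succ k ih =>
    set g : ℝ → F := fun t => D 0 t -
      ∑ l ∈ Finset.range (k + 1), ((t - x₀) ^ l / (l.factorial : ℝ)) • D l x₀ with hg
    set g' : ℝ → F := fun t => D 1 t -
      ∑ l ∈ Finset.range k, ((t - x₀) ^ l / (l.factorial : ℝ)) • D (l + 1) x₀ with hg'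
    have hsub : Set.uIcc x₀ x ⊆ Set.Icc a b := Set.uIcc_subset_Icc hx₀ hx
    have hder : ∀ t ∈ Set.uIcc x₀ x, HasDerivWithinAt g (g' t) (Set.uIcc x₀ x) t := by
      intro t ht
      have h1 := (hD 0 (Nat.succ_pos k) t (hsub ht)).mono hsub
      have h2 : ∀ l : ℕ, HasDerivAt
          (fun t : ℝ => ((t - x₀) ^ (l + 1) / ((l + 1).factorial : ℝ)) • D (l + 1) x₀)
          (((t - x₀) ^ l / (l.factorial : ℝ)) • D (l + 1) x₀) t := by
        intro l
        have h3 := ((((hasDerivAt_id t).sub_const x₀).pow (l + 1)).div_const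
          ((l + 1).factorial : ℝ)).smul_const (D (l + 1) x₀)
        convert! h3 using 2
        have : (l.factorial : ℝ) ≠ 0 := by positivity
        have : ((l : ℝ) + 1) ≠ 0 := by positivity
        simp [Nat.factorial_succ]
        field_simp
      have h4 := HasDerivAt.fun_sum (u := Finset.range k) fun l _ => h2 l
      have h5 := h1.fun_sub ((h4.add_const (D 0 x₀)).hasDerivWithinAt (s := Set.uIcc x₀ x))
      refine h5.congr_of_eventuallyEq_of_mem (Filter.Eventually.of_forall fun t => ?_) ht
      simp only [hg]
      rw [Finset.sum_range_succ']
      simp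
    have hbound : ∀ t ∈ Set.uIcc x₀ x, ‖g' t‖ ≤ M * |x - x₀| ^ k := by
      intro t ht
      refine (ih (fun l => D (l + 1)) (fun l hl => hD (l + 1) (by omega)) hM (hsub ht)).trans ?_
      refine mul_le_mul_of_nonneg_left (pow_le_pow_left₀ (abs_nonneg _) ?_ k) hM0
      have := Set.abs_sub_left_of_mem_uIcc ht
      rwa [abs_sub_comm x x₀, abs_sub_comm t x₀, abs_sub_comm x₀ x] at *
    have hmv := (convex_uIcc x₀ x).norm_image_sub_le_of_norm_hasDerivWithin_le hder hbound
      Set.left_mem_uIcc Set.right_mem_uIcc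
    have hg0 : g x₀ = 0 := by
      simp only [hg]
      rw [Finset.sum_range_succ']
      simp
    rw [hg0, sub_zero] at hmv
    refine hmv.trans (le_of_eq ?_)
    rw [Real.norm_eq_abs, pow_succ, mul_assoc]

/-- A linear functional of values and derivatives whose moments of order at most `K` vanish is of
order `h ^ (K + 1)`. -/
lemma norm_functional_le {a b M : ℝ} (K : ℕ) (D : ℕ → ℝ → F)
    (hD : ∀ l < K + 1, ∀ t ∈ Set.Icc a b, HasDerivWithinAt (D l) (D (l + 1) t) (Set.Icc a b) t)
    (hM : ∀ t ∈ Set.Icc a b, ‖D (K + 1) t‖ ≤ M) {ι κ : Type} [Fintype ι] [Fintype κ]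
    (α θ : ι → ℝ) (β ϑ : κ → ℝ)
    (hmom : ∀ l < K + 1, ∑ i, α i * θ i ^ l + l * ∑ i, β i * ϑ i ^ (l - 1) = 0)
    {x h : ℝ} (hh : 0 ≤ h) (hx : x ∈ Set.Icc a b) (hθ : ∀ i, x + θ i * h ∈ Set.Icc a b)
    (hϑ : ∀ i, x + ϑ i * h ∈ Set.Icc a b) :
    ‖∑ i, α i • D 0 (x + θ i * h) + h • ∑ i, β i • D 1 (x + ϑ i * h)‖
      ≤ M * (∑ i, |α i| * |θ i| ^ (K + 1) + ∑ i, |β i| * |ϑ i| ^ K) * h ^ (K + 1) := by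
  have t1 : ∀ i, ‖D 0 (x + θ i * h) -
      ∑ l ∈ Finset.range (K + 1), ((θ i * h) ^ l / (l.factorial : ℝ)) • D l x‖
        ≤ M * (|θ i| * h) ^ (K + 1) := fun i => by
    have := norm_sub_taylor_le (K + 1) D hD hM hx (hθ i)
    rwa [add_sub_cancel_left, abs_mul, abs_of_nonneg hh] at this
  have t2 : ∀ i, ‖D 1 (x + ϑ i * h) -
      ∑ l ∈ Finset.range K, ((ϑ i * h) ^ l / (l.factorial : ℝ)) • D (l + 1) x‖
        ≤ M * (|ϑ i| * h) ^ K := fun i => by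
    have := norm_sub_taylor_le K (fun l => D (l + 1)) (fun l hl => hD (l + 1) (by omega)) hM hx (hϑ i)
    rwa [add_sub_cancel_left, abs_mul, abs_of_nonneg hh] at this
  have hzero : ∑ i, α i • ∑ l ∈ Finset.range (K + 1), ((θ i * h) ^ l / (l.factorial : ℝ)) • D l x
      + h • ∑ i, β i • ∑ l ∈ Finset.range K, ((ϑ i * h) ^ l / (l.factorial : ℝ)) • D (l + 1) x
      = 0 := by
    have e1 : ∑ i, α i • ∑ l ∈ Finset.range (K + 1), ((θ i * h) ^ l / (l.factorial : ℝ)) • D l x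
        = ∑ l ∈ Finset.range (K + 1), (h ^ l / (l.factorial : ℝ) * ∑ i, α i * θ i ^ l) • D l x := by
      simp only [Finset.smul_sum, smul_smul]
      rw [Finset.sum_comm]
      refine Finset.sum_congr rfl fun l _ => ?_
      rw [← Finset.sum_smul, Finset.mul_sum]
      congr 1
      exact Finset.sum_congr rfl fun i _ => by rw [mul_pow]; ring
    have e2 : h • ∑ i, β i • ∑ l ∈ Finset.range K,
        ((ϑ i * h) ^ l / (l.factorial : ℝ)) • D (l + 1) x
        = ∑ l ∈ Finset.range (K + 1),
          (h ^ l / (l.factorial : ℝ) * (l * ∑ i, β i * ϑ i ^ (l - 1))) • D l x := by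
      rw [Finset.sum_range_succ']
      simp only [Finset.smul_sum, smul_smul]
      rw [Finset.sum_comm]
      simp only [Nat.cast_zero, zero_mul, mul_zero, zero_smul, add_zero]
      refine Finset.sum_congr rfl fun l _ => ?_
      rw [← Finset.sum_smul, Finset.mul_sum, Finset.mul_sum]
      congr 1
      refine Finset.sum_congr rfl fun i _ => ?_
      have : (l.factorial : ℝ) ≠ 0 := by positivity
      have : ((l : ℝ) + 1) ≠ 0 := by positivity
      rw [mul_pow, Nat.factorial_succ, Nat.add_sub_cancel]
      push_cast
      field_simp
      ring
    rw [e1, e2, ← Finset.sum_add_distrib]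
    refine Finset.sum_eq_zero fun l hl => ?_
    rw [← add_smul, ← mul_add, hmom l (Finset.mem_range.1 hl), mul_zero, zero_smul]
  have hsplit : ∑ i, α i • D 0 (x + θ i * h) + h • ∑ i, β i • D 1 (x + ϑ i * h)
      = ∑ i, α i • (D 0 (x + θ i * h) -
          ∑ l ∈ Finset.range (K + 1), ((θ i * h) ^ l / (l.factorial : ℝ)) • D l x)
        + h • ∑ i, β i • (D 1 (x + ϑ i * h) -
          ∑ l ∈ Finset.range K, ((ϑ i * h) ^ l / (l.factorial : ℝ)) • D (l + 1) x) := by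
    simp only [smul_sub, Finset.sum_sub_distrib]
    rw [sub_add_sub_comm, hzero, sub_zero]
  rw [hsplit]
  have b1 : ‖∑ i, α i • (D 0 (x + θ i * h) -
      ∑ l ∈ Finset.range (K + 1), ((θ i * h) ^ l / (l.factorial : ℝ)) • D l x)‖
      ≤ ∑ i, |α i| * (M * (|θ i| * h) ^ (K + 1)) :=
    norm_sum_le_of_le _ fun i _ => by
      rw [norm_smul, Real.norm_eq_abs]
      exact mul_le_mul_of_nonneg_left (t1 i) (abs_nonneg _)
  have b2 : ‖∑ i, β i • (D 1 (x + ϑ i * h) -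
      ∑ l ∈ Finset.range K, ((ϑ i * h) ^ l / (l.factorial : ℝ)) • D (l + 1) x)‖
      ≤ ∑ i, |β i| * (M * (|ϑ i| * h) ^ K) :=
    norm_sum_le_of_le _ fun i _ => by
      rw [norm_smul, Real.norm_eq_abs]
      exact mul_le_mul_of_nonneg_left (t2 i) (abs_nonneg _)
  refine (norm_add_le _ _).trans ?_
  rw [norm_smul, Real.norm_of_nonneg hh]
  refine (add_le_add b1 (mul_le_mul_of_nonneg_left b2 hh)).trans (le_of_eq ?_)
  simp only [mul_add, add_mul, Finset.mul_sum, Finset.sum_mul]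
  congr 1
  · exact Finset.sum_congr rfl fun i _ => by ring
  · exact Finset.sum_congr rfl fun i _ => by ring

/-- For a `C^{K+1}` function on a compact interval, linear functionals of its values and derivatives
whose moments of order at most `K` vanish are of order `h ^ (K + 1)`, uniformly in the base point. -/
theorem exists_functional_bound {a b : ℝ} (hab : a < b) {K : ℕ} {y y' : ℝ → F}
    (hy : ContDiffOn ℝ (K + 1 : ℕ) y (Set.Icc a b))
    (hy' : ∀ t ∈ Set.Icc a b, HasDerivWithinAt y (y' t) (Set.Icc a b) t) :
    ∃ M : ℝ, 0 ≤ M ∧ ∀ {ι κ : Type} [Fintype ι] [Fintype κ] (α θ : ι → ℝ) (β ϑ : κ → ℝ),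
      (∀ l < K + 1, ∑ i, α i * θ i ^ l + l * ∑ i, β i * ϑ i ^ (l - 1) = 0) →
      ∀ x h : ℝ, 0 ≤ h → x ∈ Set.Icc a b → (∀ i, x + θ i * h ∈ Set.Icc a b) →
      (∀ i, x + ϑ i * h ∈ Set.Icc a b) →
      ‖∑ i, α i • y (x + θ i * h) + h • ∑ i, β i • y' (x + ϑ i * h)‖
        ≤ M * (∑ i, |α i| * |θ i| ^ (K + 1) + ∑ i, |β i| * |ϑ i| ^ K) * h ^ (K + 1) := by
  have hud : UniqueDiffOn ℝ (Set.Icc a b) := uniqueDiffOn_Icc hab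
  set D : ℕ → ℝ → F := fun l => iteratedDerivWithin l y (Set.Icc a b) with hDdef
  have hD : ∀ l < K + 1, ∀ t ∈ Set.Icc a b,
      HasDerivWithinAt (D l) (D (l + 1) t) (Set.Icc a b) t := by
    intro l hl t ht
    have := (hy.differentiableOn_iteratedDerivWithin (m := l) (by exact_mod_cast hl) hud t
      ht).hasDerivWithinAt
    rwa [← iteratedDerivWithin_succ] at this
  have hcont : ContinuousOn (D (K + 1)) (Set.Icc a b) :=
    hy.continuousOn_iteratedDerivWithin le_rfl hud
  obtain ⟨M, hM⟩ := isCompact_Icc.exists_bound_of_continuousOn hcont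
  have hM0 : 0 ≤ M := (norm_nonneg _).trans (hM a (Set.left_mem_Icc.2 hab.le))
  refine ⟨M, hM0, ?_⟩
  intro ι κ _ _ α θ β ϑ hmom x h hh hx hθ hϑ
  have h0 : ∀ t, D 0 t = y t := fun t => by simp [hDdef]
  have h1 : ∀ t ∈ Set.Icc a b, D 1 t = y' t := fun t ht => by
    rw [hDdef]
    simp only [iteratedDerivWithin_one]
    exact (hy' t ht).derivWithin (hud t ht)
  have := norm_functional_le K D hD hM α θ β ϑ hmom hh hx hθ hϑ
  simp only [h0] at this
  have h2 : ∀ i, D 1 (x + ϑ i * h) = y' (x + ϑ i * h) := fun i => h1 _ (hϑ i)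
  simp only [h2] at this
  exact this

end Taylor

/-! ### A weighted contraction principle -/

section Contraction

variable {X₁ X₂ X₃ : Type*} [NormedAddCommGroup X₁] [NormedAddCommGroup X₂] [NormedAddCommGroup X₃]

/-- The three components of `x - x'` are bounded by `w₁ t`, `w₂ t` and `w₃ t`. -/
def WeightedLE (w₁ w₂ w₃ : ℝ) (x x' : X₁ × X₂ × X₃) (t : ℝ) : Prop :=
  ‖x.1 - x'.1‖ ≤ w₁ * t ∧ ‖x.2.1 - x'.2.1‖ ≤ w₂ * t ∧ ‖x.2.2 - x'.2.2‖ ≤ w₃ * t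

variable {w₁ w₂ w₃ : ℝ}

lemma WeightedLE.trans {x y z : X₁ × X₂ × X₃} {t t' : ℝ} (h : WeightedLE w₁ w₂ w₃ x y t)
    (h' : WeightedLE w₁ w₂ w₃ y z t') : WeightedLE w₁ w₂ w₃ x z (t + t') := by
  refine ⟨?_, ?_, ?_⟩
  · rw [mul_add]; exact (norm_sub_le_norm_sub_add_norm_sub _ y.1 _).trans (add_le_add h.1 h'.1)
  · rw [mul_add]; exact (norm_sub_le_norm_sub_add_norm_sub _ y.2.1 _).trans (add_le_add h.2.1 h'.2.1)
  · rw [mul_add]; exact (norm_sub_le_norm_sub_add_norm_sub _ y.2.2 _).trans (add_le_add h.2.2 h'.2.2)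

/-- The distance of a fixed point of a weighted contraction to any other point is controlled by the
residual of that point. -/
lemma weightedLE_of_isFixedPt (h₁ : 0 < w₁) (h₂ : 0 < w₂) (h₃ : 0 < w₃)
    {Φ : X₁ × X₂ × X₃ → X₁ × X₂ × X₃} {x z : X₁ × X₂ × X₃}
    (hΦ : ∀ t, 0 ≤ t → WeightedLE w₁ w₂ w₃ x z t → WeightedLE w₁ w₂ w₃ (Φ x) (Φ z) (t / 2))
    (hx : Φ x = x) {t₀ : ℝ} (hz : WeightedLE w₁ w₂ w₃ (Φ z) z t₀) :
    WeightedLE w₁ w₂ w₃ x z (2 * t₀) := by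
  -- `τ` is the smallest admissible bound
  set τ := max (‖x.1 - z.1‖ / w₁) (max (‖x.2.1 - z.2.1‖ / w₂) (‖x.2.2 - z.2.2‖ / w₃)) with hτ
  have hτ0 : 0 ≤ τ := le_max_of_le_left (by positivity)
  have hxz : WeightedLE w₁ w₂ w₃ x z τ := by
    refine ⟨?_, ?_, ?_⟩
    · rw [mul_comm, ← div_le_iff₀ h₁]; exact le_max_left _ _
    · rw [mul_comm, ← div_le_iff₀ h₂]; exact le_max_of_le_right (le_max_left _ _)
    · rw [mul_comm, ← div_le_iff₀ h₃]; exact le_max_of_le_right (le_max_right _ _)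
  have h := (hΦ τ hτ0 hxz).trans hz
  rw [hx] at h
  have hle : τ ≤ τ / 2 + t₀ := by
    refine max_le ?_ (max_le ?_ ?_)
    · rw [div_le_iff₀ h₁, mul_comm]; exact h.1
    · rw [div_le_iff₀ h₂, mul_comm]; exact h.2.1
    · rw [div_le_iff₀ h₃, mul_comm]; exact h.2.2
  have hle2 : τ ≤ 2 * t₀ := by linarith
  exact ⟨hxz.1.trans (mul_le_mul_of_nonneg_left hle2 h₁.le),
    hxz.2.1.trans (mul_le_mul_of_nonneg_left hle2 h₂.le),
    hxz.2.2.trans (mul_le_mul_of_nonneg_left hle2 h₃.le)⟩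

variable [NormedSpace ℝ X₁] [NormedSpace ℝ X₂] [NormedSpace ℝ X₃]
  [CompleteSpace X₁] [CompleteSpace X₂] [CompleteSpace X₃]

/-- Banach's fixed point theorem on a box around an approximate fixed point `z`. -/
lemma exists_isFixedPt_of_weighted (h₁ : 0 < w₁) (h₂ : 0 < w₂) (h₃ : 0 < w₃)
    {Φ : X₁ × X₂ × X₃ → X₁ × X₂ × X₃} {z : X₁ × X₂ × X₃} {t₀ : ℝ} (ht₀ : 0 ≤ t₀)
    (hΦ : ∀ x x', WeightedLE w₁ w₂ w₃ x z t₀ → WeightedLE w₁ w₂ w₃ x' z t₀ → ∀ t, 0 ≤ t →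
      WeightedLE w₁ w₂ w₃ x x' t → WeightedLE w₁ w₂ w₃ (Φ x) (Φ x') (t / 2))
    (hz : WeightedLE w₁ w₂ w₃ (Φ z) z (t₀ / 2)) :
    ∃ x, Φ x = x ∧ WeightedLE w₁ w₂ w₃ x z t₀ := by
  -- rescaling turns the box into a ball and `Φ` into a contraction `Ψ`
  set σ : X₁ × X₂ × X₃ → X₁ × X₂ × X₃ := fun x => (w₁ • x.1, w₂ • x.2.1, w₃ • x.2.2) with hσ
  set σi : X₁ × X₂ × X₃ → X₁ × X₂ × X₃ := fun x => (w₁⁻¹ • x.1, w₂⁻¹ • x.2.1, w₃⁻¹ • x.2.2) with hσi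
  have hσσi : ∀ x, σ (σi x) = x := fun x => by
    simp [hσ, hσi, smul_smul, h₁.ne', h₂.ne', h₃.ne']
  have hdist : ∀ x x' t, dist x x' ≤ t ↔ WeightedLE w₁ w₂ w₃ (σ x) (σ x') t := by
    intro x x' t
    simp only [WeightedLE, hσ, ← smul_sub, norm_smul, Real.norm_of_nonneg h₁.le,
      Real.norm_of_nonneg h₂.le, Real.norm_of_nonneg h₃.le, mul_le_mul_iff_right₀ h₁,
      mul_le_mul_iff_right₀ h₂, mul_le_mul_iff_right₀ h₃]
    rw [Prod.dist_eq, Prod.dist_eq, max_le_iff, max_le_iff, dist_eq_norm, dist_eq_norm, dist_eq_norm]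
  set Ψ : X₁ × X₂ × X₃ → X₁ × X₂ × X₃ := fun x => σi (Φ (σ x)) with hΨ
  set s := Metric.closedBall (σi z) t₀ with hs
  have hmem : ∀ x, x ∈ s ↔ WeightedLE w₁ w₂ w₃ (σ x) z t₀ := fun x => by
    rw [hs, Metric.mem_closedBall, hdist, hσσi]
  have hzs : WeightedLE w₁ w₂ w₃ z z t₀ := by
    simp only [WeightedLE, sub_self, norm_zero]
    exact ⟨by positivity, by positivity, by positivity⟩
  have hmaps : Set.MapsTo Ψ s s := by
    intro x hx
    rw [hmem] at hx ⊢
    simp only [hΨ, hσσi]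
    have := (hΦ _ z hx hzs t₀ ht₀ hx).trans hz
    rwa [add_halves] at this
  have hcontr : ContractingWith (1 / 2) (hmaps.restrict Ψ s s) := by
    refine ⟨by norm_num, LipschitzWith.of_dist_le_mul fun x x' => ?_⟩
    rw [Subtype.dist_eq, Subtype.dist_eq, Set.MapsTo.val_restrict_apply,
      Set.MapsTo.val_restrict_apply, hdist]
    simp only [hΨ, hσσi]
    have := hΦ _ _ ((hmem _).1 x.2) ((hmem _).1 x'.2) _ dist_nonneg ((hdist x.1 x'.1 _).1 le_rfl)
    convert! this using 1
    simp
    ring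
  obtain ⟨x, hxs, hfix, -⟩ := ContractingWith.exists_fixedPoint' Metric.isClosed_closedBall.isComplete
    hmaps hcontr (Metric.mem_closedBall_self ht₀) (edist_ne_top _ _)
  refine ⟨σ x, ?_, (hmem x).1 hxs⟩
  have := congrArg σ hfix
  rwa [hΨ, hσσi] at this

end Contraction

/-! ### The discrete state and adjoint operators -/

namespace PeerTriplet

variable {s q r : ℕ} (M : PeerTriplet s)

/-- The linear part `Y ↦ (A₀ Y₀, A_n Y_n - B_n Y_{n-1})` of the discrete state equation. -/
def stateOp (m N : ℕ) : (Fin (N + 1) → Fin s → EuclideanSpace ℝ (Fin m)) →ₗ[ℝ]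
    (Fin (N + 1) → Fin s → EuclideanSpace ℝ (Fin m)) where
  toFun Y := Fin.cons (α := fun _ => Fin s → EuclideanSpace ℝ (Fin m))
    (kronApply (M.coefA N 0) (Y 0))
    fun n : Fin N => kronApply (M.coefA N (n + 1)) (Y n.succ)
      - kronApply (M.coefB N (n + 1)) (Y n.castSucc)
  map_add' Y Z := by
    funext n
    refine Fin.cases ?_ (fun n => ?_) n
    · simp [kronApply_add]
    · simp only [Pi.add_apply, Fin.cons_succ, kronApply_add]; abel
  map_smul' t Y := by
    funext n
    refine Fin.cases ?_ (fun n => ?_) n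
    · simp [kronApply_smul]
    · simp [kronApply_smul, smul_sub]

/-- The linear part `P ↦ (A_nᵀ P_n - B_{n+1}ᵀ P_{n+1}, A_Nᵀ P_N)` of the discrete adjoint
equation. -/
def adjointOp (m N : ℕ) : (Fin (N + 1) → Fin s → EuclideanSpace ℝ (Fin m)) →ₗ[ℝ]
    (Fin (N + 1) → Fin s → EuclideanSpace ℝ (Fin m)) where
  toFun P := Fin.snoc (α := fun _ => Fin s → EuclideanSpace ℝ (Fin m))
    (fun n : Fin N => kronApply (M.coefA N n)ᵀ (P n.castSucc)
      - kronApply (M.coefB N (n + 1))ᵀ (P n.succ))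
    (kronApply (M.coefA N N)ᵀ (P (Fin.last N)))
  map_add' Y Z := by
    funext n
    refine Fin.lastCases ?_ (fun n => ?_) n
    · simp [kronApply_add]
    · simp only [Pi.add_apply, Fin.snoc_castSucc, kronApply_add]; abel
  map_smul' t Y := by
    funext n
    refine Fin.lastCases ?_ (fun n => ?_) n
    · simp [kronApply_smul]
    · simp [kronApply_smul, smul_sub]

variable {M}

lemma stateOp_zero {m N : ℕ} (Y : Fin (N + 1) → Fin s → EuclideanSpace ℝ (Fin m)) :
    M.stateOp m N Y 0 = kronApply (M.coefA N 0) (Y 0) := rfl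

lemma stateOp_succ {m N : ℕ} (Y : Fin (N + 1) → Fin s → EuclideanSpace ℝ (Fin m)) (n : Fin N) :
    M.stateOp m N Y n.succ = kronApply (M.coefA N (n + 1)) (Y n.succ)
      - kronApply (M.coefB N (n + 1)) (Y n.castSucc) := rfl

lemma adjointOp_last {m N : ℕ} (P : Fin (N + 1) → Fin s → EuclideanSpace ℝ (Fin m)) :
    M.adjointOp m N P (Fin.last N) = kronApply (M.coefA N N)ᵀ (P (Fin.last N)) := by
  simp [adjointOp]

lemma adjointOp_castSucc {m N : ℕ} (P : Fin (N + 1) → Fin s → EuclideanSpace ℝ (Fin m))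
    (n : Fin N) :
    M.adjointOp m N P n.castSucc = kronApply (M.coefA N n)ᵀ (P n.castSucc)
      - kronApply (M.coefB N (n + 1))ᵀ (P n.succ) := by
  simp [adjointOp]

/-- Stability of the discrete state equation, uniformly in the dimension and the number of steps: only
the sums of the residuals over the stages accumulate, and only in the standard steps. -/
lemma exists_stateOp_bound (hM : M.Structural) (hs : StableStep M.A M.B) :
    ∃ κ : ℝ, 0 < κ ∧ ∀ m N : ℕ, 2 ≤ N →
      ∀ (Y : Fin (N + 1) → Fin s → EuclideanSpace ℝ (Fin m)) (ρ σ : ℝ), 0 ≤ σ →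
      (∀ n, ‖M.stateOp m N Y n‖ ≤ ρ) →
      (∀ n : Fin (N + 1), (n : ℕ) ≠ 0 → (n : ℕ) ≠ N → ‖∑ i, M.stateOp m N Y n i‖ ≤ σ) →
      ‖Y‖ ≤ κ * (ρ + N * σ) := by
  obtain ⟨κ, hκ, hb⟩ := hs.exists_bound hM.det_A₀ hM.det_AN M.BN (Bs := M.B)
  refine ⟨κ, hκ, fun m N hN Y ρ σ hσ0 hρ hσ => ?_⟩
  set R := M.stateOp m N Y with hR
  have hρ0 : 0 ≤ ρ := (norm_nonneg _).trans (hρ 0)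
  set Z : ℕ → Fin s → EuclideanSpace ℝ (Fin m) := fun k => Y ⟨min k N, by omega⟩ with hZ
  set R' : ℕ → Fin s → EuclideanSpace ℝ (Fin m) := fun k => R ⟨min k N, by omega⟩ with hR'
  have hstep : ∀ k < N, kronApply (M.coefA N (k + 1)) (Z (k + 1)) =
      kronApply (M.coefB N (k + 1)) (Z k) + R' (k + 1) := by
    intro k hk
    have e1 : Z (k + 1) = Y (Fin.succ ⟨k, hk⟩) := congrArg Y (Fin.ext (by simp; omega))
    have e2 : Z k = Y (Fin.castSucc ⟨k, hk⟩) := congrArg Y (Fin.ext (by simp; omega))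
    have e3 : R' (k + 1) = R (Fin.succ ⟨k, hk⟩) := congrArg R (Fin.ext (by simp; omega))
    rw [e1, e2, e3, hR, stateOp_succ]
    simp
  have hall := hb m N hN Z R' ρ (N * σ) ?_ ?_ ?_ ?_ (fun k _ => hρ _) ?_
  · refine (pi_norm_le_iff_of_nonneg (by positivity)).2 fun n => ?_
    have := hall n (Nat.lt_succ_iff.1 n.2)
    rwa [show Z n = Y n from congrArg Y (Fin.ext (by simp; omega))] at this
  · have e1 : Z 0 = Y 0 := congrArg Y (Fin.ext (by simp))
    have e2 : R' 0 = R 0 := congrArg R (Fin.ext (by simp))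
    rw [e1, e2, hR, stateOp_zero]
    simp [coefA]
  · have := hstep 0 (by omega)
    have h1 : 1 ≠ N := by omega
    simpa [coefA, coefB, h1] using this
  · intro k hk hkN
    obtain ⟨j, rfl⟩ : ∃ j, k = j + 1 := ⟨k - 1, by omega⟩
    have := hstep j (by omega)
    simpa [coefA, coefB, hkN.ne] using this
  · obtain ⟨j, hj⟩ : ∃ j, N = j + 1 := ⟨N - 1, by omega⟩
    have := hstep j (by omega)
    simpa [coefA, coefB, ← hj, show N - 1 = j by omega, show N ≠ 0 by omega] using this
  · refine (Finset.sum_le_card_nsmul _ _ σ fun k hk => ?_).trans ?_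
    · rw [Finset.mem_Ico] at hk
      exact hσ _ (by simp; omega) (by simp; omega)
    · rw [nsmul_eq_mul]
      refine mul_le_mul_of_nonneg_right ?_ hσ0
      rw [Nat.card_Ico]
      exact_mod_cast Nat.sub_le _ _

/-- Stability of the discrete adjoint equation. Besides step `0` and step `N`, step `N - 1` is excluded
from the bound of the sums, as it involves `B_N`. -/
lemma exists_adjointOp_bound (hM : M.Structural) (hs : StableStep M.A M.B) :
    ∃ κ : ℝ, 0 < κ ∧ ∀ m N : ℕ, 2 ≤ N →
      ∀ (P : Fin (N + 1) → Fin s → EuclideanSpace ℝ (Fin m)) (ρ σ : ℝ), 0 ≤ σ →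
      (∀ n, ‖M.adjointOp m N P n‖ ≤ ρ) →
      (∀ n : Fin (N + 1), (n : ℕ) ≠ 0 → (n : ℕ) + 1 < N → ‖∑ i, M.adjointOp m N P n i‖ ≤ σ) →
      ‖P‖ ≤ κ * (ρ + N * σ) := by
  obtain ⟨κ, hκ, hb⟩ := hs.transpose.exists_bound (As := M.ANᵀ) (Ae := M.A₀ᵀ)
    (by rw [Matrix.det_transpose]; exact hM.det_AN)
    (by rw [Matrix.det_transpose]; exact hM.det_A₀) M.Bᵀ (Bs := M.BNᵀ)
  refine ⟨κ, hκ, fun m N hN P ρ σ hσ0 hρ hσ => ?_⟩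
  set R := M.adjointOp m N P with hR
  have hρ0 : 0 ≤ ρ := (norm_nonneg _).trans (hρ 0)
  -- the recursion runs backwards in time
  set Z : ℕ → Fin s → EuclideanSpace ℝ (Fin m) := fun k => P ⟨N - k, by omega⟩ with hZ
  set R' : ℕ → Fin s → EuclideanSpace ℝ (Fin m) := fun k => R ⟨N - k, by omega⟩ with hR'
  have hstep : ∀ k < N, kronApply (M.coefA N (N - (k + 1)))ᵀ (Z (k + 1)) =
      kronApply (M.coefB N (N - k))ᵀ (Z k) + R' (k + 1) := by
    intro k hk
    have hlt : N - (k + 1) < N := by omega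
    have e1 : Z (k + 1) = P (Fin.castSucc ⟨N - (k + 1), hlt⟩) := rfl
    have e2 : Z k = P (Fin.succ ⟨N - (k + 1), hlt⟩) := congrArg P (Fin.ext (by simp; omega))
    have e3 : R' (k + 1) = R (Fin.castSucc ⟨N - (k + 1), hlt⟩) := rfl
    rw [e1, e2, e3, hR, adjointOp_castSucc]
    simp [show N - (k + 1) + 1 = N - k by omega]
  have hall := hb m N hN Z R' ρ (N * σ) ?_ ?_ ?_ ?_ (fun k _ => hρ _) ?_
  · refine (pi_norm_le_iff_of_nonneg (by positivity)).2 fun n => ?_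
    have := hall (N - n) (Nat.sub_le _ _)
    rwa [show Z (N - n) = P n from congrArg P (Fin.ext (by simp; omega))] at this
  · have e1 : Z 0 = P (Fin.last N) := congrArg P (Fin.ext (by simp))
    have e2 : R' 0 = R (Fin.last N) := congrArg R (Fin.ext (by simp))
    rw [e1, e2, hR, adjointOp_last]
    simp [coefA, show N ≠ 0 by omega]
  · have := hstep 0 (by omega)
    simpa [coefA, coefB, show N - 1 ≠ 0 by omega, show N - 1 ≠ N by omega] using this
  · intro k hk hkN
    obtain ⟨j, rfl⟩ : ∃ j, k = j + 1 := ⟨k - 1, by omega⟩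
    have := hstep j (by omega)
    simpa [coefA, coefB, show N - (j + 1) ≠ 0 by omega, show N - (j + 1) ≠ N by omega,
      show N - j ≠ N by omega] using this
  · obtain ⟨j, hj⟩ : ∃ j, N = j + 1 := ⟨N - 1, by omega⟩
    have := hstep j (by omega)
    simpa [coefA, coefB, ← hj, show N - 1 = j by omega, show N - j ≠ N by omega] using this
  · refine (Finset.sum_le_card_nsmul _ _ σ fun k hk => ?_).trans ?_
    · rw [Finset.mem_Ico] at hk
      exact hσ _ (by simp; omega) (by simp; omega)
    · rw [nsmul_eq_mul]
      refine mul_le_mul_of_nonneg_right ?_ hσ0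
      rw [Nat.card_Ico]
      exact_mod_cast Nat.sub_le _ _

end PeerTriplet

lemma exists_inverse_of_injective {X : Type*} [NormedAddCommGroup X] [NormedSpace ℝ X]
    [FiniteDimensional ℝ X] (L : X →ₗ[ℝ] X) (hL : ∀ x, L x = 0 → x = 0) :
    ∃ S : X →ₗ[ℝ] X, ∀ x y, S y = x ↔ L x = y := by
  have hinj : Function.Injective L := (injective_iff_map_eq_zero L).2 hL
  refine ⟨(LinearEquiv.ofInjectiveEndo L hinj).symm, fun x y => ?_⟩
  rw [LinearEquiv.coe_coe, LinearEquiv.symm_apply_eq, eq_comm]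
  rfl

/-! ### Local estimates along the continuous solution -/

section TransposeAt

lemma norm_clm_comp_le {X F G : Type*} [NormedAddCommGroup X] [NormedSpace ℝ X]
    [NormedAddCommGroup F] [NormedSpace ℝ F] [NormedAddCommGroup G] [NormedSpace ℝ G]
    {L : F →L[ℝ] G} {L' : X →L[ℝ] F} {a b : ℝ} (hL : ‖L‖ ≤ a) (hL' : ‖L'‖ ≤ b) :
    ‖L.comp L'‖ ≤ a * b :=
  (L.opNorm_comp_le L').trans (mul_le_mul hL hL' (norm_nonneg _) ((norm_nonneg _).trans hL))

variable {m d : ℕ} {X : Type*} [NormedAddCommGroup X] [NormedSpace ℝ X]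

/-- The map `L ↦ (L ∘ ι)ᵀ π`, which is linear in `L`. -/
def transposeAt (ι : EuclideanSpace ℝ (Fin d) →L[ℝ] X) (π : EuclideanSpace ℝ (Fin m)) :
    (X →L[ℝ] EuclideanSpace ℝ (Fin m)) →L[ℝ] EuclideanSpace ℝ (Fin d) :=
  LinearMap.mkContinuous
    { toFun := fun L => ContinuousLinearMap.adjoint (L.comp ι) π
      map_add' := fun L L' => by simp [ContinuousLinearMap.add_comp]
      map_smul' := fun c L => by simp [ContinuousLinearMap.smul_comp] }
    (‖ι‖ * ‖π‖) fun L => by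
      refine ((ContinuousLinearMap.adjoint (L.comp ι)).le_opNorm π).trans ?_
      rw [LinearIsometryEquiv.norm_map]
      calc ‖L.comp ι‖ * ‖π‖ ≤ (‖L‖ * ‖ι‖) * ‖π‖ :=
            mul_le_mul_of_nonneg_right (L.opNorm_comp_le ι) (norm_nonneg _)
        _ = ‖ι‖ * ‖π‖ * ‖L‖ := by ring

lemma transposeAt_apply (ι : EuclideanSpace ℝ (Fin d) →L[ℝ] X) (π : EuclideanSpace ℝ (Fin m))
    (L : X →L[ℝ] EuclideanSpace ℝ (Fin m)) :
    transposeAt ι π L = ContinuousLinearMap.adjoint (L.comp ι) π := rfl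

lemma transposeAt_sub (ι : EuclideanSpace ℝ (Fin d) →L[ℝ] X) (π π' : EuclideanSpace ℝ (Fin m)) :
    transposeAt ι (π - π') = transposeAt ι π - transposeAt ι π' := by
  ext1 L
  simp [transposeAt_apply]

lemma norm_transposeAt_le {ι : EuclideanSpace ℝ (Fin d) →L[ℝ] X} (hι : ‖ι‖ ≤ 1)
    (π : EuclideanSpace ℝ (Fin m)) : ‖transposeAt ι π‖ ≤ ‖π‖ :=
  (LinearMap.mkContinuous_norm_le _ (by positivity) _).trans
    (mul_le_of_le_one_left (norm_nonneg _) hι)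

lemma norm_transposeAt_apply_le {ι : EuclideanSpace ℝ (Fin d) →L[ℝ] X} (hι : ‖ι‖ ≤ 1)
    (π : EuclideanSpace ℝ (Fin m)) (L : X →L[ℝ] EuclideanSpace ℝ (Fin m)) :
    ‖transposeAt ι π L‖ ≤ ‖L‖ * ‖π‖ := by
  rw [mul_comm]
  exact ((transposeAt ι π).le_opNorm L).trans
    (mul_le_mul_of_nonneg_right (norm_transposeAt_le hι π) (norm_nonneg _))

lemma fderiv_transposeAt (ι : EuclideanSpace ℝ (Fin d) →L[ℝ] X) (π : EuclideanSpace ℝ (Fin m))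
    (g : X → (X →L[ℝ] EuclideanSpace ℝ (Fin m))) (x : X) (hg : DifferentiableAt ℝ g x) :
    fderiv ℝ (fun x => transposeAt ι π (g x)) x = (transposeAt ι π).comp (fderiv ℝ g x) :=
  ((transposeAt ι π).hasFDerivAt.comp x hg.hasFDerivAt).fderiv

lemma norm_fderiv_transposeAt_sub_le (ι : EuclideanSpace ℝ (Fin d) →L[ℝ] X) (hι : ‖ι‖ ≤ 1)
    (π π' : EuclideanSpace ℝ (Fin m)) (g : X → (X →L[ℝ] EuclideanSpace ℝ (Fin m))) (x : X)
    (hg : DifferentiableAt ℝ g x) :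
    ‖fderiv ℝ (fun x => transposeAt ι π (g x)) x - fderiv ℝ (fun x => transposeAt ι π' (g x)) x‖
      ≤ ‖π - π'‖ * ‖fderiv ℝ g x‖ := by
  rw [fderiv_transposeAt ι π g x hg, fderiv_transposeAt ι π' g x hg,
    ← ContinuousLinearMap.sub_comp, ← transposeAt_sub]
  exact norm_clm_comp_le (norm_transposeAt_le hι _) le_rfl

end TransposeAt

namespace SmoothnessBounds

variable {m d : ℕ}
  {f : EuclideanSpace ℝ (Fin m) × EuclideanSpace ℝ (Fin d) → EuclideanSpace ℝ (Fin m)}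
  {Tstar : ℝ} {y p : ℝ → EuclideanSpace ℝ (Fin m)} {u : ℝ → EuclideanSpace ℝ (Fin d)}
  {ρ Λ₁ Λ₂ Λ₃ : ℝ}

lemma isOpen_tube (y : ℝ → EuclideanSpace ℝ (Fin m)) (u : ℝ → EuclideanSpace ℝ (Fin d))
    (Tstar ρ : ℝ) : IsOpen {x : EuclideanSpace ℝ (Fin m) × EuclideanSpace ℝ (Fin d) |
      ∃ t ∈ Set.Icc 0 Tstar, dist x (y t, u t) < ρ} := by
  have : {x : EuclideanSpace ℝ (Fin m) × EuclideanSpace ℝ (Fin d) |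
      ∃ t ∈ Set.Icc 0 Tstar, dist x (y t, u t) < ρ} =
      ⋃ t ∈ Set.Icc 0 Tstar, Metric.ball (y t, u t) ρ := by
    ext x; simp
  rw [this]
  exact isOpen_biUnion fun _ _ => Metric.isOpen_ball

lemma tube_mem_nhds {t : ℝ} (ht : t ∈ Set.Icc 0 Tstar)
    {x : EuclideanSpace ℝ (Fin m) × EuclideanSpace ℝ (Fin d)}
    (hx : x ∈ Metric.ball (y t, u t) ρ) :
    {x | ∃ t ∈ Set.Icc 0 Tstar, dist x (y t, u t) < ρ} ∈ nhds x :=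
  (isOpen_tube y u Tstar ρ).mem_nhds ⟨t, ht, hx⟩

lemma contDiffAt_f (hb : SmoothnessBounds f Tstar y p u ρ Λ₁ Λ₂ Λ₃)
    {t : ℝ} (ht : t ∈ Set.Icc 0 Tstar)
    {x : EuclideanSpace ℝ (Fin m) × EuclideanSpace ℝ (Fin d)}
    (hx : x ∈ Metric.ball (y t, u t) ρ) : ContDiffAt ℝ 2 f x :=
  hb.smooth_f.contDiffAt (tube_mem_nhds ht hx)

lemma differentiableAt_f (hb : SmoothnessBounds f Tstar y p u ρ Λ₁ Λ₂ Λ₃)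
    {t : ℝ} (ht : t ∈ Set.Icc 0 Tstar)
    {x : EuclideanSpace ℝ (Fin m) × EuclideanSpace ℝ (Fin d)}
    (hx : x ∈ Metric.ball (y t, u t) ρ) : DifferentiableAt ℝ f x :=
  (hb.contDiffAt_f ht hx).differentiableAt (by norm_num)

lemma differentiableAt_fderiv (hb : SmoothnessBounds f Tstar y p u ρ Λ₁ Λ₂ Λ₃)
    {t : ℝ} (ht : t ∈ Set.Icc 0 Tstar)
    {x : EuclideanSpace ℝ (Fin m) × EuclideanSpace ℝ (Fin d)}
    (hx : x ∈ Metric.ball (y t, u t) ρ) : DifferentiableAt ℝ (fderiv ℝ f) x :=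
  ((hb.contDiffAt_f ht hx).fderiv_right (m := 1) (by norm_num)).differentiableAt (by norm_num)

lemma jacY_eq (hb : SmoothnessBounds f Tstar y p u ρ Λ₁ Λ₂ Λ₃)
    {t : ℝ} (ht : t ∈ Set.Icc 0 Tstar)
    {x : EuclideanSpace ℝ (Fin m) × EuclideanSpace ℝ (Fin d)}
    (hx : x ∈ Metric.ball (y t, u t) ρ) :
    jacY f x.1 x.2 = (fderiv ℝ f x).comp (ContinuousLinearMap.inl ℝ _ _) := by
  have h1 : HasFDerivAt (fun v : EuclideanSpace ℝ (Fin m) => (v, x.2))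
      (ContinuousLinearMap.inl ℝ (EuclideanSpace ℝ (Fin m)) (EuclideanSpace ℝ (Fin d))) x.1 :=
    hasFDerivAt_prodMk_left _ _
  exact ((hb.differentiableAt_f ht hx).hasFDerivAt.comp x.1 h1).fderiv

lemma jacU_eq (hb : SmoothnessBounds f Tstar y p u ρ Λ₁ Λ₂ Λ₃)
    {t : ℝ} (ht : t ∈ Set.Icc 0 Tstar)
    {x : EuclideanSpace ℝ (Fin m) × EuclideanSpace ℝ (Fin d)}
    (hx : x ∈ Metric.ball (y t, u t) ρ) :
    jacU f x.1 x.2 = (fderiv ℝ f x).comp (ContinuousLinearMap.inr ℝ _ _) := by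
  have h1 : HasFDerivAt (fun v : EuclideanSpace ℝ (Fin d) => (x.1, v))
      (ContinuousLinearMap.inr ℝ (EuclideanSpace ℝ (Fin m)) (EuclideanSpace ℝ (Fin d))) x.2 :=
    hasFDerivAt_prodMk_right _ _
  exact ((hb.differentiableAt_f ht hx).hasFDerivAt.comp x.2 h1).fderiv

lemma adjY_eq (hb : SmoothnessBounds f Tstar y p u ρ Λ₁ Λ₂ Λ₃)
    {t : ℝ} (ht : t ∈ Set.Icc 0 Tstar)
    {x : EuclideanSpace ℝ (Fin m) × EuclideanSpace ℝ (Fin d)}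
    (hx : x ∈ Metric.ball (y t, u t) ρ) (π : EuclideanSpace ℝ (Fin m)) :
    adjY f x.1 π x.2 = transposeAt (ContinuousLinearMap.inl ℝ _ _) π (fderiv ℝ f x) := by
  rw [transposeAt_apply, ← hb.jacY_eq ht hx, adjY]

lemma adjU_eq (hb : SmoothnessBounds f Tstar y p u ρ Λ₁ Λ₂ Λ₃)
    {t : ℝ} (ht : t ∈ Set.Icc 0 Tstar)
    {x : EuclideanSpace ℝ (Fin m) × EuclideanSpace ℝ (Fin d)}
    (hx : x ∈ Metric.ball (y t, u t) ρ) (π : EuclideanSpace ℝ (Fin m)) :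
    adjU f x.1 π x.2 = transposeAt (ContinuousLinearMap.inr ℝ _ _) π (fderiv ℝ f x) := by
  rw [transposeAt_apply, ← hb.jacU_eq ht hx, adjU]

lemma norm_fderiv_le (hb : SmoothnessBounds f Tstar y p u ρ Λ₁ Λ₂ Λ₃)
    (hρ : 0 < ρ) {t : ℝ} (ht : t ∈ Set.Icc 0 Tstar)
    {x : EuclideanSpace ℝ (Fin m) × EuclideanSpace ℝ (Fin d)}
    (hx : x ∈ Metric.ball (y t, u t) ρ) : ‖fderiv ℝ f x‖ ≤ Λ₁ := by
  refine hb.bound₁ t ht x.1 (p t) x.2 ?_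
  rw [Metric.mem_ball, Prod.dist_eq, max_lt_iff] at hx
  simp only [Prod.dist_eq, max_lt_iff, dist_self]
  exact ⟨hx.1, hρ, hx.2⟩

lemma norm_fderiv_fderiv_le (hb : SmoothnessBounds f Tstar y p u ρ Λ₁ Λ₂ Λ₃)
    {t : ℝ} (ht : t ∈ Set.Icc 0 Tstar)
    {x : EuclideanSpace ℝ (Fin m) × EuclideanSpace ℝ (Fin d)} {π : EuclideanSpace ℝ (Fin m)}
    (hx : x ∈ Metric.ball (y t, u t) ρ) (hπ : π ∈ Metric.ball (p t) ρ) :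
    (1 + ‖π‖) * ‖fderiv ℝ (fderiv ℝ f) x‖ ≤ Λ₂ := by
  have h := hb.bound₂ t ht x.1 π x.2 (by
    rw [Metric.mem_ball, Prod.dist_eq, max_lt_iff] at hx
    simp only [Prod.dist_eq, max_lt_iff]
    exact ⟨hx.1, hπ, hx.2⟩)
  refine le_trans (mul_le_mul_of_nonneg_right ?_ (norm_nonneg (fderiv ℝ (fderiv ℝ f) x))) h
  have : ‖π‖ ≤ ‖(x.1, π, x.2)‖ := le_max_of_le_right (le_max_left _ _)
  linarith

lemma nonneg (hb : SmoothnessBounds f Tstar y p u ρ Λ₁ Λ₂ Λ₃)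
    (hρ : 0 < ρ) {t : ℝ} (ht : t ∈ Set.Icc 0 Tstar) : 0 ≤ Λ₁ ∧ 0 ≤ Λ₂ ∧ 0 ≤ Λ₃ := by
  have hx : (y t, u t) ∈ Metric.ball (y t, u t) ρ := Metric.mem_ball_self hρ
  refine ⟨(norm_nonneg _).trans (hb.norm_fderiv_le hρ ht hx),
    le_trans ?_ (hb.norm_fderiv_fderiv_le ht hx (Metric.mem_ball_self hρ : p t ∈ _)),
    le_trans (norm_nonneg (fderiv ℝ (fderiv ℝ (fun x : EuclideanSpace ℝ (Fin m) ×
      EuclideanSpace ℝ (Fin d) => adjU f x.1 (p t) x.2)) (y t, u t)))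
      (hb.bound₃ t ht (y t) (p t) (u t) (by simpa using hρ))⟩
  positivity

lemma norm_f_sub_le (hb : SmoothnessBounds f Tstar y p u ρ Λ₁ Λ₂ Λ₃)
    (hρ : 0 < ρ) {t : ℝ} (ht : t ∈ Set.Icc 0 Tstar)
    {x x' : EuclideanSpace ℝ (Fin m) × EuclideanSpace ℝ (Fin d)}
    (hx : x ∈ Metric.ball (y t, u t) ρ) (hx' : x' ∈ Metric.ball (y t, u t) ρ) :
    ‖f x - f x'‖ ≤ Λ₁ * ‖x - x'‖ :=
  (convex_ball _ _).norm_image_sub_le_of_norm_fderiv_le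
    (fun _ hz => hb.differentiableAt_f ht hz) (fun _ hz => hb.norm_fderiv_le hρ ht hz) hx' hx

lemma norm_fderiv_sub_mul_le (hb : SmoothnessBounds f Tstar y p u ρ Λ₁ Λ₂ Λ₃)
    {t : ℝ} (ht : t ∈ Set.Icc 0 Tstar)
    {x x' : EuclideanSpace ℝ (Fin m) × EuclideanSpace ℝ (Fin d)} {π : EuclideanSpace ℝ (Fin m)}
    (hx : x ∈ Metric.ball (y t, u t) ρ) (hx' : x' ∈ Metric.ball (y t, u t) ρ)
    (hπ : π ∈ Metric.ball (p t) ρ) :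
    ‖fderiv ℝ f x - fderiv ℝ f x'‖ * ‖π‖ ≤ Λ₂ * ‖x - x'‖ := by
  have h1 : 0 < 1 + ‖π‖ := by positivity
  have h := (convex_ball (y t, u t) ρ).norm_image_sub_le_of_norm_fderiv_le (C := Λ₂ / (1 + ‖π‖))
    (fun _ hz => hb.differentiableAt_fderiv ht hz) (fun z hz => by
      rw [le_div_iff₀ h1, mul_comm]
      exact hb.norm_fderiv_fderiv_le ht hz hπ) hx' hx
  calc ‖fderiv ℝ f x - fderiv ℝ f x'‖ * ‖π‖
      ≤ ‖fderiv ℝ f x - fderiv ℝ f x'‖ * (1 + ‖π‖) :=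
        mul_le_mul_of_nonneg_left (by linarith) (norm_nonneg _)
    _ ≤ Λ₂ / (1 + ‖π‖) * ‖x - x'‖ * (1 + ‖π‖) := mul_le_mul_of_nonneg_right h h1.le
    _ = Λ₂ * ‖x - x'‖ := by field_simp

/-- Common estimate for the two partial gradients of the Hamiltonian. -/
lemma norm_transposeAt_fderiv_sub_le (hb : SmoothnessBounds f Tstar y p u ρ Λ₁ Λ₂ Λ₃)
    (hρ : 0 < ρ) {k : ℕ} {t : ℝ} (ht : t ∈ Set.Icc 0 Tstar)
    {ι : EuclideanSpace ℝ (Fin k) →L[ℝ] EuclideanSpace ℝ (Fin m) × EuclideanSpace ℝ (Fin d)}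
    (hι : ‖ι‖ ≤ 1)
    {x x' : EuclideanSpace ℝ (Fin m) × EuclideanSpace ℝ (Fin d)} {π : EuclideanSpace ℝ (Fin m)}
    (hx : x ∈ Metric.ball (y t, u t) ρ) (hx' : x' ∈ Metric.ball (y t, u t) ρ)
    (hπ : π ∈ Metric.ball (p t) ρ) (π' : EuclideanSpace ℝ (Fin m)) :
    ‖transposeAt ι π (fderiv ℝ f x) - transposeAt ι π' (fderiv ℝ f x')‖
      ≤ Λ₁ * ‖π - π'‖ + Λ₂ * ‖x - x'‖ := by
  have h1 : transposeAt ι π (fderiv ℝ f x) - transposeAt ι π' (fderiv ℝ f x') =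
      transposeAt ι (π - π') (fderiv ℝ f x') + transposeAt ι π (fderiv ℝ f x - fderiv ℝ f x') := by
    rw [transposeAt_sub, map_sub, sub_apply]
    abel
  rw [h1]
  refine (norm_add_le _ _).trans (add_le_add ?_ ?_)
  · exact (norm_transposeAt_apply_le hι _ _).trans
      (mul_le_mul_of_nonneg_right (hb.norm_fderiv_le hρ ht hx') (norm_nonneg _))
  · exact (norm_transposeAt_apply_le hι _ _).trans (hb.norm_fderiv_sub_mul_le ht hx hx' hπ)

lemma norm_adjY_sub_le (hb : SmoothnessBounds f Tstar y p u ρ Λ₁ Λ₂ Λ₃)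
    (hρ : 0 < ρ) {t : ℝ} (ht : t ∈ Set.Icc 0 Tstar)
    {x x' : EuclideanSpace ℝ (Fin m) × EuclideanSpace ℝ (Fin d)} {π : EuclideanSpace ℝ (Fin m)}
    (hx : x ∈ Metric.ball (y t, u t) ρ) (hx' : x' ∈ Metric.ball (y t, u t) ρ)
    (hπ : π ∈ Metric.ball (p t) ρ) (π' : EuclideanSpace ℝ (Fin m)) :
    ‖adjY f x.1 π x.2 - adjY f x'.1 π' x'.2‖ ≤ Λ₁ * ‖π - π'‖ + Λ₂ * ‖x - x'‖ := by
  rw [hb.adjY_eq ht hx, hb.adjY_eq ht hx']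
  exact hb.norm_transposeAt_fderiv_sub_le hρ ht (ContinuousLinearMap.norm_inl_le_one _ _ _)
    hx hx' hπ π'

lemma norm_adjU_sub_le (hb : SmoothnessBounds f Tstar y p u ρ Λ₁ Λ₂ Λ₃)
    (hρ : 0 < ρ) {t : ℝ} (ht : t ∈ Set.Icc 0 Tstar)
    {x x' : EuclideanSpace ℝ (Fin m) × EuclideanSpace ℝ (Fin d)} {π : EuclideanSpace ℝ (Fin m)}
    (hx : x ∈ Metric.ball (y t, u t) ρ) (hx' : x' ∈ Metric.ball (y t, u t) ρ)
    (hπ : π ∈ Metric.ball (p t) ρ) (π' : EuclideanSpace ℝ (Fin m)) :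
    ‖adjU f x.1 π x.2 - adjU f x'.1 π' x'.2‖ ≤ Λ₁ * ‖π - π'‖ + Λ₂ * ‖x - x'‖ := by
  rw [hb.adjU_eq ht hx, hb.adjU_eq ht hx']
  exact hb.norm_transposeAt_fderiv_sub_le hρ ht (ContinuousLinearMap.norm_inr_le_one _ _ _)
    hx hx' hπ π'

lemma contDiffAt_adjU (hb : SmoothnessBounds f Tstar y p u ρ Λ₁ Λ₂ Λ₃)
    {t : ℝ} (ht : t ∈ Set.Icc 0 Tstar)
    {x : EuclideanSpace ℝ (Fin m) × EuclideanSpace ℝ (Fin d)}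
    (hx : x ∈ Metric.ball (y t, u t) ρ) (π : EuclideanSpace ℝ (Fin m)) :
    ContDiffAt ℝ 2 (fun x : EuclideanSpace ℝ (Fin m) × EuclideanSpace ℝ (Fin d) =>
      adjU f x.1 π x.2) x :=
  (transposeAt (ContinuousLinearMap.id ℝ (EuclideanSpace ℝ (Fin d))) π).contDiff.contDiffAt.comp x
    (hb.smooth_fu.contDiffAt (tube_mem_nhds ht hx))

lemma adjU_eventuallyEq (hb : SmoothnessBounds f Tstar y p u ρ Λ₁ Λ₂ Λ₃)
    {t : ℝ} (ht : t ∈ Set.Icc 0 Tstar)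
    {x : EuclideanSpace ℝ (Fin m) × EuclideanSpace ℝ (Fin d)}
    (hx : x ∈ Metric.ball (y t, u t) ρ) (π : EuclideanSpace ℝ (Fin m)) :
    (fun x : EuclideanSpace ℝ (Fin m) × EuclideanSpace ℝ (Fin d) => adjU f x.1 π x.2)
      =ᶠ[nhds x] fun x => transposeAt (ContinuousLinearMap.inr ℝ _ _) π (fderiv ℝ f x) := by
  filter_upwards [Metric.isOpen_ball.mem_nhds hx] with z hz
  exact hb.adjU_eq ht hz π

lemma hasFDerivAt_adjU (hb : SmoothnessBounds f Tstar y p u ρ Λ₁ Λ₂ Λ₃)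
    {t : ℝ} (ht : t ∈ Set.Icc 0 Tstar)
    {x : EuclideanSpace ℝ (Fin m) × EuclideanSpace ℝ (Fin d)}
    (hx : x ∈ Metric.ball (y t, u t) ρ) (π : EuclideanSpace ℝ (Fin m)) :
    HasFDerivAt (fun v => adjU f x.1 π v)
      ((fderiv ℝ (fun x : EuclideanSpace ℝ (Fin m) × EuclideanSpace ℝ (Fin d) =>
        adjU f x.1 π x.2) x).comp (ContinuousLinearMap.inr ℝ _ _)) x.2 := by
  have h1 : HasFDerivAt (fun v : EuclideanSpace ℝ (Fin d) => (x.1, v))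
      (ContinuousLinearMap.inr ℝ (EuclideanSpace ℝ (Fin m)) (EuclideanSpace ℝ (Fin d))) x.2 :=
    hasFDerivAt_prodMk_right _ _
  exact (((hb.contDiffAt_adjU ht hx π).differentiableAt (by norm_num)).hasFDerivAt).comp x.2 h1

lemma norm_fderiv_adjU_sub_le (hb : SmoothnessBounds f Tstar y p u ρ Λ₁ Λ₂ Λ₃)
    {t : ℝ} (ht : t ∈ Set.Icc 0 Tstar)
    {x : EuclideanSpace ℝ (Fin m) × EuclideanSpace ℝ (Fin d)} {π : EuclideanSpace ℝ (Fin m)}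
    (hx : x ∈ Metric.ball (y t, u t) ρ) (hπ : π ∈ Metric.ball (p t) ρ)
    (π' : EuclideanSpace ℝ (Fin m)) :
    ‖fderiv ℝ (fun x : EuclideanSpace ℝ (Fin m) × EuclideanSpace ℝ (Fin d) =>
        adjU f x.1 π' x.2) x -
      fderiv ℝ (fun x : EuclideanSpace ℝ (Fin m) × EuclideanSpace ℝ (Fin d) =>
        adjU f x.1 π x.2) x‖ ≤ Λ₂ * ‖π' - π‖ := by
  rw [(hb.adjU_eventuallyEq ht hx π).fderiv_eq, (hb.adjU_eventuallyEq ht hx π').fderiv_eq]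
  have hι : ‖ContinuousLinearMap.inr ℝ (EuclideanSpace ℝ (Fin m)) (EuclideanSpace ℝ (Fin d))‖ ≤ 1 :=
    ContinuousLinearMap.norm_inr_le_one _ _ _
  refine (norm_fderiv_transposeAt_sub_le (ContinuousLinearMap.inr ℝ (EuclideanSpace ℝ (Fin m))
    (EuclideanSpace ℝ (Fin d))) hι π' π (fderiv ℝ f) x (hb.differentiableAt_fderiv ht hx)).trans ?_
  rw [mul_comm]
  refine mul_le_mul_of_nonneg_right ?_ (norm_nonneg (π' - π))
  exact le_trans (le_mul_of_one_le_left (norm_nonneg (fderiv ℝ (fderiv ℝ f) x))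
    (by linarith [norm_nonneg π])) (hb.norm_fderiv_fderiv_le ht hx hπ)

/-- The Hessian in `u` of the Hamiltonian varies little near the continuous solution: with `Λ₃` in
`(y, u)`, and with `Λ₂` in the multiplier, on which it depends linearly. -/
lemma norm_hessUU_sub_le (hb : SmoothnessBounds f Tstar y p u ρ Λ₁ Λ₂ Λ₃)
    (hρ : 0 < ρ) {t : ℝ} (ht : t ∈ Set.Icc 0 Tstar)
    {x : EuclideanSpace ℝ (Fin m) × EuclideanSpace ℝ (Fin d)} {π : EuclideanSpace ℝ (Fin m)}
    (hx : x ∈ Metric.ball (y t, u t) ρ) (hπ : π ∈ Metric.ball (p t) ρ) :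
    ‖hessUU f x.1 π x.2 - hessUU f (y t) (p t) (u t)‖
      ≤ Λ₃ * ‖x - (y t, u t)‖ + Λ₂ * ‖π - p t‖ := by
  have hx₀ : (y t, u t) ∈ Metric.ball (y t, u t) ρ := Metric.mem_ball_self hρ
  set ψ : EuclideanSpace ℝ (Fin m) → EuclideanSpace ℝ (Fin m) × EuclideanSpace ℝ (Fin d) →
    EuclideanSpace ℝ (Fin d) := fun π x => adjU f x.1 π x.2 with hψ
  have e1 : hessUU f x.1 π x.2 = (fderiv ℝ (ψ π) x).comp (ContinuousLinearMap.inr ℝ _ _) :=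
    (hb.hasFDerivAt_adjU ht hx π).fderiv
  have e2 : hessUU f (y t) (p t) (u t) =
      (fderiv ℝ (ψ (p t)) (y t, u t)).comp (ContinuousLinearMap.inr ℝ _ _) :=
    (hb.hasFDerivAt_adjU ht hx₀ (p t)).fderiv
  have b1 : ‖fderiv ℝ (ψ π) x - fderiv ℝ (ψ π) (y t, u t)‖ ≤ Λ₃ * ‖x - (y t, u t)‖ := by
    refine (convex_ball (y t, u t) ρ).norm_image_sub_le_of_norm_fderiv_le
      (fun z hz => ((hb.contDiffAt_adjU ht hz π).fderiv_right (m := 1)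
        (by norm_num)).differentiableAt (by norm_num)) (fun z hz => ?_) hx₀ hx
    refine hb.bound₃ t ht z.1 π z.2 ?_
    rw [Metric.mem_ball, Prod.dist_eq, max_lt_iff] at hz
    simp only [Prod.dist_eq, max_lt_iff]
    exact ⟨hz.1, hπ, hz.2⟩
  have b2 : ‖fderiv ℝ (ψ π) (y t, u t) - fderiv ℝ (ψ (p t)) (y t, u t)‖ ≤ Λ₂ * ‖π - p t‖ := by
    exact hb.norm_fderiv_adjU_sub_le ht hx₀ (Metric.mem_ball_self hρ) π
  rw [e1, e2, ← ContinuousLinearMap.sub_comp]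
  calc _ ≤ ‖fderiv ℝ (ψ π) x - fderiv ℝ (ψ (p t)) (y t, u t)‖ * 1 :=
        norm_clm_comp_le le_rfl (ContinuousLinearMap.norm_inr_le_one _ _ _)
    _ ≤ _ := by
        rw [mul_one]
        exact (norm_sub_le_norm_sub_add_norm_sub _ (fderiv ℝ (ψ π) (y t, u t)) _).trans
          (add_le_add b1 b2)

/-- The simplified Newton map `ν ↦ ν - R ∇_u f(η, ν)ᵀ π` of the control equation, with the inverse
Hessian `R` at the continuous solution, contracts in `ν` near that solution. -/
lemma norm_newton_sub_le (hb : SmoothnessBounds f Tstar y p u ρ Λ₁ Λ₂ Λ₃)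
    (hρ : 0 < ρ) {t ω δ : ℝ} (ht : t ∈ Set.Icc 0 Tstar) (hδρ : δ ≤ ρ)
    {R : EuclideanSpace ℝ (Fin d) →L[ℝ] EuclideanSpace ℝ (Fin d)}
    (hR : R.comp (hessUU f (y t) (p t) (u t)) = ContinuousLinearMap.id ℝ _) (hRω : ‖R‖ ≤ ω)
    (hδ : ω * ((Λ₃ + Λ₂) * δ) ≤ 1 / 8)
    {η η' π π' : EuclideanSpace ℝ (Fin m)} {ν ν' : EuclideanSpace ℝ (Fin d)}
    (hη : η ∈ Metric.ball (y t) δ) (hη' : η' ∈ Metric.ball (y t) δ)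
    (hπ : π ∈ Metric.ball (p t) δ)
    (hν : ν ∈ Metric.ball (u t) δ) (hν' : ν' ∈ Metric.ball (u t) δ) :
    ‖(ν - R (adjU f η π ν)) - (ν' - R (adjU f η' π' ν'))‖
      ≤ 1 / 8 * ‖ν - ν'‖ + ω * (Λ₁ * ‖π - π'‖ + Λ₂ * ‖η - η'‖) := by
  have hω : 0 ≤ ω := (norm_nonneg _).trans hRω
  obtain ⟨-, hΛ₂, hΛ₃⟩ := hb.nonneg hρ ht
  have hball : ∀ {η : EuclideanSpace ℝ (Fin m)} {ν : EuclideanSpace ℝ (Fin d)},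
      η ∈ Metric.ball (y t) δ → ν ∈ Metric.ball (u t) δ → (η, ν) ∈ Metric.ball (y t, u t) δ :=
    fun h h' => by
      rw [Metric.mem_ball, Prod.dist_eq, max_lt_iff]
      exact ⟨h, h'⟩
  have hmono : ∀ {x : EuclideanSpace ℝ (Fin m) × EuclideanSpace ℝ (Fin d)},
      x ∈ Metric.ball (y t, u t) δ → x ∈ Metric.ball (y t, u t) ρ := fun h =>
    Metric.ball_subset_ball hδρ h
  have hπρ : π ∈ Metric.ball (p t) ρ := Metric.ball_subset_ball hδρ hπ
  have b1 : ‖(ν - R (adjU f η π ν)) - (ν' - R (adjU f η π ν'))‖ ≤ 1 / 8 * ‖ν - ν'‖ := by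
    refine (convex_ball (u t) δ).norm_image_sub_le_of_norm_hasFDerivWithin_le
      (f := fun v => v - R (adjU f η π v))
      (f' := fun v => ContinuousLinearMap.id ℝ _ - R.comp (hessUU f η π v))
      (fun v hv => ?_) (fun v hv => ?_) hν' hν
    · have h1 := hb.hasFDerivAt_adjU ht (hmono (hball hη hv)) π
      have h2 : HasFDerivAt (fun v => adjU f η π v) (hessUU f η π v) v :=
        h1.differentiableAt.hasFDerivAt
      exact ((hasFDerivAt_id v).sub (R.hasFDerivAt.comp v h2)).hasFDerivWithinAt
    · rw [← hR, ← ContinuousLinearMap.comp_sub]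
      refine (norm_clm_comp_le hRω ?_).trans hδ
      rw [norm_sub_rev]
      refine (hb.norm_hessUU_sub_le hρ ht (hmono (hball hη hv)) hπρ).trans ?_
      rw [add_mul]
      refine add_le_add (mul_le_mul_of_nonneg_left ?_ hΛ₃) (mul_le_mul_of_nonneg_left ?_ hΛ₂)
      · rw [← dist_eq_norm]; exact (hball hη hv).le
      · rw [← dist_eq_norm]; exact (Metric.mem_ball.1 hπ).le
  have b2 : ‖(ν' - R (adjU f η π ν')) - (ν' - R (adjU f η' π' ν'))‖
      ≤ ω * (Λ₁ * ‖π - π'‖ + Λ₂ * ‖η - η'‖) := by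
    rw [sub_sub_sub_cancel_left, ← map_sub, ← norm_neg, ← map_neg, neg_sub]
    refine (R.le_opNorm _).trans (mul_le_mul hRω ?_ (norm_nonneg _) hω)
    refine (hb.norm_adjU_sub_le hρ ht (x := (η, ν')) (x' := (η', ν')) (hmono (hball hη hν'))
      (hmono (hball hη' hν')) hπρ π').trans (le_of_eq ?_)
    simp [Prod.norm_def]
  exact (norm_sub_le_norm_sub_add_norm_sub _ (ν' - R (adjU f η π ν')) _).trans (add_le_add b1 b2)

end SmoothnessBounds

/-! ### The gradient of a quadratic objective -/

/-- The gradient of a quadratic polynomial is affine, so that its derivative at any point is its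
Lipschitz constant. -/
lemma IsQuadraticObjective.norm_gradient_sub_le {m : ℕ} {C : EuclideanSpace ℝ (Fin m) → ℝ}
    (hC : IsQuadraticObjective C) (z a b : EuclideanSpace ℝ (Fin m)) :
    ‖gradient C a - gradient C b‖ ≤ ‖fderiv ℝ (gradient C) z‖ * ‖a - b‖ := by
  obtain ⟨H, g, e, hCeq⟩ := hC
  set L := H + ContinuousLinearMap.adjoint H with hL
  have hgrad : ∀ y, gradient C y = g + L y := by
    intro y
    refine HasGradientAt.gradient ?_
    rw [hasGradientAt_iff_hasFDerivAt]
    have h1 : HasFDerivAt (fun y => ⟪g, y⟫_ℝ) (innerSL ℝ g) y := (innerSL ℝ g).hasFDerivAt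
    have h2 := (H.hasFDerivAt (x := y)).inner ℝ (hasFDerivAt_id y)
    have h3 := (h1.const_add e).add h2
    have h4 : C = fun y => e + ⟪g, y⟫_ℝ + ⟪H y, y⟫_ℝ := funext hCeq
    rw [h4]
    refine h3.congr_fderiv ?_
    ext v
    simp [hL, ContinuousLinearMap.adjoint_inner_left, real_inner_comm, fderivInnerCLM_apply]
  have hfd : fderiv ℝ (gradient C) z = L := by
    rw [show gradient C = fun y => g + L y from funext hgrad]
    exact (L.hasFDerivAt.const_add g).fderiv
  rw [hfd, hgrad, hgrad, add_sub_add_left_eq_sub, ← map_sub]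
  exact L.le_opNorm _

namespace PeerTriplet

variable {s : ℕ} (M : PeerTriplet s) {m d : ℕ}
  (f : EuclideanSpace ℝ (Fin m) × EuclideanSpace ℝ (Fin d) → EuclideanSpace ℝ (Fin m))
  (C : EuclideanSpace ℝ (Fin m) → ℝ)

/-! ### Right-hand sides of the discrete equations -/

/-- The right-hand side of the discrete state equation. -/
def stateRhs (y₀ : EuclideanSpace ℝ (Fin m)) (h : ℝ) (N : ℕ)
    (Y : Fin (N + 1) → Fin s → EuclideanSpace ℝ (Fin m))
    (U : Fin (N + 1) → Fin s → EuclideanSpace ℝ (Fin d)) :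
    Fin (N + 1) → Fin s → EuclideanSpace ℝ (Fin m) := fun n i =>
  (if n = 0 then M.a i • y₀ else 0) +
    h • kronApply (M.coefK N n) (fun j => f (Y n j, U n j)) i

/-- The right-hand side of the discrete adjoint equation. -/
def adjointRhs (h : ℝ) (N : ℕ)
    (Y P : Fin (N + 1) → Fin s → EuclideanSpace ℝ (Fin m))
    (U : Fin (N + 1) → Fin s → EuclideanSpace ℝ (Fin d)) :
    Fin (N + 1) → Fin s → EuclideanSpace ℝ (Fin m) := fun n i =>
  (if n = Fin.last N then M.w i • gradient C (∑ k, M.w k • Y (Fin.last N) k) else 0) +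
    h • adjY f (Y n i) (kronApply (M.coefK N n)ᵀ (P n) i) (U n i)

/-- The weighted average of the adjoint stages that enters the control equation of stage `i`. -/
def stageAverage (N : ℕ) (P : Fin (N + 1) → Fin s → EuclideanSpace ℝ (Fin m))
    (n : Fin (N + 1)) (i : Fin s) : EuclideanSpace ℝ (Fin m) :=
  (colSum (M.coefK N n) i)⁻¹ • kronApply (M.coefK N n)ᵀ (P n) i

variable {M f C}

lemma isDiscreteKKT_iff {y₀ : EuclideanSpace ℝ (Fin m)} {h : ℝ} {N : ℕ}
    {Y P : Fin (N + 1) → Fin s → EuclideanSpace ℝ (Fin m)}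
    {U : Fin (N + 1) → Fin s → EuclideanSpace ℝ (Fin d)} :
    IsDiscreteKKT f C M y₀ h N Y P U ↔
      M.stateOp m N Y = M.stateRhs f y₀ h N Y U ∧
      M.adjointOp m N P = M.adjointRhs f C h N Y P U ∧
      ∀ n i, adjU f (Y n i) (kronApply (M.coefK N n)ᵀ (P n) i) (U n i) = 0 := by
  constructor
  · rintro ⟨h1, h2, h3, h4, h5⟩
    refine ⟨?_, ?_, h5⟩
    · funext n i
      refine Fin.cases ?_ (fun n => ?_) n
      · rw [stateOp_zero, h1]; simp [stateRhs]
      · rw [stateOp_succ, Pi.sub_apply, h2]; simp [stateRhs]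
    · funext n i
      refine Fin.lastCases ?_ (fun n => ?_) n
      · rw [adjointOp_last, h3]; simp [adjointRhs]
      · rw [adjointOp_castSucc, Pi.sub_apply, h4]; simp [adjointRhs]
  · rintro ⟨h1, h2, h3⟩
    refine ⟨fun i => ?_, fun n i => ?_, fun i => ?_, fun n i => ?_, h3⟩
    · have := congrFun (congrFun h1 0) i
      rw [stateOp_zero] at this
      simpa [stateRhs] using this
    · have := congrFun (congrFun h1 n.succ) i
      rw [stateOp_succ, Pi.sub_apply, sub_eq_iff_eq_add'] at this
      simpa [stateRhs] using this
    · have := congrFun (congrFun h2 (Fin.last N)) i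
      rw [adjointOp_last] at this
      simpa [adjointRhs] using this
    · have := congrFun (congrFun h2 n.castSucc) i
      rw [adjointOp_castSucc, Pi.sub_apply, sub_eq_iff_eq_add'] at this
      simpa [adjointRhs] using this

lemma kronApply_transpose_coefK_eq_zero (hM : M.Structural) (hpos : M.Positivity) {N n : ℕ}
    {i : Fin s} (hi : ¬ M.Active N n i) (P : Fin s → EuclideanSpace ℝ (Fin m)) :
    kronApply (M.coefK N n)ᵀ P i = 0 := by
  simp [kronApply, coefK_eq_zero_of_not_active hM hpos hi]

lemma kronApply_transpose_coefK (hM : M.Structural) (hpos : M.Positivity) {N : ℕ}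
    (P : Fin (N + 1) → Fin s → EuclideanSpace ℝ (Fin m)) (n : Fin (N + 1)) (i : Fin s) :
    kronApply (M.coefK N n)ᵀ (P n) i = colSum (M.coefK N n) i • M.stageAverage N P n i := by
  by_cases hi : M.Active N n i
  · rw [stageAverage, smul_inv_smul₀ hi]
  · rw [stageAverage, kronApply_transpose_coefK_eq_zero hM hpos hi, smul_zero, smul_zero]

variable (M) in
/-- A bound, uniform in the step, of a nonnegative quantity depending on the matrix `K_n`. -/
lemma coefK_le {φ : Matrix (Fin s) (Fin s) ℝ → ℝ} (hφ : ∀ K, 0 ≤ φ K) (N n : ℕ) :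
    φ (M.coefK N n) ≤ φ M.K₀ + φ M.K + φ M.KN := by
  have h1 := hφ M.K₀
  have h2 := hφ M.K
  have h3 := hφ M.KN
  unfold coefK
  split_ifs <;> linarith

/-- Bound of the entries of all `K_n`. -/
def boundK (M : PeerTriplet s) : ℝ := absSum M.K₀ + absSum M.K + absSum M.KN

/-- The sum of the moduli of the weights of the averages of the adjoint stages, up to a factor. -/
def averageWeight (K : Matrix (Fin s) (Fin s) ℝ) : ℝ := (∑ i, |(colSum K i)⁻¹|) * absSum K

/-- Lipschitz bound of the averages of the adjoint stages, in all steps. -/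
def boundAverage (M : PeerTriplet s) : ℝ :=
  averageWeight M.K₀ + averageWeight M.K + averageWeight M.KN

lemma averageWeight_nonneg (K : Matrix (Fin s) (Fin s) ℝ) : 0 ≤ averageWeight K :=
  mul_nonneg (Finset.sum_nonneg fun _ _ => abs_nonneg _) (absSum_nonneg K)

lemma boundK_nonneg (M : PeerTriplet s) : 0 ≤ M.boundK :=
  add_nonneg (add_nonneg (absSum_nonneg _) (absSum_nonneg _)) (absSum_nonneg _)

lemma boundAverage_nonneg (M : PeerTriplet s) : 0 ≤ M.boundAverage :=
  add_nonneg (add_nonneg (averageWeight_nonneg _) (averageWeight_nonneg _))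
    (averageWeight_nonneg _)

lemma absSum_coefK_le (M : PeerTriplet s) (N n : ℕ) : absSum (M.coefK N n) ≤ M.boundK :=
  M.coefK_le absSum_nonneg N n

lemma abs_colSum_coefK_le (M : PeerTriplet s) (N n : ℕ) (i : Fin s) :
    |colSum (M.coefK N n) i| ≤ M.boundK := by
  refine le_trans ?_ (M.absSum_coefK_le N n)
  rw [← absSum_transpose]
  exact (Finset.abs_sum_le_sum_abs _ _).trans (sum_abs_row_le_absSum (M.coefK N n)ᵀ i)

lemma norm_stageAverage_sub_le (M : PeerTriplet s) {N : ℕ}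
    (P P' : Fin (N + 1) → Fin s → EuclideanSpace ℝ (Fin m)) (n : Fin (N + 1)) (i : Fin s) :
    ‖M.stageAverage N P n i - M.stageAverage N P' n i‖ ≤ M.boundAverage * ‖P - P'‖ := by
  rw [stageAverage, stageAverage, ← smul_sub, ← Pi.sub_apply, ← kronApply_sub, norm_smul,
    Real.norm_eq_abs]
  have h1 : ‖kronApply (M.coefK N n)ᵀ (P n - P' n) i‖ ≤ absSum (M.coefK N n) * ‖P - P'‖ := by
    rw [← absSum_transpose]
    exact norm_kronApply_apply_le _ _ (norm_nonneg _)
      (fun j => (norm_le_pi_norm (P n - P' n) j).trans (norm_le_pi_norm (P - P') n)) i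
  have h2 : |(colSum (M.coefK N n) i)⁻¹| ≤ ∑ i, |(colSum (M.coefK N n) i)⁻¹| :=
    Finset.single_le_sum (f := fun i => |(colSum (M.coefK N n) i)⁻¹|) (fun _ _ => abs_nonneg _)
      (Finset.mem_univ i)
  calc _ ≤ (∑ i, |(colSum (M.coefK N n) i)⁻¹|) * (absSum (M.coefK N n) * ‖P - P'‖) :=
        mul_le_mul h2 h1 (norm_nonneg _) ((abs_nonneg _).trans h2)
    _ = averageWeight (M.coefK N n) * ‖P - P'‖ := by rw [averageWeight, mul_assoc]
    _ ≤ _ := mul_le_mul_of_nonneg_right (M.coefK_le averageWeight_nonneg N n) (norm_nonneg _)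

/-- A grid function lies in the tube of radius `δ` in which the local estimates hold: the states,
the averaged adjoints and the controls of all active stages are close to the solution. -/
structure InTube (M : PeerTriplet s) (y p : ℝ → EuclideanSpace ℝ (Fin m))
    (u : ℝ → EuclideanSpace ℝ (Fin d)) (h : ℝ) (N : ℕ) (δ : ℝ)
    (Y P : Fin (N + 1) → Fin s → EuclideanSpace ℝ (Fin m))
    (U : Fin (N + 1) → Fin s → EuclideanSpace ℝ (Fin d)) : Prop where
  state : ∀ (n : Fin (N + 1)) i, Y n i ∈ Metric.ball (y (M.node h n i)) δ
  average : ∀ (n : Fin (N + 1)) i, M.Active N n i →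
    M.stageAverage N P n i ∈ Metric.ball (p (M.node h n i)) δ
  control : ∀ (n : Fin (N + 1)) i, M.Active N n i → U n i ∈ Metric.ball (u (M.node h n i)) δ

section Lipschitz

variable {Tstar : ℝ} {y p : ℝ → EuclideanSpace ℝ (Fin m)} {u : ℝ → EuclideanSpace ℝ (Fin d)}
  {ρ Λ₁ Λ₂ Λ₃ : ℝ} {h : ℝ} {N : ℕ}
  {Y P Y' P' : Fin (N + 1) → Fin s → EuclideanSpace ℝ (Fin m)}
  {U U' : Fin (N + 1) → Fin s → EuclideanSpace ℝ (Fin d)}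

lemma InTube.mem_ball (hX : InTube M y p u h N ρ Y P U) {n : Fin (N + 1)} {i : Fin s}
    (hi : M.Active N n i) :
    (Y n i, U n i) ∈ Metric.ball (y (M.node h n i), u (M.node h n i)) ρ := by
  rw [Metric.mem_ball, Prod.dist_eq, max_lt_iff]
  exact ⟨hX.state n i, hX.control n i hi⟩

lemma norm_pair_sub_le (Y Y' : Fin (N + 1) → Fin s → EuclideanSpace ℝ (Fin m))
    (U U' : Fin (N + 1) → Fin s → EuclideanSpace ℝ (Fin d)) (n : Fin (N + 1)) (i : Fin s) :
    ‖(Y n i, U n i) - (Y' n i, U' n i)‖ ≤ ‖Y - Y'‖ + ‖U - U'‖ := by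
  have h1 : ‖Y n i - Y' n i‖ ≤ ‖Y - Y'‖ :=
    (norm_le_pi_norm ((Y - Y') n) i).trans (norm_le_pi_norm (Y - Y') n)
  have h2 : ‖U n i - U' n i‖ ≤ ‖U - U'‖ :=
    (norm_le_pi_norm ((U - U') n) i).trans (norm_le_pi_norm (U - U') n)
  rw [Prod.mk_sub_mk, Prod.norm_mk]
  refine max_le (h1.trans ?_) (h2.trans ?_)
  · linarith [norm_nonneg (U - U')]
  · linarith [norm_nonneg (Y - Y')]

lemma norm_stateRhs_sub_le (hM : M.Structural) (hpos : M.Positivity)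
    (hb : SmoothnessBounds f Tstar y p u ρ Λ₁ Λ₂ Λ₃) (hρ : 0 < ρ) (hh : 0 ≤ h)
    (hnode : ∀ (n : Fin (N + 1)) i, M.node h n i ∈ Set.Icc 0 Tstar)
    (hX : InTube M y p u h N ρ Y P U) (hX' : InTube M y p u h N ρ Y' P' U')
    (y₀ : EuclideanSpace ℝ (Fin m)) (n : Fin (N + 1)) (i : Fin s) :
    ‖M.stateRhs f y₀ h N Y U n i - M.stateRhs f y₀ h N Y' U' n i‖
      ≤ h * (M.boundK * (Λ₁ * (‖Y - Y'‖ + ‖U - U'‖))) := by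
  have hΛ := (hb.nonneg hρ (hnode n i)).1
  have e1 : M.stateRhs f y₀ h N Y U n i - M.stateRhs f y₀ h N Y' U' n i =
      h • ∑ j, M.coefK N n i j • (f (Y n j, U n j) - f (Y' n j, U' n j)) := by
    simp only [stateRhs, add_sub_add_left_eq_sub, ← smul_sub, kronApply,
      ← Finset.sum_sub_distrib]
  rw [e1, norm_smul, Real.norm_of_nonneg hh]
  refine mul_le_mul_of_nonneg_left ?_ hh
  calc _ ≤ ∑ j, |M.coefK N n i j| * (Λ₁ * (‖Y - Y'‖ + ‖U - U'‖)) := by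
        refine norm_sum_le_of_le _ fun j _ => ?_
        by_cases hj : M.Active N n j
        · rw [norm_smul, Real.norm_eq_abs]
          refine mul_le_mul_of_nonneg_left ?_ (abs_nonneg _)
          exact (hb.norm_f_sub_le hρ (hnode n j) (hX.mem_ball hj) (hX'.mem_ball hj)).trans
            (mul_le_mul_of_nonneg_left (norm_pair_sub_le _ _ _ _ _ _) hΛ)
        · rw [coefK_eq_zero_of_not_active hM hpos hj]; simp
    _ ≤ _ := by
        rw [← Finset.sum_mul]
        exact mul_le_mul_of_nonneg_right
          ((sum_abs_row_le_absSum _ i).trans (M.absSum_coefK_le N n)) (by positivity)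

lemma adjY_smul (k : ℝ) (y p : EuclideanSpace ℝ (Fin m)) (u : EuclideanSpace ℝ (Fin d)) :
    adjY f y (k • p) u = k • adjY f y p u := map_smul _ _ _

lemma adjU_smul (k : ℝ) (y p : EuclideanSpace ℝ (Fin m)) (u : EuclideanSpace ℝ (Fin d)) :
    adjU f y (k • p) u = k • adjU f y p u := map_smul _ _ _

lemma norm_stage_adjY_sub_le (hM : M.Structural) (hpos : M.Positivity)
    (hb : SmoothnessBounds f Tstar y p u ρ Λ₁ Λ₂ Λ₃) (hρ : 0 < ρ)
    (hnode : ∀ (n : Fin (N + 1)) i, M.node h n i ∈ Set.Icc 0 Tstar)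
    (hX : InTube M y p u h N ρ Y P U) (hX' : InTube M y p u h N ρ Y' P' U')
    (n : Fin (N + 1)) (i : Fin s) :
    ‖adjY f (Y n i) (kronApply (M.coefK N n)ᵀ (P n) i) (U n i) -
      adjY f (Y' n i) (kronApply (M.coefK N n)ᵀ (P' n) i) (U' n i)‖
      ≤ M.boundK * (Λ₁ * (M.boundAverage * ‖P - P'‖) + Λ₂ * (‖Y - Y'‖ + ‖U - U'‖)) := by
  obtain ⟨hΛ₁, hΛ₂, -⟩ := hb.nonneg hρ (hnode n i)
  have hB := M.boundAverage_nonneg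
  have hrhs : 0 ≤ Λ₁ * (M.boundAverage * ‖P - P'‖) + Λ₂ * (‖Y - Y'‖ + ‖U - U'‖) := by positivity
  rw [kronApply_transpose_coefK hM hpos, kronApply_transpose_coefK hM hpos, adjY_smul, adjY_smul,
    ← smul_sub, norm_smul, Real.norm_eq_abs]
  by_cases hi : M.Active N n i
  · refine mul_le_mul (M.abs_colSum_coefK_le N n i) ?_ (norm_nonneg _) M.boundK_nonneg
    refine (hb.norm_adjY_sub_le hρ (hnode n i) (hX.mem_ball hi) (hX'.mem_ball hi)
      (hX.average n i hi) _).trans (add_le_add ?_ ?_)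
    · exact mul_le_mul_of_nonneg_left (M.norm_stageAverage_sub_le P P' n i) hΛ₁
    · exact mul_le_mul_of_nonneg_left (norm_pair_sub_le _ _ _ _ _ _) hΛ₂
  · rw [show colSum (M.coefK N n) i = 0 from not_not.1 hi, abs_zero, zero_mul]
    exact mul_nonneg M.boundK_nonneg hrhs

lemma norm_endTerm_sub_le (hC : IsQuadraticObjective C) (z : EuclideanSpace ℝ (Fin m))
    (Y Y' : Fin (N + 1) → Fin s → EuclideanSpace ℝ (Fin m)) (i : Fin s) :
    ‖M.w i • gradient C (∑ k, M.w k • Y (Fin.last N) k) -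
      M.w i • gradient C (∑ k, M.w k • Y' (Fin.last N) k)‖
      ≤ (∑ k, |M.w k|) ^ 2 * (‖fderiv ℝ (gradient C) z‖ * ‖Y - Y'‖) := by
  rw [← smul_sub, norm_smul, Real.norm_eq_abs]
  have h1 : |M.w i| ≤ ∑ k, |M.w k| :=
    Finset.single_le_sum (f := fun k => |M.w k|) (fun _ _ => abs_nonneg _) (Finset.mem_univ i)
  have h2 : ‖∑ k, M.w k • Y (Fin.last N) k - ∑ k, M.w k • Y' (Fin.last N) k‖
      ≤ (∑ k, |M.w k|) * ‖Y - Y'‖ := by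
    simp only [← Finset.sum_sub_distrib, ← smul_sub]
    exact norm_sum_smul_le _ _ _ _ fun k _ =>
      (norm_le_pi_norm ((Y - Y') (Fin.last N)) k).trans (norm_le_pi_norm (Y - Y') _)
  have h3 := (hC.norm_gradient_sub_le z _ _).trans
    (mul_le_mul_of_nonneg_left h2 (norm_nonneg (fderiv ℝ (gradient C) z)))
  refine (mul_le_mul h1 h3 (norm_nonneg _) ((abs_nonneg _).trans h1)).trans (le_of_eq ?_)
  ring

end Lipschitz

end PeerTriplet

/-! ### Consistency of the discrete system -/

/-- Residuals of a finite family of two-step formulas whose moments of order at most `K` agree. -/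
lemma exists_residual_bound {F : Type*} [NormedAddCommGroup F] [NormedSpace ℝ F] {a b : ℝ}
    (hab : a < b) {K : ℕ} {y y' : ℝ → F} (hy : ContDiffOn ℝ (K + 1 : ℕ) y (Set.Icc a b))
    (hy' : ∀ t ∈ Set.Icc a b, HasDerivWithinAt y (y' t) (Set.Icc a b) t)
    {s : ℕ} (c : Fin s → ℝ) {τ ι : Type} [Fintype τ] [Fintype ι] (α κ : τ → Fin s → ℝ)
    (β θ : τ → ι → ℝ)
    (hmom : ∀ l < K + 1, ∀ i, ∑ j, α i j * c j ^ l =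
      ∑ j, β i j * θ i j ^ l + l * ∑ j, κ i j * c j ^ (l - 1)) :
    ∃ B : ℝ, 0 ≤ B ∧ ∀ x h : ℝ, 0 ≤ h → x ∈ Set.Icc a b → (∀ j, x + c j * h ∈ Set.Icc a b) →
      ∀ i, (∀ j, x + θ i j * h ∈ Set.Icc a b) →
      ‖∑ j, α i j • y (x + c j * h) - ∑ j, β i j • y (x + θ i j * h)
        - h • ∑ j, κ i j • y' (x + c j * h)‖ ≤ B * h ^ (K + 1) := by
  obtain ⟨M, hM0, hM⟩ := exists_functional_bound hab hy hy'
  set b₀ : τ → ℝ := fun i => M * (∑ j : Fin s ⊕ ι, |Sum.elim (α i) (fun j => -β i j) j| *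
    |Sum.elim c (θ i) j| ^ (K + 1) + ∑ j, |(-κ i j)| * |c j| ^ K) with hb₀
  have hb₀0 : ∀ i, 0 ≤ b₀ i := fun i => by
    have h1 : 0 ≤ ∑ j : Fin s ⊕ ι, |Sum.elim (α i) (fun j => -β i j) j| *
      |Sum.elim c (θ i) j| ^ (K + 1) := Finset.sum_nonneg fun _ _ => by positivity
    have h2 : 0 ≤ ∑ j, |(-κ i j)| * |c j| ^ K := Finset.sum_nonneg fun _ _ => by positivity
    positivity
  refine ⟨∑ i, b₀ i, Finset.sum_nonneg fun i _ => hb₀0 i, ?_⟩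
  intro x h hh hx hc i hθ
  have h1 := hM (Sum.elim (α i) (fun j => -β i j)) (Sum.elim c (θ i)) (fun j => -κ i j) c ?_ x h hh
    hx ?_ hc
  · simp only [Fintype.sum_sum_type, Sum.elim_inl, Sum.elim_inr, neg_smul,
      Finset.sum_neg_distrib, smul_neg, ← sub_eq_add_neg] at h1
    refine h1.trans (mul_le_mul_of_nonneg_right ?_ (pow_nonneg hh _))
    refine le_trans (le_of_eq ?_) (Finset.single_le_sum (fun i _ => hb₀0 i) (Finset.mem_univ i))
    simp only [hb₀, Fintype.sum_sum_type, Sum.elim_inl, Sum.elim_inr]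
  · intro l hl
    have := hmom l hl i
    simp only [Fintype.sum_sum_type, Sum.elim_inl, Sum.elim_inr, neg_mul,
      Finset.sum_neg_distrib, this]
    ring
  · rintro (j | j)
    · exact hc j
    · exact hθ j

namespace PeerTriplet

variable {s q r : ℕ} {M : PeerTriplet s}

/-- The restriction of a function to the grid of the off-step points. -/
def onGrid {F : Type*} (M : PeerTriplet s) (h : ℝ) (N : ℕ) (g : ℝ → F) : Fin (N + 1) → Fin s → F :=
  fun n i => g (M.node h n i)

lemma node_eq_shift_pred (M : PeerTriplet s) (h : ℝ) (n : ℕ) (i : Fin s) :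
    M.node h n i = ((n + 1 : ℕ) : ℝ) * h + (M.c i - 1) * h := by
  simp only [node]; push_cast; ring

lemma node_succ_eq_shift (M : PeerTriplet s) (h : ℝ) (n : ℕ) (i : Fin s) :
    M.node h (n + 1 : ℕ) i = (n : ℝ) * h + (M.c i + 1) * h := by
  simp only [node]; push_cast; ring

variable {m : ℕ} {Tstar : ℝ} {y y' : ℝ → EuclideanSpace ℝ (Fin m)}

lemma exists_step_residual_bound {K : ℕ} (hT : 0 < Tstar)
    (hy : ContDiffOn ℝ (K + 1 : ℕ) y (Set.Icc 0 Tstar))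
    (hy' : ∀ t ∈ Set.Icc 0 Tstar, HasDerivWithinAt y (y' t) (Set.Icc 0 Tstar) t)
    {A B Q : Matrix (Fin s) (Fin s) ℝ}
    (hmom : ∀ l < K + 1, ∀ i, ∑ j, A i j * M.c j ^ l =
      ∑ j, B i j * (M.c j - 1) ^ l + l * ∑ j, Q i j * M.c j ^ (l - 1)) :
    ∃ b : ℝ, 0 ≤ b ∧ ∀ (h : ℝ) (n : ℕ), 0 ≤ h → ((n + 1 : ℕ) : ℝ) * h ∈ Set.Icc 0 Tstar →
      (∀ i, M.node h n i ∈ Set.Icc 0 Tstar) → (∀ i, M.node h (n + 1 : ℕ) i ∈ Set.Icc 0 Tstar) →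
      ∀ i, ‖kronApply A (fun j => y (M.node h (n + 1 : ℕ) j)) i -
        kronApply B (fun j => y (M.node h n j)) i -
        h • kronApply Q (fun j => y' (M.node h (n + 1 : ℕ) j)) i‖ ≤ b * h ^ (K + 1) := by
  obtain ⟨b, hb0, hb⟩ := exists_residual_bound hT hy hy' M.c (fun i j => A i j) (fun i j => Q i j)
    (fun i j => B i j) (fun _ j => M.c j - 1) hmom
  refine ⟨b, hb0, fun h n hh hx hn hn1 i => ?_⟩
  simp only [M.node_eq_shift_pred h n] at hn ⊢
  exact hb _ h hh hx hn1 i hn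

/-- Consistency of the discrete state equation: all residuals are of order `h ^ q`, and in the
standard steps the sums over the stages are of order `h ^ (q + 1)`. -/
theorem exists_state_consistency (hq : 1 ≤ q) (hqr : q ≤ r) (hord : M.OrderConditions q r)
    (hsup : M.Superconvergence q r) (hT : 0 < Tstar)
    (hy : ContDiffOn ℝ (q + 1 : ℕ) y (Set.Icc 0 Tstar))
    (hy' : ∀ t ∈ Set.Icc 0 Tstar, HasDerivWithinAt y (y' t) (Set.Icc 0 Tstar) t) :
    ∃ b : ℝ, 0 ≤ b ∧ ∀ (N : ℕ) (h : ℝ), 2 ≤ N → 0 ≤ h → (N : ℝ) * h ≤ Tstar →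
      (∀ (n : Fin (N + 1)) i, M.node h n i ∈ Set.Icc 0 Tstar) →
      ∀ V : Fin (N + 1) → Fin s → EuclideanSpace ℝ (Fin m),
      (∀ (n : Fin (N + 1)) i, V n i = M.stateOp m N (M.onGrid h N y) n i -
        ((if n = 0 then M.a i • y 0 else 0) +
          h • kronApply (M.coefK N n) (fun j => y' (M.node h n j)) i)) →
      (∀ n i, ‖V n i‖ ≤ b * h ^ q) ∧
      ∀ n : Fin (N + 1), (n : ℕ) ≠ 0 → (n : ℕ) ≠ N → ‖∑ i, V n i‖ ≤ b * h ^ (q + 1) := by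
  obtain ⟨K, rfl⟩ : ∃ K, q = K + 1 := ⟨q - 1, by omega⟩
  have hyK : ContDiffOn ℝ (K + 1 : ℕ) y (Set.Icc 0 Tstar) :=
    hy.of_le (by exact_mod_cast Nat.le_succ _)
  obtain ⟨b0, p0, hb0⟩ := exists_residual_bound hT hyK hy' M.c (fun i j => M.A₀ i j)
    (fun i j => M.K₀ i j) (fun i (_ : Unit) => M.a i) (fun _ _ => 0)
    (fun l hl i => by simpa using moment_start hord (hl.trans_le hqr) i)
  obtain ⟨b1, p1, hb1⟩ := exists_step_residual_bound (M := M) hT hyK hy'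
    (fun l hl i => moment_of_forward hord.standard_forward (hl.trans_le hqr) i)
  obtain ⟨b2, p2, hb2⟩ := exists_step_residual_bound (M := M) hT hyK hy'
    (fun l hl i => moment_of_forward hord.last_forward (hl.trans_le hqr) i)
  obtain ⟨b3, p3, hb3⟩ := exists_residual_bound hT hy hy' M.c
    (fun (_ : Unit) j => ∑ i, M.A i j) (fun _ j => ∑ i, M.K i j)
    (fun _ j => ∑ i, M.B i j) (fun _ j => M.c j - 1)
    (fun l hl _ => moment_forward_sum hqr hord hsup hl)
  refine ⟨b0 + b1 + b2 + b3, by positivity, fun N h hN hh hNh hnode V hV => ?_⟩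
  have hbase : ∀ n : Fin N, (((n : ℕ) + 1 : ℕ) : ℝ) * h ∈ Set.Icc 0 Tstar := fun n =>
    ⟨by positivity, le_trans (mul_le_mul_of_nonneg_right (by exact_mod_cast n.2) hh) hNh⟩
  have hVsucc : ∀ (n : Fin N) i, V n.succ i =
      kronApply (M.coefA N (n + 1)) (fun j => y (M.node h ((n : ℕ) + 1 : ℕ) j)) i -
        kronApply (M.coefB N (n + 1)) (fun j => y (M.node h n j)) i -
        h • kronApply (M.coefK N (n + 1)) (fun j => y' (M.node h ((n : ℕ) + 1 : ℕ) j)) i := by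
    intro n i
    rw [hV, stateOp_succ, if_neg (Fin.succ_ne_zero n), zero_add]
    rfl
  constructor
  · intro n i
    refine Fin.cases ?_ (fun n => ?_) n
    · have h1 := hb0 0 h hh ⟨le_rfl, hT.le⟩ (fun j => by simpa [node] using hnode 0 j) i
        (fun _ => by simpa using hT.le)
      have h2 : V 0 i = ∑ j, M.A₀ i j • y (0 + M.c j * h) - ∑ j : Unit, M.a i • y (0 + 0 * h)
          - h • ∑ j, M.K₀ i j • y' (0 + M.c j * h) := by
        rw [hV, stateOp_zero]
        simp [kronApply, coefA, coefK, onGrid, node, sub_sub]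
      rw [h2]
      refine h1.trans (mul_le_mul_of_nonneg_right (by linarith) (pow_nonneg hh _))
    · rw [hVsucc]
      have e1 := hnode n.castSucc
      have e2 := hnode n.succ
      by_cases hn : (n : ℕ) + 1 = N
      · simp only [coefA, coefB, coefK, if_pos hn, if_neg (Nat.succ_ne_zero _)]
        exact (hb2 h n hh (hbase n) e1 e2 i).trans
          (mul_le_mul_of_nonneg_right (by linarith) (pow_nonneg hh _))
      · simp only [coefA, coefB, coefK, if_neg hn, if_neg (Nat.succ_ne_zero _)]
        exact (hb1 h n hh (hbase n) e1 e2 i).trans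
          (mul_le_mul_of_nonneg_right (by linarith) (pow_nonneg hh _))
  · intro n hn0 hnN
    obtain ⟨k, rfl⟩ := Fin.exists_succ_eq.2 (fun h0 => hn0 (by simp [h0]) : n ≠ 0)
    rw [Fin.val_succ] at hnN
    have e1 := hnode k.castSucc
    have e2 := hnode k.succ
    have h1 := hb3 _ h hh (hbase k) e2 ()
      (fun j => by rw [← M.node_eq_shift_pred h k]; exact e1 j)
    have h2 : ∑ i, V k.succ i = ∑ j, (∑ i, M.A i j) • y ((((k : ℕ) + 1 : ℕ) : ℝ) * h + M.c j * h)
        - ∑ j, (∑ i, M.B i j) • y ((((k : ℕ) + 1 : ℕ) : ℝ) * h + (M.c j - 1) * h)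
        - h • ∑ j, (∑ i, M.K i j) • y' ((((k : ℕ) + 1 : ℕ) : ℝ) * h + M.c j * h) := by
      simp only [hVsucc, coefA, coefB, coefK, if_neg hnN, if_neg (Nat.succ_ne_zero _),
        Finset.sum_sub_distrib, ← Finset.smul_sum, kronApply, Finset.sum_smul,
        M.node_eq_shift_pred h k]
      rw [Finset.sum_comm (f := fun i j => M.A i j • _), Finset.sum_comm (f := fun i j => M.B i j • _),
        Finset.sum_comm (f := fun i j => M.K i j • _)]
      rfl
    rw [h2]
    exact h1.trans (mul_le_mul_of_nonneg_right (by linarith) (pow_nonneg hh _))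

end PeerTriplet

/-! ### Consistency of the adjoint averages and of the end value -/

namespace PeerTriplet

variable {s q r : ℕ} {M : PeerTriplet s} {m : ℕ} {Tstar : ℝ}
  {p p' : ℝ → EuclideanSpace ℝ (Fin m)}

lemma sum_neg_colSum_mul (K : Matrix (Fin s) (Fin s) ℝ) (i : Fin s) (g : Fin s → ℝ) :
    ∑ j, (if j = i then -colSum K i else 0) * g j = -(colSum K i * g i) := by
  simp

/-- Residuals of one step of the adjoint equation, with `p'` taken at the single node `i` and the weight
`𝟙ᵀ K`. The one-leg conditions turn the order conditions into the moment conditions of this form. -/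
lemma exists_adjointStep_residual_bound {K : ℕ} (hT : 0 < Tstar)
    (hp : ContDiffOn ℝ (K + 1 : ℕ) p (Set.Icc 0 Tstar))
    (hp' : ∀ t ∈ Set.Icc 0 Tstar, HasDerivWithinAt p (p' t) (Set.Icc 0 Tstar) t)
    {A B Q : Matrix (Fin s) (Fin s) ℝ} (hQ : OneLeg M.c (K + 1) Q)
    (h : Aᵀ * vandermondeV M.c (K + 1) = Bᵀ * vandermondeV M.c (K + 1) * pascalP (K + 1)
      - Qᵀ * vandermondeV M.c (K + 1) * nilpotentE (K + 1)) :
    ∃ b : ℝ, 0 ≤ b ∧ ∀ (h : ℝ) (n : ℕ), 0 ≤ h → (n : ℝ) * h ∈ Set.Icc 0 Tstar →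
      (∀ i, M.node h n i ∈ Set.Icc 0 Tstar) → (∀ i, M.node h (n + 1 : ℕ) i ∈ Set.Icc 0 Tstar) →
      ∀ i, ‖kronApply Aᵀ (fun j => p (M.node h n j)) i -
        kronApply Bᵀ (fun j => p (M.node h (n + 1 : ℕ) j)) i +
        h • colSum Q i • p' (M.node h n i)‖ ≤ b * h ^ (K + 1) := by
  obtain ⟨b, hb0, hb⟩ := exists_residual_bound hT hp hp' M.c (fun i j => A j i)
    (fun i j => if j = i then -colSum Q i else 0) (fun i j => B j i) (fun _ j => M.c j + 1)
    (fun l hl i => by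
      rw [moment_of_adjoint h hl i, hQ.moment (by omega : l - 1 < K + 1) i, sum_neg_colSum_mul]
      ring)
  refine ⟨b, hb0, fun h n hh hx hn hn1 i => ?_⟩
  simp only [M.node_succ_eq_shift h n] at hn1 ⊢
  have := hb _ h hh hx hn i hn1
  simp only [ite_smul, zero_smul, Finset.sum_ite_eq', Finset.mem_univ, if_true, neg_smul, smul_neg,
    sub_neg_eq_add] at this
  exact this

/-- Consistency of the discrete adjoint equation, with the one-leg property inserted. -/
theorem exists_adjoint_consistency (hq : 1 ≤ q) (hM : M.Structural) (hord : M.OrderConditions q r)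
    (hsup : M.Superconvergence q r) (hT : 0 < Tstar)
    (hp : ContDiffOn ℝ (q + 1 : ℕ) p (Set.Icc 0 Tstar))
    (hp' : ∀ t ∈ Set.Icc 0 Tstar, HasDerivWithinAt p (p' t) (Set.Icc 0 Tstar) t) :
    ∃ b : ℝ, 0 ≤ b ∧ ∀ (N : ℕ) (h : ℝ), 2 ≤ N → 0 ≤ h → ((N : ℝ) + 1) * h ≤ Tstar →
      (∀ (n : Fin (N + 1)) i, M.node h n i ∈ Set.Icc 0 Tstar) →
      ∀ V : Fin (N + 1) → Fin s → EuclideanSpace ℝ (Fin m),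
      (∀ (n : Fin (N + 1)) i, V n i = M.adjointOp m N (M.onGrid h N p) n i -
        (if n = Fin.last N then M.w i • p (((N : ℝ) + 1) * h) else 0) +
          h • colSum (M.coefK N n) i • p' (M.node h n i)) →
      (∀ n i, ‖V n i‖ ≤ b * h ^ q) ∧
      ∀ n : Fin (N + 1), (n : ℕ) ≠ 0 → (n : ℕ) + 1 < N → ‖∑ i, V n i‖ ≤ b * h ^ (q + 1) := by
  obtain ⟨K, rfl⟩ : ∃ K, q = K + 1 := ⟨q - 1, by omega⟩
  have hpK : ContDiffOn ℝ (K + 1 : ℕ) p (Set.Icc 0 Tstar) :=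
    hp.of_le (by exact_mod_cast Nat.le_succ _)
  obtain ⟨b0, p0, hb0⟩ := exists_adjointStep_residual_bound (M := M) hT hpK hp'
    hord.oneLeg_start hord.start_adjoint
  obtain ⟨b1, p1, hb1⟩ := exists_adjointStep_residual_bound (M := M) hT hpK hp'
    (oneLeg_K hM _) hord.standard_adjoint
  obtain ⟨b2, p2, hb2⟩ := exists_adjointStep_residual_bound (M := M) hT hpK hp'
    (oneLeg_K hM _) hord.last_adjoint
  obtain ⟨b3, p3, hb3⟩ := exists_residual_bound hT hp hp' M.c
    (fun (_ : Unit) j => ∑ i, M.A j i) (fun _ j => -colSum M.K j)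
    (fun _ j => ∑ i, M.B j i) (fun _ j => M.c j + 1)
    (fun l hl _ => by
      rw [moment_adjoint_sum hM hord hsup hl]
      simp only [neg_mul, Finset.sum_neg_distrib]
      ring)
  obtain ⟨b4, p4, hb4⟩ := exists_residual_bound hT hpK hp' M.c
    (fun i j => M.AN j i) (fun i j => if j = i then -colSum M.KN i else 0)
    (fun i (_ : Unit) => M.w i) (fun _ _ => 1)
    (fun l hl i => by
      rw [moment_end_adjoint hord hl i, hord.oneLeg_end.moment (by omega : l - 1 < K + 1) i,
        sum_neg_colSum_mul]
      simp
      ring)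
  refine ⟨b0 + b1 + b2 + b3 + b4, by positivity, fun N h hN hh hNh hnode V hV => ?_⟩
  have hbase : ∀ n : ℕ, n ≤ N → (n : ℝ) * h ∈ Set.Icc 0 Tstar := fun n hn =>
    ⟨by positivity, le_trans (mul_le_mul_of_nonneg_right
      ((Nat.cast_le.2 hn).trans (by linarith)) hh) hNh⟩
  have hVcast : ∀ (n : Fin N) i, V n.castSucc i =
      kronApply (M.coefA N n)ᵀ (fun j => p (M.node h n j)) i -
        kronApply (M.coefB N (n + 1))ᵀ (fun j => p (M.node h ((n : ℕ) + 1 : ℕ) j)) i +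
        h • colSum (M.coefK N n) i • p' (M.node h n i) := by
    intro n i
    rw [hV, adjointOp_castSucc, if_neg (Fin.castSucc_lt_last n).ne, sub_zero]
    rfl
  constructor
  · intro n i
    refine Fin.lastCases ?_ (fun n => ?_) n
    · have e1 := hnode (Fin.last N)
      rw [Fin.val_last] at e1
      have h1 := hb4 ((N : ℝ) * h) h hh (hbase N le_rfl) e1 i
        (fun _ => ⟨by positivity, by linarith⟩)
      have h2 : V (Fin.last N) i = ∑ j, M.AN j i • p ((N : ℝ) * h + M.c j * h)
          - ∑ j : Unit, M.w i • p ((N : ℝ) * h + 1 * h)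
          - h • ∑ j, (if j = i then -colSum M.KN i else 0) • p' ((N : ℝ) * h + M.c j * h) := by
        rw [hV, adjointOp_last, if_pos rfl, ← add_mul]
        simp only [coefA, coefK, if_neg (show N ≠ 0 by omega), if_true, Fin.val_last,
          ite_smul, zero_smul, Finset.sum_ite_eq', Finset.mem_univ, neg_smul, smul_neg,
          sub_neg_eq_add, Finset.univ_unique, Finset.sum_singleton]
        rfl
      rw [h2]
      exact h1.trans (mul_le_mul_of_nonneg_right (by linarith) (pow_nonneg hh _))
    · rw [hVcast]
      have e1 := hnode n.castSucc
      have e2 := hnode n.succ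
      have hnN : (n : ℕ) ≠ N := n.2.ne
      by_cases hn0 : (n : ℕ) = 0
      · have hn1 : (n : ℕ) + 1 ≠ N := by omega
        simp only [coefA, coefB, coefK, if_pos hn0, if_neg hn1]
        exact (hb0 h n hh (hbase n n.2.le) e1 e2 i).trans
          (mul_le_mul_of_nonneg_right (by linarith) (pow_nonneg hh _))
      by_cases hn : (n : ℕ) + 1 = N
      · simp only [coefA, coefB, coefK, if_pos hn, if_neg hn0, if_neg hnN]
        exact (hb2 h n hh (hbase n n.2.le) e1 e2 i).trans
          (mul_le_mul_of_nonneg_right (by linarith) (pow_nonneg hh _))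
      · simp only [coefA, coefB, coefK, if_neg hn, if_neg hn0, if_neg hnN]
        exact (hb1 h n hh (hbase n n.2.le) e1 e2 i).trans
          (mul_le_mul_of_nonneg_right (by linarith) (pow_nonneg hh _))
  · intro n hn0 hnN
    obtain ⟨k, rfl⟩ : ∃ k : Fin N, n = k.castSucc := ⟨⟨n, by omega⟩, rfl⟩
    rw [Fin.val_castSucc] at hn0 hnN
    have e1 := hnode k.castSucc
    have e2 := hnode k.succ
    have h1 := hb3 _ h hh (hbase k k.2.le) e1 ()
      (fun j => by rw [← M.node_succ_eq_shift h k]; exact e2 j)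
    have h2 : ∑ i, V k.castSucc i = ∑ j, (∑ i, M.A j i) • p ((k : ℝ) * h + M.c j * h)
        - ∑ j, (∑ i, M.B j i) • p ((k : ℝ) * h + (M.c j + 1) * h)
        - h • ∑ j, (-colSum M.K j) • p' ((k : ℝ) * h + M.c j * h) := by
      simp only [hVcast, coefA, coefB, coefK, if_neg hn0, if_neg hnN.ne,
        if_neg (show (k : ℕ) ≠ N by omega), neg_smul, Finset.sum_neg_distrib, smul_neg,
        sub_neg_eq_add, Finset.sum_add_distrib,
        Finset.sum_sub_distrib, ← Finset.smul_sum, kronApply, Finset.sum_smul,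
        M.node_succ_eq_shift h k, Matrix.transpose_apply]
      rw [Finset.sum_comm (f := fun i j => M.A j i • _), Finset.sum_comm (f := fun i j => M.B j i • _)]
      rfl
    rw [h2]
    exact h1.trans (mul_le_mul_of_nonneg_right (by linarith) (pow_nonneg hh _))

/-- The averages of the exact adjoint that enter the control equation are accurate of order `q`. -/
theorem exists_average_consistency (hq : 1 ≤ q) (hM : M.Structural) (hord : M.OrderConditions q r)
    (hT : 0 < Tstar) (hp : ContDiffOn ℝ (q + 1 : ℕ) p (Set.Icc 0 Tstar))
    (hp' : ∀ t ∈ Set.Icc 0 Tstar, HasDerivWithinAt p (p' t) (Set.Icc 0 Tstar) t) :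
    ∃ b : ℝ, 0 ≤ b ∧ ∀ (N : ℕ) (h : ℝ), 0 ≤ h → (N : ℝ) * h ≤ Tstar →
      (∀ (n : Fin (N + 1)) i, M.node h n i ∈ Set.Icc 0 Tstar) →
      ∀ (n : Fin (N + 1)) i, M.Active N n i →
      ‖M.stageAverage N (M.onGrid h N p) n i - p (M.node h n i)‖ ≤ b * h ^ q := by
  obtain ⟨K, rfl⟩ : ∃ K, q = K + 1 := ⟨q - 1, by omega⟩
  have hpK : ContDiffOn ℝ (K + 1 : ℕ) p (Set.Icc 0 Tstar) :=
    hp.of_le (by exact_mod_cast Nat.le_succ _)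
  have aux : ∀ Q : Matrix (Fin s) (Fin s) ℝ, OneLeg M.c (K + 1) Q → ∃ b : ℝ, 0 ≤ b ∧
      ∀ x h : ℝ, 0 ≤ h → x ∈ Set.Icc 0 Tstar → (∀ j, x + M.c j * h ∈ Set.Icc 0 Tstar) →
      ∀ i, colSum Q i ≠ 0 → ‖(colSum Q i)⁻¹ • kronApply Qᵀ (fun j => p (x + M.c j * h)) i -
        p (x + M.c i * h)‖ ≤ b * h ^ (K + 1) := by
    intro Q hQ
    obtain ⟨b, hb0, hb⟩ := exists_residual_bound hT hpK hp' M.c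
      (fun i j => (colSum Q i)⁻¹ * Q j i) (fun _ _ => 0)
      (fun i (_ : Unit) => (colSum Q i)⁻¹ * colSum Q i) (fun i _ => M.c i)
      (fun l hl i => by
        simp only [mul_assoc, ← Finset.mul_sum, hQ.moment hl i]
        simp)
    refine ⟨b, hb0, fun x h hh hx hn i hi => ?_⟩
    have := hb x h hh hx hn i (fun _ => hn i)
    simpa [kronApply, Finset.smul_sum, smul_smul, inv_mul_cancel₀ hi] using this
  obtain ⟨b0, p0, hb0⟩ := aux _ hord.oneLeg_start
  obtain ⟨b1, p1, hb1⟩ := aux _ (oneLeg_K hM _)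
  obtain ⟨b2, p2, hb2⟩ := aux _ hord.oneLeg_end
  refine ⟨b0 + b1 + b2, by positivity, fun N h hh hNh hnode n i hi => ?_⟩
  have hx : (n : ℝ) * h ∈ Set.Icc 0 Tstar :=
    ⟨by positivity, le_trans (mul_le_mul_of_nonneg_right
      (by exact_mod_cast Nat.lt_succ_iff.1 n.2) hh) hNh⟩
  have hi' : colSum (M.coefK N n) i ≠ 0 := hi
  unfold stageAverage
  unfold coefK at hi' ⊢
  split_ifs at hi' ⊢
  · exact (hb0 _ h hh hx (hnode n) i hi').trans
      (mul_le_mul_of_nonneg_right (by linarith) (pow_nonneg hh _))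
  · exact (hb2 _ h hh hx (hnode n) i hi').trans
      (mul_le_mul_of_nonneg_right (by linarith) (pow_nonneg hh _))
  · exact (hb1 _ h hh hx (hnode n) i hi').trans
      (mul_le_mul_of_nonneg_right (by linarith) (pow_nonneg hh _))

/-- The end value `wᵀ Y_N` of the exact solution is accurate of order `q`. -/
theorem exists_end_consistency (hq : 1 ≤ q) (hqr : q ≤ r) (hord : M.OrderConditions q r)
    (hT : 0 < Tstar) (hp : ContDiffOn ℝ (q + 1 : ℕ) p (Set.Icc 0 Tstar))
    (hp' : ∀ t ∈ Set.Icc 0 Tstar, HasDerivWithinAt p (p' t) (Set.Icc 0 Tstar) t) :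
    ∃ b : ℝ, 0 ≤ b ∧ ∀ (N : ℕ) (h : ℝ), 0 ≤ h → ((N : ℝ) + 1) * h ≤ Tstar →
      (∀ i, M.node h N i ∈ Set.Icc 0 Tstar) →
      ‖∑ k, M.w k • M.onGrid h N p (Fin.last N) k - p (((N : ℝ) + 1) * h)‖ ≤ b * h ^ q := by
  obtain ⟨K, rfl⟩ : ∃ K, q = K + 1 := ⟨q - 1, by omega⟩
  obtain ⟨b, hb0, hb⟩ := exists_residual_bound (K := K) hT
    (hp.of_le (by exact_mod_cast Nat.le_succ _)) hp' M.c
    (fun (_ : Unit) j => M.w j) (fun _ _ => 0) (fun _ (_ : Unit) => 1) (fun _ _ => 1)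
    (fun l hl _ => by simpa using moment_end_forward hord (hl.trans_le hqr))
  refine ⟨b, hb0, fun N h hh hNh hnode => ?_⟩
  have h0 : 0 ≤ (N : ℝ) * h := by positivity
  have := hb ((N : ℝ) * h) h hh ⟨h0, by linarith⟩ hnode () (fun _ => ⟨by linarith, by linarith⟩)
  simp only [zero_smul, Finset.sum_const_zero, smul_zero, sub_zero, one_smul, Finset.univ_unique,
    Finset.sum_singleton] at this
  rw [add_mul]
  exact this

end PeerTriplet

/-! ### The fixed point map of the discrete system -/

/-- Weights for the components `y`, `p`, `u` in which the fixed point map contracts. They nearly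
solve the inequalities with equality, up to a small `η` which keeps them positive. -/
lemma exists_weights {A T Λ₁ Λ₂ Γ ω : ℝ} (hA : 0 < A) (hT : 0 < T) (h₁ : 0 ≤ Λ₁) (h₂ : 0 ≤ Λ₂)
    (hΓ : 0 ≤ Γ) (hω : 0 ≤ ω) (hP : (6 * A * Λ₁ + 1 * Λ₂ + 1 * Γ * Λ₁) * T ≤ 2 / 3)
    (hU : (1 * Λ₁ + (24 * A + 48 * A ^ 2) * Λ₂ + 192 * A ^ 3 * Γ * Λ₁) * Λ₁ * ω * T ≤ 1 / 3) :
    ∃ w₁ w₂ : ℝ, 0 < w₁ ∧ 0 < w₂ ∧ A * T * Λ₁ * (w₁ + 1) ≤ w₁ / 2 ∧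
      (A * T * Λ₂ + A * Γ) * w₁ + A * T * Λ₁ * w₂ + A * T * Λ₂ ≤ w₂ / 2 ∧
      1 / 8 + ω * (A * Λ₁ * w₂ + Λ₂ * w₁) ≤ 1 / 2 := by
  set a := A * T * Λ₁ with ha
  set b := A * T * Λ₂ with hb
  set g := A * Γ with hg
  have ha0 : 0 ≤ a := by positivity
  have hb0 : 0 ≤ b := by positivity
  have hg0 : 0 ≤ g := by positivity
  have ha8 : 8 * a ≤ 1 := by
    have h3 : 0 ≤ Λ₂ * T := by positivity
    have h4 : 0 ≤ Γ * Λ₁ * T := by positivity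
    have h5 : (6 * A * Λ₁ + 1 * Λ₂ + 1 * Γ * Λ₁) * T = 6 * a + Λ₂ * T + Γ * Λ₁ * T := by
      rw [ha]; ring
    linarith
  set k := ω * (A * Λ₁ * (8 * (b + g) + 1) + Λ₂) with hk
  have hk0 : 0 ≤ k := by positivity
  set η := 1 / (8 * (1 + k)) with hη
  have hη0 : 0 < η := by positivity
  have hηk : η * k ≤ 1 / 8 := by
    rw [hη, div_mul_eq_mul_div, one_mul, div_le_div_iff₀ (by positivity) (by norm_num)]
    linarith
  -- `8 a` and `8 (b + (b + g) w₁)` exceed the solutions of the first two equations, as `8 a ≤ 1`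
  refine ⟨8 * a + η, 8 * (b + (b + g) * (8 * a + η)) + η, by positivity, by positivity, ?_, ?_, ?_⟩
  · have : 8 * a * (8 * a + η) ≤ 1 * (8 * a + η) :=
      mul_le_mul_of_nonneg_right ha8 (by positivity)
    linarith
  · set w₁ := 8 * a + η with hw₁
    set w₂ := 8 * (b + (b + g) * w₁) + η with hw₂
    have hw₂0 : 0 ≤ w₂ := by positivity
    have h3 : 8 * a * w₂ ≤ 1 * w₂ := mul_le_mul_of_nonneg_right ha8 hw₂0
    linarith
  · -- expanded, the left-hand side consists of terms of the second assumption and of `η k`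
    have hX : 0 ≤ Λ₂ * Λ₁ * ω * T := by positivity
    have hΛ : 0 ≤ Λ₁ * Λ₁ * ω * T := by positivity
    have h3 : 8 * a * (A ^ 2 * (Λ₂ * Λ₁ * ω * T)) ≤ 1 * (A ^ 2 * (Λ₂ * Λ₁ * ω * T)) :=
      mul_le_mul_of_nonneg_right ha8 (by positivity)
    have h4 : ω * (A * Λ₁ * (8 * (b + (b + g) * (8 * a + η)) + η) + Λ₂ * (8 * a + η)) =
        8 * A ^ 2 * (Λ₂ * Λ₁ * ω * T) + 8 * (8 * a * (A ^ 2 * (Λ₂ * Λ₁ * ω * T)))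
        + 64 * A ^ 3 * (Γ * Λ₁ * Λ₁ * ω * T) + 8 * A * (Λ₂ * Λ₁ * ω * T) + η * k := by
      rw [hk, hb, hg, ha]; ring
    have h5 : (1 * Λ₁ + (24 * A + 48 * A ^ 2) * Λ₂ + 192 * A ^ 3 * Γ * Λ₁) * Λ₁ * ω * T =
        Λ₁ * Λ₁ * ω * T + 24 * A * (Λ₂ * Λ₁ * ω * T) + 48 * (A ^ 2 * (Λ₂ * Λ₁ * ω * T))
        + 192 * A ^ 3 * (Γ * Λ₁ * Λ₁ * ω * T) := by ring
    linarith

namespace PeerTriplet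

variable {s : ℕ} {M : PeerTriplet s} {m d : ℕ}
  {f : EuclideanSpace ℝ (Fin m) × EuclideanSpace ℝ (Fin d) → EuclideanSpace ℝ (Fin m)}
  {C : EuclideanSpace ℝ (Fin m) → ℝ}

open Classical in
/-- The control part of the fixed point map: a simplified Newton step with the matrices `R n i` in
the active stages, and a fixed value in the blind ones. -/
def controlMap (M : PeerTriplet s)
    (f : EuclideanSpace ℝ (Fin m) × EuclideanSpace ℝ (Fin d) → EuclideanSpace ℝ (Fin m)) (N : ℕ)
    (R : Fin (N + 1) → Fin s → EuclideanSpace ℝ (Fin d) →L[ℝ] EuclideanSpace ℝ (Fin d))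
    (Ub : Fin (N + 1) → Fin s → EuclideanSpace ℝ (Fin d))
    (Y P : Fin (N + 1) → Fin s → EuclideanSpace ℝ (Fin m))
    (U : Fin (N + 1) → Fin s → EuclideanSpace ℝ (Fin d)) :
    Fin (N + 1) → Fin s → EuclideanSpace ℝ (Fin d) := fun n i =>
  if M.Active N n i then U n i - R n i (adjU f (Y n i) (M.stageAverage N P n i) (U n i))
  else Ub n i

section Estimates

variable {Tstar : ℝ} {y p : ℝ → EuclideanSpace ℝ (Fin m)} {u : ℝ → EuclideanSpace ℝ (Fin d)}
  {ρ Λ₁ Λ₂ Λ₃ : ℝ} {h : ℝ} {N : ℕ}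
  {Y P Y' P' : Fin (N + 1) → Fin s → EuclideanSpace ℝ (Fin m)}
  {U U' : Fin (N + 1) → Fin s → EuclideanSpace ℝ (Fin d)}

lemma one_add_mul_le (N s : ℕ) : (1 + (N : ℝ) * s) ≤ (1 + s) * ((N : ℝ) + 1) := by
  have h1 : (0 : ℝ) ≤ N := Nat.cast_nonneg _
  have h2 : (0 : ℝ) ≤ s := Nat.cast_nonneg _
  linarith

lemma norm_sum_fin_le {F : Type*} [NormedAddCommGroup F] (v : Fin s → F) {b : ℝ}
    (hv : ∀ i, ‖v i‖ ≤ b) : ‖∑ i, v i‖ ≤ s * b := by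
  simpa using norm_sum_le_of_le Finset.univ (fun i _ => hv i)

/-- Lipschitz bound of the state part of the fixed point map. The number of steps is compensated by
`(N + 1) h = T`. -/
lemma norm_state_solution_sub_le (hM : M.Structural) (hpos : M.Positivity)
    (hb : SmoothnessBounds f Tstar y p u ρ Λ₁ Λ₂ Λ₃) (hρ : 0 < ρ) (hh : 0 ≤ h) {T κ A : ℝ}
    (hs : 0 < s) (hTh : ((N : ℝ) + 1) * h = T) (hκ : 0 ≤ κ)
    (hκA : κ * (1 + s) * M.boundK ≤ A)
    (hbd : ∀ (Y : Fin (N + 1) → Fin s → EuclideanSpace ℝ (Fin m)) (ρ σ : ℝ), 0 ≤ σ →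
      (∀ n, ‖M.stateOp m N Y n‖ ≤ ρ) →
      (∀ n : Fin (N + 1), (n : ℕ) ≠ 0 → (n : ℕ) ≠ N → ‖∑ i, M.stateOp m N Y n i‖ ≤ σ) →
      ‖Y‖ ≤ κ * (ρ + N * σ))
    (hnode : ∀ (n : Fin (N + 1)) i, M.node h n i ∈ Set.Icc 0 Tstar)
    {S : (Fin (N + 1) → Fin s → EuclideanSpace ℝ (Fin m)) →ₗ[ℝ]
      (Fin (N + 1) → Fin s → EuclideanSpace ℝ (Fin m))}
    (hS : ∀ x y, S y = x ↔ M.stateOp m N x = y)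
    (hX : InTube M y p u h N ρ Y P U) (hX' : InTube M y p u h N ρ Y' P' U')
    (y₀ : EuclideanSpace ℝ (Fin m)) :
    ‖S (M.stateRhs f y₀ h N Y U) - S (M.stateRhs f y₀ h N Y' U')‖
      ≤ A * T * Λ₁ * (‖Y - Y'‖ + ‖U - U'‖) := by
  have hΛ := (hb.nonneg hρ (hnode 0 ⟨0, hs⟩)).1
  have hK := M.boundK_nonneg
  set e := ‖Y - Y'‖ + ‖U - U'‖ with he
  have he0 : 0 ≤ e := by positivity
  set ρ₀ := h * (M.boundK * (Λ₁ * e)) with hρ₀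
  have hρ₀0 : 0 ≤ ρ₀ := by positivity
  rw [← map_sub]
  set v := S (M.stateRhs f y₀ h N Y U - M.stateRhs f y₀ h N Y' U') with hv
  have hLv : M.stateOp m N v = M.stateRhs f y₀ h N Y U - M.stateRhs f y₀ h N Y' U' :=
    (hS _ _).1 hv.symm
  have hstage : ∀ n i, ‖M.stateOp m N v n i‖ ≤ ρ₀ := fun n i => by
    rw [hLv]
    exact norm_stateRhs_sub_le hM hpos hb hρ hh hnode hX hX' y₀ n i
  have h1 := hbd v ρ₀ (s * ρ₀) (by positivity)
    (fun n => (pi_norm_le_iff_of_nonneg hρ₀0).2 (hstage n))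
    (fun n _ _ => norm_sum_fin_le _ (hstage n))
  refine h1.trans ?_
  calc κ * (ρ₀ + N * (s * ρ₀)) = κ * (1 + N * s) * ρ₀ := by ring
    _ ≤ κ * ((1 + s) * ((N : ℝ) + 1)) * ρ₀ :=
        mul_le_mul_of_nonneg_right (mul_le_mul_of_nonneg_left (one_add_mul_le N s) hκ) hρ₀0
    _ = (κ * (1 + s) * M.boundK) * (T * Λ₁ * e) := by rw [hρ₀, ← hTh]; ring
    _ ≤ A * (T * Λ₁ * e) := by
        refine mul_le_mul_of_nonneg_right hκA ?_
        rw [← hTh]; positivity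
    _ = _ := by ring

/-- Lipschitz bound of the adjoint part of the fixed point map. The end condition enters without the
factor `T`, with the Lipschitz constant `Γ` of the gradient of the objective. -/
lemma norm_adjoint_solution_sub_le (hM : M.Structural) (hpos : M.Positivity)
    (hb : SmoothnessBounds f Tstar y p u ρ Λ₁ Λ₂ Λ₃) (hρ : 0 < ρ) (hh : 0 ≤ h) {T κ A : ℝ}
    (hs : 0 < s) (hTh : ((N : ℝ) + 1) * h = T) (hκ : 0 ≤ κ)
    (hκA : κ * (1 + s) * M.boundK ≤ A) (hκA' : κ * (1 + s) * M.boundK * M.boundAverage ≤ A)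
    (hκw : κ * (∑ k, |M.w k|) ^ 2 ≤ A) (hC : IsQuadraticObjective C)
    (z : EuclideanSpace ℝ (Fin m))
    (hbd : ∀ (P : Fin (N + 1) → Fin s → EuclideanSpace ℝ (Fin m)) (ρ σ : ℝ), 0 ≤ σ →
      (∀ n, ‖M.adjointOp m N P n‖ ≤ ρ) →
      (∀ n : Fin (N + 1), (n : ℕ) ≠ 0 → (n : ℕ) + 1 < N → ‖∑ i, M.adjointOp m N P n i‖ ≤ σ) →
      ‖P‖ ≤ κ * (ρ + N * σ))
    (hnode : ∀ (n : Fin (N + 1)) i, M.node h n i ∈ Set.Icc 0 Tstar)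
    {S : (Fin (N + 1) → Fin s → EuclideanSpace ℝ (Fin m)) →ₗ[ℝ]
      (Fin (N + 1) → Fin s → EuclideanSpace ℝ (Fin m))}
    (hS : ∀ x y, S y = x ↔ M.adjointOp m N x = y)
    (hX : InTube M y p u h N ρ Y P U) (hX' : InTube M y p u h N ρ Y' P' U') :
    ‖S (M.adjointRhs f C h N Y P U) - S (M.adjointRhs f C h N Y' P' U')‖
      ≤ (A * T * Λ₂ + A * ‖fderiv ℝ (gradient C) z‖) * ‖Y - Y'‖ + A * T * Λ₁ * ‖P - P'‖
        + A * T * Λ₂ * ‖U - U'‖ := by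
  obtain ⟨hΛ₁, hΛ₂, -⟩ := hb.nonneg hρ (hnode 0 ⟨0, hs⟩)
  have hK := M.boundK_nonneg
  have hB := M.boundAverage_nonneg
  set Γ := ‖fderiv ℝ (gradient C) z‖ with hΓ
  have hΓ0 : 0 ≤ Γ := norm_nonneg _
  set e := ‖Y - Y'‖ + ‖U - U'‖ with he
  have he0 : 0 ≤ e := by positivity
  set ρ₁ := h * (M.boundK * (Λ₁ * (M.boundAverage * ‖P - P'‖) + Λ₂ * e)) with hρ₁
  have hρ₁0 : 0 ≤ ρ₁ := by positivity
  set ρ₀ := (∑ k, |M.w k|) ^ 2 * (Γ * ‖Y - Y'‖) with hρ₀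
  have hρ₀0 : 0 ≤ ρ₀ := by positivity
  rw [← map_sub]
  set v := S (M.adjointRhs f C h N Y P U - M.adjointRhs f C h N Y' P' U') with hv
  have hLv : M.adjointOp m N v = M.adjointRhs f C h N Y P U - M.adjointRhs f C h N Y' P' U' :=
    (hS _ _).1 hv.symm
  have hstep : ∀ n i, ‖h • adjY f (Y n i) (kronApply (M.coefK N n)ᵀ (P n) i) (U n i) -
      h • adjY f (Y' n i) (kronApply (M.coefK N n)ᵀ (P' n) i) (U' n i)‖ ≤ ρ₁ := fun n i => by
    rw [← smul_sub, norm_smul, Real.norm_of_nonneg hh]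
    exact mul_le_mul_of_nonneg_left (norm_stage_adjY_sub_le hM hpos hb hρ hnode hX hX' n i) hh
  have hstage : ∀ n i, n ≠ Fin.last N → ‖M.adjointOp m N v n i‖ ≤ ρ₁ := fun n i hn => by
    rw [hLv, Pi.sub_apply, Pi.sub_apply, adjointRhs, adjointRhs, if_neg hn, if_neg hn, zero_add,
      zero_add]
    exact hstep n i
  have hlast : ∀ i, ‖M.adjointOp m N v (Fin.last N) i‖ ≤ ρ₀ + ρ₁ := fun i => by
    rw [hLv, Pi.sub_apply, Pi.sub_apply, adjointRhs, adjointRhs, if_pos rfl, if_pos rfl,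
      add_sub_add_comm]
    exact (norm_add_le _ _).trans (add_le_add (norm_endTerm_sub_le hC z Y Y' i) (hstep _ i))
  have h1 := hbd v (ρ₀ + ρ₁) (s * ρ₁) (by positivity) (fun n => ?_) (fun n _ hn =>
    norm_sum_fin_le _ fun i => hstage n i fun hn' => by
      rw [hn', Fin.val_last] at hn; omega)
  · refine h1.trans ?_
    have h2 : κ * (ρ₀ + ρ₁ + N * (s * ρ₁)) ≤ κ * (∑ k, |M.w k|) ^ 2 * (Γ * ‖Y - Y'‖) +
        κ * ((1 + s) * ((N : ℝ) + 1)) * ρ₁ := by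
      have := mul_le_mul_of_nonneg_right (mul_le_mul_of_nonneg_left (one_add_mul_le N s) hκ) hρ₁0
      calc κ * (ρ₀ + ρ₁ + N * (s * ρ₁)) = κ * ρ₀ + κ * (1 + N * s) * ρ₁ := by ring
        _ ≤ κ * ρ₀ + κ * ((1 + s) * ((N : ℝ) + 1)) * ρ₁ := by linarith
        _ = _ := by rw [hρ₀]; ring
    have hT0 : 0 ≤ T := by rw [← hTh]; positivity
    have h3 : κ * ((1 + s) * ((N : ℝ) + 1)) * ρ₁ =
        (κ * (1 + s) * M.boundK * M.boundAverage) * (T * Λ₁ * ‖P - P'‖) +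
        (κ * (1 + s) * M.boundK) * (T * Λ₂ * e) := by rw [hρ₁, ← hTh]; ring
    have h4 := mul_le_mul_of_nonneg_right hκA' (by positivity : 0 ≤ T * Λ₁ * ‖P - P'‖)
    have h5 := mul_le_mul_of_nonneg_right hκA (by positivity : 0 ≤ T * Λ₂ * e)
    have h6 := mul_le_mul_of_nonneg_right hκw (by positivity : 0 ≤ Γ * ‖Y - Y'‖)
    have h7 : A * (T * Λ₂ * e) = A * T * Λ₂ * ‖Y - Y'‖ + A * T * Λ₂ * ‖U - U'‖ := by
      rw [he]; ring
    linarith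
  · refine (pi_norm_le_iff_of_nonneg (by positivity)).2 fun i => ?_
    by_cases hn : n = Fin.last N
    · rw [hn]; exact hlast i
    · exact (hstage n i hn).trans (by linarith)

/-- Lipschitz bound of the control part of the fixed point map: `1 / 8` in the control itself. -/
lemma norm_controlMap_sub_le (hb : SmoothnessBounds f Tstar y p u ρ Λ₁ Λ₂ Λ₃) (hρ : 0 < ρ)
    (hs : 0 < s) {ω δ A : ℝ} (hω : 0 ≤ ω) (hδρ : δ ≤ ρ) (hδ : ω * ((Λ₃ + Λ₂) * δ) ≤ 1 / 8)
    (hA : M.boundAverage ≤ A)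
    (hnode : ∀ (n : Fin (N + 1)) i, M.node h n i ∈ Set.Icc 0 Tstar)
    {R : Fin (N + 1) → Fin s → EuclideanSpace ℝ (Fin d) →L[ℝ] EuclideanSpace ℝ (Fin d)}
    (hR : ∀ n i, (R n i).comp (hessUU f (y (M.node h n i)) (p (M.node h n i)) (u (M.node h n i))) =
      ContinuousLinearMap.id ℝ _) (hRω : ∀ n i, ‖R n i‖ ≤ ω)
    (Ub : Fin (N + 1) → Fin s → EuclideanSpace ℝ (Fin d))
    (hX : InTube M y p u h N δ Y P U) (hX' : InTube M y p u h N δ Y' P' U') :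
    ‖M.controlMap f N R Ub Y P U - M.controlMap f N R Ub Y' P' U'‖
      ≤ 1 / 8 * ‖U - U'‖ + ω * (A * Λ₁ * ‖P - P'‖ + Λ₂ * ‖Y - Y'‖) := by
  obtain ⟨hΛ₁, hΛ₂, -⟩ := hb.nonneg hρ (hnode 0 ⟨0, hs⟩)
  have hA0 : 0 ≤ A := M.boundAverage_nonneg.trans hA
  have hrhs : 0 ≤ 1 / 8 * ‖U - U'‖ + ω * (A * Λ₁ * ‖P - P'‖ + Λ₂ * ‖Y - Y'‖) := by positivity
  refine (pi_norm_le_iff_of_nonneg hrhs).2 fun n => (pi_norm_le_iff_of_nonneg hrhs).2 fun i => ?_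
  simp only [Pi.sub_apply, controlMap]
  split_ifs with hi
  · refine (hb.norm_newton_sub_le hρ (hnode n i) hδρ (hR n i) (hRω n i) hδ (hX.state n i)
      (hX'.state n i) (hX.average n i hi) (hX.control n i hi) (hX'.control n i hi)).trans ?_
    have h1 : ‖U n i - U' n i‖ ≤ ‖U - U'‖ :=
      (norm_le_pi_norm ((U - U') n) i).trans (norm_le_pi_norm (U - U') n)
    have h2 : ‖Y n i - Y' n i‖ ≤ ‖Y - Y'‖ :=
      (norm_le_pi_norm ((Y - Y') n) i).trans (norm_le_pi_norm (Y - Y') n)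
    have h3 : ‖M.stageAverage N P n i - M.stageAverage N P' n i‖ ≤ A * ‖P - P'‖ :=
      (M.norm_stageAverage_sub_le P P' n i).trans (mul_le_mul_of_nonneg_right hA (norm_nonneg _))
    refine add_le_add (by linarith) (mul_le_mul_of_nonneg_left (add_le_add ?_ ?_) hω)
    · calc _ ≤ Λ₁ * (A * ‖P - P'‖) := mul_le_mul_of_nonneg_left h3 hΛ₁
        _ = _ := by ring
    · exact mul_le_mul_of_nonneg_left h2 hΛ₂
  · simpa using hrhs

end Estimates

/-- Zeros of the control equation are the fixed points of the control map. In a blind stage the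
control equation is void, because its multiplier vanishes. -/
lemma controlMap_eq_iff (hM : M.Structural) (hpos : M.Positivity) {N : ℕ}
    {R : Fin (N + 1) → Fin s → EuclideanSpace ℝ (Fin d) →L[ℝ] EuclideanSpace ℝ (Fin d)}
    (hR : ∀ n i, Function.Injective (R n i)) {Ub : Fin (N + 1) → Fin s → EuclideanSpace ℝ (Fin d)}
    {Y P : Fin (N + 1) → Fin s → EuclideanSpace ℝ (Fin m)}
    {U : Fin (N + 1) → Fin s → EuclideanSpace ℝ (Fin d)} :
    M.controlMap f N R Ub Y P U = U ↔
      (∀ n i, adjU f (Y n i) (kronApply (M.coefK N n)ᵀ (P n) i) (U n i) = 0) ∧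
      ∀ (n : Fin (N + 1)) i, ¬ M.Active N n i → Ub n i = U n i := by
  constructor
  · intro h
    refine ⟨fun n i => ?_, fun n i hi => ?_⟩
    · by_cases hi : M.Active N n i
      · have := congrFun (congrFun h n) i
        rw [controlMap, if_pos hi, sub_eq_self, map_eq_zero_iff _ (hR n i)] at this
        rw [kronApply_transpose_coefK hM hpos, adjU_smul, this, smul_zero]
      · rw [kronApply_transpose_coefK_eq_zero hM hpos hi]
        exact map_zero _
    · have := congrFun (congrFun h n) i
      rwa [controlMap, if_neg hi] at this
  · rintro ⟨h1, h2⟩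
    funext n i
    by_cases hi : M.Active N n i
    · have := h1 n i
      rw [kronApply_transpose_coefK hM hpos, adjU_smul, smul_eq_zero_iff_right hi] at this
      rw [controlMap, if_pos hi, this, map_zero, sub_zero]
    · rw [controlMap, if_neg hi, h2 n i hi]

/-- The averages of the adjoint stages stay in the tube because they are Lipschitz in the stages and
accurate on the exact solution. -/
lemma InTube.of_errorLE {y p : ℝ → EuclideanSpace ℝ (Fin m)} {u : ℝ → EuclideanSpace ℝ (Fin d)}
    {h : ℝ} {N : ℕ} {Y P : Fin (N + 1) → Fin s → EuclideanSpace ℝ (Fin m)}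
    {U : Fin (N + 1) → Fin s → EuclideanSpace ℝ (Fin d)} {δ δ₁ b : ℝ}
    (hE : ErrorLE M y p u h N Y P U δ) (hδ0 : 0 ≤ δ) (hδ : δ < δ₁)
    (hb : ∀ (n : Fin (N + 1)) i, M.Active N n i →
      ‖M.stageAverage N (M.onGrid h N p) n i - p (M.node h n i)‖ ≤ b)
    (hδb : M.boundAverage * δ + b < δ₁) : InTube M y p u h N δ₁ Y P U := by
  refine ⟨fun n i => ?_, fun n i hi => ?_, fun n i hi => ?_⟩
  · rw [Metric.mem_ball, dist_eq_norm]; exact (hE.state n i).trans_lt hδ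
  · rw [Metric.mem_ball, dist_eq_norm]
    have h1 : ‖P - M.onGrid h N p‖ ≤ δ :=
      (pi_norm_le_iff_of_nonneg hδ0).2 fun n => (pi_norm_le_iff_of_nonneg hδ0).2 fun i =>
        hE.adjoint n i
    refine lt_of_le_of_lt ?_ hδb
    refine (norm_sub_le_norm_sub_add_norm_sub _ (M.stageAverage N (M.onGrid h N p) n i) _).trans ?_
    exact add_le_add ((M.norm_stageAverage_sub_le _ _ n i).trans
      (mul_le_mul_of_nonneg_left h1 M.boundAverage_nonneg)) (hb n i hi)
  · rw [Metric.mem_ball, dist_eq_norm]; exact (hE.control n i hi).trans_lt hδ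

end PeerTriplet

/-! ### Residuals of the exact solution -/

namespace PeerTriplet

variable {s q r : ℕ} {M : PeerTriplet s} {m d : ℕ}
  {f : EuclideanSpace ℝ (Fin m) × EuclideanSpace ℝ (Fin d) → EuclideanSpace ℝ (Fin m)}
  {C : EuclideanSpace ℝ (Fin m) → ℝ} {y₀ : EuclideanSpace ℝ (Fin m)} {T Tstar : ℝ}
  {y p : ℝ → EuclideanSpace ℝ (Fin m)} {u : ℝ → EuclideanSpace ℝ (Fin d)}
  {ρ Λ₁ Λ₂ Λ₃ : ℝ}

lemma InTube.mono {h : ℝ} {N : ℕ} {Y P : Fin (N + 1) → Fin s → EuclideanSpace ℝ (Fin m)}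
    {U : Fin (N + 1) → Fin s → EuclideanSpace ℝ (Fin d)} {δ δ' : ℝ}
    (hX : InTube M y p u h N δ Y P U) (hδ : δ ≤ δ') : InTube M y p u h N δ' Y P U :=
  ⟨fun n i => Metric.ball_subset_ball hδ (hX.state n i),
    fun n i hi => Metric.ball_subset_ball hδ (hX.average n i hi),
    fun n i hi => Metric.ball_subset_ball hδ (hX.control n i hi)⟩

/-- On the grid of the exact state, the solution of the linear discrete state equation is accurate
of order `q`. -/
lemma exists_state_residual (hq : 1 ≤ q) (hqr : q ≤ r) (hord : M.OrderConditions q r)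
    (hsup : M.Superconvergence q r) (hT : 0 < T) (hTT : T < Tstar)
    (hkkt : IsContinuousKKT f C y₀ T Tstar y p u)
    (hy : ContDiffOn ℝ (q + 1 : ℕ) y (Set.Icc 0 Tstar)) {κ : ℝ} (hκ : 0 ≤ κ)
    (hbd : ∀ N : ℕ, 2 ≤ N → ∀ (Y : Fin (N + 1) → Fin s → EuclideanSpace ℝ (Fin m)) (ρ σ : ℝ),
      0 ≤ σ → (∀ n, ‖M.stateOp m N Y n‖ ≤ ρ) →
      (∀ n : Fin (N + 1), (n : ℕ) ≠ 0 → (n : ℕ) ≠ N → ‖∑ i, M.stateOp m N Y n i‖ ≤ σ) →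
      ‖Y‖ ≤ κ * (ρ + N * σ)) :
    ∃ b : ℝ, 0 ≤ b ∧ ∀ (N : ℕ) (h : ℝ), 2 ≤ N → 0 ≤ h → ((N : ℝ) + 1) * h = T →
      (∀ (n : Fin (N + 1)) i, M.node h n i ∈ Set.Icc 0 Tstar) →
      ∀ S : (Fin (N + 1) → Fin s → EuclideanSpace ℝ (Fin m)) →ₗ[ℝ]
        (Fin (N + 1) → Fin s → EuclideanSpace ℝ (Fin m)),
      (∀ x y, S y = x ↔ M.stateOp m N x = y) →
      ‖S (M.stateRhs f y₀ h N (M.onGrid h N y) (M.onGrid h N u)) - M.onGrid h N y‖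
        ≤ b * h ^ q := by
  obtain ⟨b, hb0, hb⟩ := exists_state_consistency (y' := fun t => f (y t, u t)) hq hqr hord hsup
    (hT.trans hTT) hy hkkt.state
  refine ⟨κ * (b + T * b), by positivity, fun N h hN hh hTh hnode S hS => ?_⟩
  have hNh : (N : ℝ) * h ≤ T := by rw [← hTh]; linarith
  set v := S (M.stateRhs f y₀ h N (M.onGrid h N y) (M.onGrid h N u)) - M.onGrid h N y with hv
  have hLv : M.stateOp m N v = M.stateRhs f y₀ h N (M.onGrid h N y) (M.onGrid h N u) -
      M.stateOp m N (M.onGrid h N y) := by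
    rw [hv, map_sub, (hS _ _).1 rfl]
  obtain ⟨h1, h2⟩ := hb N h hN hh (hNh.trans hTT.le) hnode (fun n i => -M.stateOp m N v n i)
    (fun n i => by rw [hLv, ← hkkt.init]; simp only [Pi.sub_apply, neg_sub]; rfl)
  simp only [norm_neg, Finset.sum_neg_distrib] at h1 h2
  have h3 := hbd N hN v (b * h ^ q) (b * h ^ (q + 1)) (by positivity)
    (fun n => (pi_norm_le_iff_of_nonneg (by positivity)).2 (h1 n)) h2
  refine h3.trans ?_
  rw [mul_assoc]
  refine mul_le_mul_of_nonneg_left ?_ hκ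
  have h4 := mul_le_mul_of_nonneg_right hNh (by positivity : 0 ≤ b * h ^ q)
  calc b * h ^ q + N * (b * h ^ (q + 1)) = b * h ^ q + N * h * (b * h ^ q) := by ring
    _ ≤ _ := by linarith

/-- The same for the adjoint equation. Besides the truncation errors there are the error of the end
value and, in the first and the last step, that of the averages. -/
lemma exists_adjoint_residual (hq : 1 ≤ q) (hqr : q ≤ r) (hM : M.Structural)
    (hord : M.OrderConditions q r) (hpos : M.Positivity)
    (hsup : M.Superconvergence q r) (hT : 0 < T) (hTT : T < Tstar) (hC : IsQuadraticObjective C)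
    (hkkt : IsContinuousKKT f C y₀ T Tstar y p u)
    (hy : ContDiffOn ℝ (q + 1 : ℕ) y (Set.Icc 0 Tstar))
    (hp : ContDiffOn ℝ (q + 1 : ℕ) p (Set.Icc 0 Tstar))
    (hρ : 0 < ρ) (hb : SmoothnessBounds f Tstar y p u ρ Λ₁ Λ₂ Λ₃) {κ : ℝ} (hκ : 0 ≤ κ)
    (hbd : ∀ N : ℕ, 2 ≤ N → ∀ (P : Fin (N + 1) → Fin s → EuclideanSpace ℝ (Fin m)) (ρ σ : ℝ),
      0 ≤ σ → (∀ n, ‖M.adjointOp m N P n‖ ≤ ρ) →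
      (∀ n : Fin (N + 1), (n : ℕ) ≠ 0 → (n : ℕ) + 1 < N → ‖∑ i, M.adjointOp m N P n i‖ ≤ σ) →
      ‖P‖ ≤ κ * (ρ + N * σ)) :
    ∃ b : ℝ, 0 ≤ b ∧ ∀ (N : ℕ) (h : ℝ), 2 ≤ N → 0 ≤ h → h ≤ 1 → ((N : ℝ) + 1) * h = T →
      (∀ (n : Fin (N + 1)) i, M.node h n i ∈ Set.Icc 0 Tstar) →
      ∀ S : (Fin (N + 1) → Fin s → EuclideanSpace ℝ (Fin m)) →ₗ[ℝ]
        (Fin (N + 1) → Fin s → EuclideanSpace ℝ (Fin m)),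
      (∀ x y, S y = x ↔ M.adjointOp m N x = y) →
      ‖S (M.adjointRhs f C h N (M.onGrid h N y) (M.onGrid h N p) (M.onGrid h N u)) -
        M.onGrid h N p‖ ≤ b * h ^ q := by
  have hT0 : 0 < Tstar := hT.trans hTT
  obtain ⟨b, hb0, hbV⟩ := exists_adjoint_consistency hq hM hord hsup hT0 hp hkkt.adjoint
  obtain ⟨ba, hba0, hba⟩ := exists_average_consistency hq hM hord hT0 hp hkkt.adjoint
  obtain ⟨be, hbe0, hbe⟩ := exists_end_consistency hq hqr hord hT0 hy hkkt.state
  have hΛ₁ := (hb.nonneg hρ (Set.left_mem_Icc.2 hT0.le)).1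
  have hK := M.boundK_nonneg
  set W := ∑ k, |M.w k| with hW
  have hW0 : 0 ≤ W := Finset.sum_nonneg fun _ _ => abs_nonneg _
  set Γ := ‖fderiv ℝ (gradient C) (y T)‖ with hΓ
  have hΓ0 : 0 ≤ Γ := norm_nonneg _
  set g := M.boundK * (Λ₁ * ba) with hg
  have hg0 : 0 ≤ g := by positivity
  refine ⟨κ * (b + W * (Γ * be) + g + T * (b + s * g)), by positivity,
    fun N h hN hh hh1 hTh hnode S hS => ?_⟩
  have hNh : (N : ℝ) * h ≤ T := by rw [← hTh]; linarith
  have hhq : 0 ≤ h ^ q := pow_nonneg hh q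
  set Ys := M.onGrid h N y with hYs
  set Ps := M.onGrid h N p with hPs
  set Us := M.onGrid h N u with hUs
  set v := S (M.adjointRhs f C h N Ys Ps Us) - Ps with hv
  have hLv : M.adjointOp m N v = M.adjointRhs f C h N Ys Ps Us - M.adjointOp m N Ps := by
    rw [hv, map_sub, (hS _ _).1 rfl]
  -- the truncation error `V` and the errors `D`, `E` of the averages and of the end value
  set V : Fin (N + 1) → Fin s → EuclideanSpace ℝ (Fin m) := fun n i =>
    M.adjointOp m N Ps n i - (if n = Fin.last N then M.w i • p (((N : ℝ) + 1) * h) else 0) +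
      h • colSum (M.coefK N n) i •
        -adjY f (y (M.node h n i)) (p (M.node h n i)) (u (M.node h n i)) with hV
  obtain ⟨hV1, hV2⟩ := hbV N h hN hh (by rw [hTh]; exact hTT.le) hnode V (fun n i => rfl)
  set D : Fin (N + 1) → Fin s → EuclideanSpace ℝ (Fin m) := fun n i =>
    h • colSum (M.coefK N n) i •
      (adjY f (y (M.node h n i)) (M.stageAverage N Ps n i) (u (M.node h n i)) -
        adjY f (y (M.node h n i)) (p (M.node h n i)) (u (M.node h n i))) with hD
  set E : Fin s → EuclideanSpace ℝ (Fin m) := fun i =>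
    M.w i • (gradient C (∑ k, M.w k • Ys (Fin.last N) k) - gradient C (y T)) with hE
  have hsplit : ∀ n i, M.adjointOp m N v n i =
      -V n i + D n i + if n = Fin.last N then E i else 0 := by
    intro n i
    rw [hLv]
    simp only [Pi.sub_apply, hV, hD, hE, adjointRhs, kronApply_transpose_coefK hM hpos, adjY_smul,
      hTh, hkkt.final, smul_sub, smul_neg]
    have e1 : Ys n i = y (M.node h n i) := rfl
    have e2 : Us n i = u (M.node h n i) := rfl
    rw [e1, e2]
    split_ifs <;> abel
  have hDb : ∀ n i, ‖D n i‖ ≤ g * h ^ q * h := by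
    intro n i
    simp only [hD]
    by_cases hi : M.Active N n i
    · have hx : (y (M.node h n i), u (M.node h n i)) ∈
          Metric.ball (y (M.node h n i), u (M.node h n i)) ρ := Metric.mem_ball_self hρ
      have h1 := hb.norm_adjY_sub_le hρ (hnode n i) hx hx
        (Metric.mem_ball_self hρ : p (M.node h n i) ∈ _) (M.stageAverage N Ps n i)
      rw [sub_self, norm_zero, mul_zero, add_zero, norm_sub_rev, norm_sub_rev (p _)] at h1
      have h2 := hba N h hh (hNh.trans hTT.le) hnode n i hi
      rw [norm_smul, norm_smul, Real.norm_of_nonneg hh, Real.norm_eq_abs]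
      have h3 := h1.trans (mul_le_mul_of_nonneg_left h2 hΛ₁)
      have h4 := mul_le_mul (M.abs_colSum_coefK_le N n i) h3 (norm_nonneg _) hK
      refine (mul_le_mul_of_nonneg_left h4 hh).trans (le_of_eq ?_)
      rw [hg]; ring
    · rw [show colSum (M.coefK N n) i = 0 from not_not.1 hi, zero_smul, smul_zero, norm_zero]
      positivity
  have hEb : ∀ i, ‖E i‖ ≤ W * (Γ * be) * h ^ q := by
    intro i
    have h1 : |M.w i| ≤ W :=
      Finset.single_le_sum (f := fun k => |M.w k|) (fun _ _ => abs_nonneg _) (Finset.mem_univ i)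
    have h2 := hbe N h hh (by rw [hTh]; exact hTT.le) (fun i => by simpa using hnode (Fin.last N) i)
    rw [hTh] at h2
    have h3 := (hC.norm_gradient_sub_le (y T) (∑ k, M.w k • Ys (Fin.last N) k) (y T)).trans
      (mul_le_mul_of_nonneg_left h2 hΓ0)
    simp only [hE]
    rw [norm_smul, Real.norm_eq_abs]
    refine (mul_le_mul h1 h3 (norm_nonneg _) hW0).trans (le_of_eq ?_)
    ring
  have h1 : ∀ n i, ‖M.adjointOp m N v n i‖ ≤ (b + W * (Γ * be) + g) * h ^ q := by
    intro n i
    rw [hsplit]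
    have e1 : ‖(if n = Fin.last N then E i else 0)‖ ≤ W * (Γ * be) * h ^ q := by
      split_ifs
      · exact hEb i
      · rw [norm_zero]; positivity
    have e2 : g * h ^ q * h ≤ g * h ^ q := mul_le_of_le_one_right (by positivity) hh1
    refine (norm_add₃_le).trans ?_
    rw [norm_neg]
    have := hV1 n i
    have := hDb n i
    linarith
  have h2 : ∀ n : Fin (N + 1), (n : ℕ) ≠ 0 → (n : ℕ) + 1 < N →
      ‖∑ i, M.adjointOp m N v n i‖ ≤ (b + s * g) * h ^ q * h := by
    intro n hn0 hnN
    have hne : n ≠ Fin.last N := fun hn => by rw [hn, Fin.val_last] at hnN; omega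
    simp only [hsplit, if_neg hne, add_zero, Finset.sum_add_distrib, Finset.sum_neg_distrib]
    refine (norm_add_le _ _).trans ?_
    rw [norm_neg]
    have e1 := hV2 n hn0 hnN
    have e2 := norm_sum_fin_le (D n) (hDb n)
    calc _ ≤ b * h ^ (q + 1) + s * (g * h ^ q * h) := add_le_add e1 e2
      _ = _ := by ring
  have h3 := hbd N hN v _ _ (by positivity)
    (fun n => (pi_norm_le_iff_of_nonneg (by positivity)).2 (h1 n)) h2
  refine h3.trans ?_
  rw [mul_assoc κ (b + W * (Γ * be) + g + T * (b + s * g))]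
  refine mul_le_mul_of_nonneg_left ?_ hκ
  have h4 := mul_le_mul_of_nonneg_right hNh (by positivity : 0 ≤ (b + s * g) * h ^ q)
  calc _ = (b + W * (Γ * be) + g) * h ^ q + N * h * ((b + s * g) * h ^ q) := by ring
    _ ≤ (b + W * (Γ * be) + g) * h ^ q + T * ((b + s * g) * h ^ q) := by linarith
    _ = _ := by ring

/-- The residual of the exact solution in the control map stems from the averages alone. -/
lemma norm_control_residual_le (hT : 0 < Tstar)
    (hkkt : IsContinuousKKT f C y₀ T Tstar y p u) (hρ : 0 < ρ)
    (hb : SmoothnessBounds f Tstar y p u ρ Λ₁ Λ₂ Λ₃) {h ω b : ℝ} {N : ℕ} (hω : 0 ≤ ω) (hb0 : 0 ≤ b)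
    (hnode : ∀ (n : Fin (N + 1)) i, M.node h n i ∈ Set.Icc 0 Tstar)
    (hba : ∀ (n : Fin (N + 1)) i, M.Active N n i →
      ‖M.stageAverage N (M.onGrid h N p) n i - p (M.node h n i)‖ ≤ b)
    {R : Fin (N + 1) → Fin s → EuclideanSpace ℝ (Fin d) →L[ℝ] EuclideanSpace ℝ (Fin d)}
    (hRω : ∀ n i, ‖R n i‖ ≤ ω) :
    ‖M.controlMap f N R (M.onGrid h N u) (M.onGrid h N y) (M.onGrid h N p) (M.onGrid h N u)
      - M.onGrid h N u‖ ≤ ω * (Λ₁ * b) := by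
  have hΛ₁ := (hb.nonneg hρ (Set.left_mem_Icc.2 hT.le)).1
  have hrhs : 0 ≤ ω * (Λ₁ * b) := by positivity
  refine (pi_norm_le_iff_of_nonneg hrhs).2 fun n => (pi_norm_le_iff_of_nonneg hrhs).2 fun i => ?_
  simp only [Pi.sub_apply, controlMap]
  split_ifs with hi
  · rw [sub_sub_cancel_left, norm_neg]
    refine ((R n i).le_opNorm _).trans (mul_le_mul (hRω n i) ?_ (norm_nonneg _) hω)
    have hx : (y (M.node h n i), u (M.node h n i)) ∈
        Metric.ball (y (M.node h n i), u (M.node h n i)) ρ := Metric.mem_ball_self hρ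
    have h1 := hb.norm_adjU_sub_le hρ (hnode n i) hx hx
      (Metric.mem_ball_self hρ : p (M.node h n i) ∈ _) (M.stageAverage N (M.onGrid h N p) n i)
    rw [hkkt.control _ (hnode n i), sub_self, norm_zero, mul_zero, add_zero, zero_sub, norm_neg,
      norm_sub_rev] at h1
    exact h1.trans (mul_le_mul_of_nonneg_left (hba n i hi) hΛ₁)
  · rwa [sub_self, norm_zero]

end PeerTriplet

/-! ### Solvability on a single grid -/

namespace PeerTriplet

variable {s : ℕ} {M : PeerTriplet s} {m d : ℕ}
  {f : EuclideanSpace ℝ (Fin m) × EuclideanSpace ℝ (Fin d) → EuclideanSpace ℝ (Fin m)}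
  {C : EuclideanSpace ℝ (Fin m) → ℝ} {y₀ : EuclideanSpace ℝ (Fin m)}
  {y p : ℝ → EuclideanSpace ℝ (Fin m)} {u : ℝ → EuclideanSpace ℝ (Fin d)}

/-- Functions on the stages of all steps, with the maximum norm. -/
abbrev GridFun (N s m : ℕ) : Type := Fin (N + 1) → Fin s → EuclideanSpace ℝ (Fin m)

/-- The fixed point form of the discrete optimality system: the linear state and adjoint equations
are solved by `S` and `S'`, the control equation is treated by `controlMap`. -/
def fixedPointMap (M : PeerTriplet s)
    (f : EuclideanSpace ℝ (Fin m) × EuclideanSpace ℝ (Fin d) → EuclideanSpace ℝ (Fin m))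
    (C : EuclideanSpace ℝ (Fin m) → ℝ) (y₀ : EuclideanSpace ℝ (Fin m)) (h : ℝ) (N : ℕ)
    (S S' : GridFun N s m →ₗ[ℝ] GridFun N s m)
    (R : Fin (N + 1) → Fin s → EuclideanSpace ℝ (Fin d) →L[ℝ] EuclideanSpace ℝ (Fin d))
    (Ub : GridFun N s d) (x : GridFun N s m × GridFun N s m × GridFun N s d) :
    GridFun N s m × GridFun N s m × GridFun N s d :=
  (S (M.stateRhs f y₀ h N x.1 x.2.2), S' (M.adjointRhs f C h N x.1 x.2.1 x.2.2),
    M.controlMap f N R Ub x.1 x.2.1 x.2.2)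

variable {h : ℝ} {N : ℕ} {S S' : GridFun N s m →ₗ[ℝ] GridFun N s m}
  {R : Fin (N + 1) → Fin s → EuclideanSpace ℝ (Fin d) →L[ℝ] EuclideanSpace ℝ (Fin d)}

lemma fixedPointMap_eq_iff (hM : M.Structural) (hpos : M.Positivity)
    (hS : ∀ x y, S y = x ↔ M.stateOp m N x = y) (hS' : ∀ x y, S' y = x ↔ M.adjointOp m N x = y)
    (hR : ∀ n i, Function.Injective (R n i)) {Ub : GridFun N s d}
    {x : GridFun N s m × GridFun N s m × GridFun N s d} :
    M.fixedPointMap f C y₀ h N S S' R Ub x = x ↔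
      IsDiscreteKKT f C M y₀ h N x.1 x.2.1 x.2.2 ∧
      ∀ (n : Fin (N + 1)) i, ¬ M.Active N n i → Ub n i = x.2.2 n i := by
  rw [Prod.ext_iff, Prod.ext_iff, isDiscreteKKT_iff, fixedPointMap, hS, hS',
    controlMap_eq_iff hM hpos hR]
  tauto

/-- The controls of blind stages do not enter the discrete optimality system. -/
lemma _root_.IsDiscreteKKT.congr_control (hM : M.Structural) (hpos : M.Positivity)
    {Y P : GridFun N s m} {U U' : GridFun N s d} (hX : IsDiscreteKKT f C M y₀ h N Y P U)
    (hU : ∀ (n : Fin (N + 1)) i, M.Active N n i → U n i = U' n i) :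
    IsDiscreteKKT f C M y₀ h N Y P U' := by
  rw [isDiscreteKKT_iff] at hX ⊢
  obtain ⟨h1, h2, h3⟩ := hX
  have hz : ∀ (n : Fin (N + 1)) i, ¬ M.Active N n i → kronApply (M.coefK N n)ᵀ (P n) i = 0 :=
    fun n i hi => kronApply_transpose_coefK_eq_zero hM hpos hi _
  refine ⟨h1.trans ?_, h2.trans ?_, fun n i => ?_⟩
  · funext n i
    simp only [stateRhs, kronApply]
    congr 2
    refine Finset.sum_congr rfl fun j _ => ?_
    by_cases hj : M.Active N n j
    · rw [hU n j hj]
    · rw [coefK_eq_zero_of_not_active hM hpos hj, zero_smul, zero_smul]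
  · funext n i
    simp only [adjointRhs]
    by_cases hi : M.Active N n i
    · rw [hU n i hi]
    · rw [hz n i hi, adjY, adjY, map_zero, map_zero]
  · by_cases hi : M.Active N n i
    · rw [← hU n i hi]; exact h3 n i
    · rw [hz n i hi, adjU, map_zero]

lemma errorLE_of_weightedLE {w₁ w₂ t : ℝ} (h₁ : 0 ≤ w₁) (h₂ : 0 ≤ w₂) (ht : 0 ≤ t)
    {x : GridFun N s m × GridFun N s m × GridFun N s d}
    (hx : WeightedLE w₁ w₂ 1 x (M.onGrid h N y, M.onGrid h N p, M.onGrid h N u) t) :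
    ErrorLE M y p u h N x.1 x.2.1 x.2.2 ((w₁ + w₂ + 1) * t) := by
  obtain ⟨hx1, hx2, hx3⟩ := hx
  have ht1 : 0 ≤ w₁ * t := by positivity
  have ht2 : 0 ≤ w₂ * t := by positivity
  refine ⟨fun n i => ?_, fun n i => ?_, fun n i _ => ?_⟩
  · have := (norm_le_pi_norm ((x.1 - M.onGrid h N y) n) i).trans
      (norm_le_pi_norm (x.1 - M.onGrid h N y) n)
    exact (this.trans hx1).trans (by linarith)
  · have := (norm_le_pi_norm ((x.2.1 - M.onGrid h N p) n) i).trans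
      (norm_le_pi_norm (x.2.1 - M.onGrid h N p) n)
    exact (this.trans hx2).trans (by linarith)
  · have := (norm_le_pi_norm ((x.2.2 - M.onGrid h N u) n) i).trans
      (norm_le_pi_norm (x.2.2 - M.onGrid h N u) n)
    exact (this.trans hx3).trans (by linarith)

lemma _root_.ErrorLE.mono {Y P : GridFun N s m} {U : GridFun N s d} {δ δ' : ℝ}
    (hE : ErrorLE M y p u h N Y P U δ) (hδ : δ ≤ δ') : ErrorLE M y p u h N Y P U δ' :=
  ⟨fun n i => (hE.state n i).trans hδ, fun n i => (hE.adjoint n i).trans hδ,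
    fun n i hi => (hE.control n i hi).trans hδ⟩

lemma _root_.ErrorLE.congr_control {Y P : GridFun N s m} {U U' : GridFun N s d} {δ : ℝ}
    (hE : ErrorLE M y p u h N Y P U δ)
    (hU : ∀ (n : Fin (N + 1)) i, M.Active N n i → U n i = U' n i) :
    ErrorLE M y p u h N Y P U' δ :=
  ⟨hE.state, hE.adjoint, fun n i hi => by rw [← hU n i hi]; exact hE.control n i hi⟩

open Classical in
/-- If the fixed point map contracts by the factor `1 / 2` in a tube and the exact solution has a
small residual `τ`, then there is exactly one discrete solution near the exact one, and its error
is of the size of `τ`. -/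
lemma existsUnique_discreteKKT_of_contraction (hM : M.Structural) (hpos : M.Positivity)
    (hS : ∀ x y, S y = x ↔ M.stateOp m N x = y) (hS' : ∀ x y, S' y = x ↔ M.adjointOp m N x = y)
    (hR : ∀ n i, Function.Injective (R n i)) {w₁ w₂ t₀ τ δ δ₁ : ℝ} (h₁ : 0 < w₁) (h₂ : 0 < w₂)
    (ht₀ : 0 ≤ t₀) (hτ0 : 0 ≤ τ) (hτ : τ ≤ t₀ / 2) (hδ0 : 0 ≤ δ) (hwδ : (w₁ + w₂ + 1) * t₀ ≤ δ)
    (htube : ∀ Y P U, ErrorLE M y p u h N Y P U δ → InTube M y p u h N δ₁ Y P U)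
    (hΦ : ∀ x x' : GridFun N s m × GridFun N s m × GridFun N s d,
      InTube M y p u h N δ₁ x.1 x.2.1 x.2.2 → InTube M y p u h N δ₁ x'.1 x'.2.1 x'.2.2 →
      ∀ t, WeightedLE w₁ w₂ 1 x x' t →
        WeightedLE w₁ w₂ 1 (M.fixedPointMap f C y₀ h N S S' R (M.onGrid h N u) x)
          (M.fixedPointMap f C y₀ h N S S' R (M.onGrid h N u) x') (t / 2))
    (hz : WeightedLE w₁ w₂ 1 (M.fixedPointMap f C y₀ h N S S' R (M.onGrid h N u)
      (M.onGrid h N y, M.onGrid h N p, M.onGrid h N u))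
      (M.onGrid h N y, M.onGrid h N p, M.onGrid h N u) τ) :
    (∃ Y P U, IsDiscreteKKT f C M y₀ h N Y P U ∧ ErrorLE M y p u h N Y P U δ) ∧
    (∀ Y P U Y' P' U',
      IsDiscreteKKT f C M y₀ h N Y P U → ErrorLE M y p u h N Y P U δ →
      IsDiscreteKKT f C M y₀ h N Y' P' U' → ErrorLE M y p u h N Y' P' U' δ →
      Y = Y' ∧ P = P' ∧ ∀ (n : Fin (N + 1)) (i : Fin s), M.Active N n i → U n i = U' n i) ∧
    (∀ Y P U,
      IsDiscreteKKT f C M y₀ h N Y P U → ErrorLE M y p u h N Y P U δ →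
      ErrorLE M y p u h N Y P U ((w₁ + w₂ + 1) * (2 * τ))) := by
  set Φ := M.fixedPointMap f C y₀ h N S S' R (M.onGrid h N u) with hΦdef
  set z : GridFun N s m × GridFun N s m × GridFun N s d :=
    (M.onGrid h N y, M.onGrid h N p, M.onGrid h N u) with hzdef
  have hfix : ∀ x, Φ x = x ↔ IsDiscreteKKT f C M y₀ h N x.1 x.2.1 x.2.2 ∧
      ∀ (n : Fin (N + 1)) i, ¬ M.Active N n i → M.onGrid h N u n i = x.2.2 n i :=
    fun x => fixedPointMap_eq_iff hM hpos hS hS' hR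
  have hbox : ∀ x, WeightedLE w₁ w₂ 1 x z t₀ → ErrorLE M y p u h N x.1 x.2.1 x.2.2 δ :=
    fun x hx => (errorLE_of_weightedLE h₁.le h₂.le ht₀ hx).mono hwδ
  have hztube : InTube M y p u h N δ₁ z.1 z.2.1 z.2.2 := by
    refine htube _ _ _ ⟨fun n i => ?_, fun n i => ?_, fun n i _ => ?_⟩ <;>
    · simp only [hzdef, onGrid, sub_self, norm_zero]; exact hδ0
  -- a solution with the controls of blind stages replaced by exact ones is a fixed point
  have hfill : ∀ Y P U, IsDiscreteKKT f C M y₀ h N Y P U → ErrorLE M y p u h N Y P U δ →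
      ∃ U', (∀ (n : Fin (N + 1)) i, M.Active N n i → U n i = U' n i) ∧
        Φ (Y, P, U') = (Y, P, U') ∧ InTube M y p u h N δ₁ Y P U' := by
    intro Y P U hX hE
    have hU : ∀ (n : Fin (N + 1)) i, M.Active N n i →
        U n i = if M.Active N n i then U n i else M.onGrid h N u n i :=
      fun n i hi => (if_pos hi).symm
    refine ⟨fun n i => if M.Active N n i then U n i else M.onGrid h N u n i, hU,
      (hfix _).2 ⟨hX.congr_control hM hpos hU, fun n i hi => (if_neg hi).symm⟩,
      htube _ _ _ (hE.congr_control hU)⟩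
  refine ⟨?_, ?_, ?_⟩
  · obtain ⟨x, hx, hxz⟩ := exists_isFixedPt_of_weighted (Φ := Φ) (z := z) h₁ h₂ one_pos ht₀
      (fun x x' hx hx' t _ hxx => hΦ x x' (htube _ _ _ (hbox x hx)) (htube _ _ _ (hbox x' hx')) t hxx)
      ⟨hz.1.trans (mul_le_mul_of_nonneg_left hτ h₁.le),
        hz.2.1.trans (mul_le_mul_of_nonneg_left hτ h₂.le),
        hz.2.2.trans (mul_le_mul_of_nonneg_left hτ zero_le_one)⟩
    exact ⟨x.1, x.2.1, x.2.2, ((hfix x).1 hx).1, hbox x hxz⟩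
  · intro Y P U Y' P' U' hX hE hX' hE'
    obtain ⟨V, hV, hfV, htV⟩ := hfill Y P U hX hE
    obtain ⟨V', hV', hfV', htV'⟩ := hfill Y' P' U' hX' hE'
    have h0 : WeightedLE w₁ w₂ 1 (Φ (Y', P', V')) (Y', P', V') 0 := by
      rw [hfV']
      simp [WeightedLE]
    obtain ⟨e1, e2, e3⟩ := weightedLE_of_isFixedPt h₁ h₂ one_pos
      (fun t _ ht => hΦ (Y, P, V) (Y', P', V') htV htV' t ht) hfV h0
    simp only [mul_zero, norm_le_zero_iff, sub_eq_zero] at e1 e2 e3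
    exact ⟨e1, e2, fun n i hi => by rw [hV n i hi, hV' n i hi, e3]⟩
  · intro Y P U hX hE
    obtain ⟨V, hV, hfV, htV⟩ := hfill Y P U hX hE
    have hW := weightedLE_of_isFixedPt h₁ h₂ one_pos
      (fun t _ ht => hΦ (Y, P, V) z htV hztube t ht) hfV hz
    exact (errorLE_of_weightedLE h₁.le h₂.le (by positivity) hW).congr_control
      fun n i hi => (hV n i hi).symm

/-- With suitable weights the fixed point map contracts by the factor `1 / 2`. -/
lemma weightedLE_fixedPointMap (hM : M.Structural) (hpos : M.Positivity) {Tstar T A ω δ κ κ' : ℝ}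
    {ρ Λ₁ Λ₂ Λ₃ : ℝ} (hb : SmoothnessBounds f Tstar y p u ρ Λ₁ Λ₂ Λ₃) (hρ : 0 < ρ) (hh : 0 ≤ h)
    (hs : 0 < s) (hTh : ((N : ℝ) + 1) * h = T) (hκ : 0 ≤ κ) (hκ' : 0 ≤ κ') (hω : 0 ≤ ω)
    (hκA : κ * (1 + s) * M.boundK ≤ A) (hκA' : κ' * (1 + s) * M.boundK ≤ A)
    (hκB : κ' * (1 + s) * M.boundK * M.boundAverage ≤ A)
    (hκw : κ' * (∑ k, |M.w k|) ^ 2 ≤ A) (hBA : M.boundAverage ≤ A) (hC : IsQuadraticObjective C)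
    (z : EuclideanSpace ℝ (Fin m))
    (hbd : ∀ (Y : GridFun N s m) (ρ σ : ℝ), 0 ≤ σ → (∀ n, ‖M.stateOp m N Y n‖ ≤ ρ) →
      (∀ n : Fin (N + 1), (n : ℕ) ≠ 0 → (n : ℕ) ≠ N → ‖∑ i, M.stateOp m N Y n i‖ ≤ σ) →
      ‖Y‖ ≤ κ * (ρ + N * σ))
    (hbd' : ∀ (P : GridFun N s m) (ρ σ : ℝ), 0 ≤ σ → (∀ n, ‖M.adjointOp m N P n‖ ≤ ρ) →
      (∀ n : Fin (N + 1), (n : ℕ) ≠ 0 → (n : ℕ) + 1 < N → ‖∑ i, M.adjointOp m N P n i‖ ≤ σ) →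
      ‖P‖ ≤ κ' * (ρ + N * σ))
    (hnode : ∀ (n : Fin (N + 1)) i, M.node h n i ∈ Set.Icc 0 Tstar)
    (hS : ∀ x y, S y = x ↔ M.stateOp m N x = y) (hS' : ∀ x y, S' y = x ↔ M.adjointOp m N x = y)
    (hR : ∀ n i, (R n i).comp (hessUU f (y (M.node h n i)) (p (M.node h n i)) (u (M.node h n i))) =
      ContinuousLinearMap.id ℝ _) (hRω : ∀ n i, ‖R n i‖ ≤ ω)
    (hδρ : δ ≤ ρ) (hδ : ω * ((Λ₃ + Λ₂) * δ) ≤ 1 / 8) {w₁ w₂ : ℝ}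
    (hw₁ : A * T * Λ₁ * (w₁ + 1) ≤ w₁ / 2)
    (hw₂ : (A * T * Λ₂ + A * ‖fderiv ℝ (gradient C) z‖) * w₁ + A * T * Λ₁ * w₂ + A * T * Λ₂
      ≤ w₂ / 2)
    (hw₃ : 1 / 8 + ω * (A * Λ₁ * w₂ + Λ₂ * w₁) ≤ 1 / 2) {Ub : GridFun N s d}
    {x x' : GridFun N s m × GridFun N s m × GridFun N s d}
    (hX : InTube M y p u h N δ x.1 x.2.1 x.2.2) (hX' : InTube M y p u h N δ x'.1 x'.2.1 x'.2.2)
    {t : ℝ} (hxx : WeightedLE w₁ w₂ 1 x x' t) :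
    WeightedLE w₁ w₂ 1 (M.fixedPointMap f C y₀ h N S S' R Ub x)
      (M.fixedPointMap f C y₀ h N S S' R Ub x') (t / 2) := by
  obtain ⟨hΛ₁, hΛ₂, -⟩ := hb.nonneg hρ (hnode 0 ⟨0, hs⟩)
  have hA0 : 0 ≤ A := M.boundAverage_nonneg.trans hBA
  have hT0 : 0 ≤ T := by rw [← hTh]; positivity
  obtain ⟨e1, e2, e3⟩ := hxx
  have ht : 0 ≤ t := by simpa using (norm_nonneg _).trans e3
  refine ⟨?_, ?_, ?_⟩
  · refine (norm_state_solution_sub_le hM hpos hb hρ hh hs hTh hκ hκA hbd hnode hS (hX.mono hδρ)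
      (hX'.mono hδρ) y₀).trans ?_
    calc _ ≤ A * T * Λ₁ * (w₁ * t + 1 * t) :=
          mul_le_mul_of_nonneg_left (add_le_add e1 e3) (by positivity)
      _ = A * T * Λ₁ * (w₁ + 1) * t := by ring
      _ ≤ w₁ / 2 * t := mul_le_mul_of_nonneg_right hw₁ ht
      _ = _ := by ring
  · refine (norm_adjoint_solution_sub_le hM hpos hb hρ hh hs hTh hκ' hκA' hκB hκw hC z hbd' hnode
      hS' (hX.mono hδρ) (hX'.mono hδρ)).trans ?_
    set Γ := ‖fderiv ℝ (gradient C) z‖ with hΓ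
    have hΓ0 : 0 ≤ Γ := norm_nonneg _
    calc _ ≤ (A * T * Λ₂ + A * Γ) * (w₁ * t) + A * T * Λ₁ * (w₂ * t) + A * T * Λ₂ * (1 * t) :=
          add_le_add (add_le_add (mul_le_mul_of_nonneg_left e1 (by positivity))
            (mul_le_mul_of_nonneg_left e2 (by positivity)))
            (mul_le_mul_of_nonneg_left e3 (by positivity))
      _ = ((A * T * Λ₂ + A * Γ) * w₁ + A * T * Λ₁ * w₂ + A * T * Λ₂) * t := by ring
      _ ≤ w₂ / 2 * t := mul_le_mul_of_nonneg_right hw₂ ht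
      _ = _ := by ring
  · refine (norm_controlMap_sub_le hb hρ hs hω hδρ hδ hBA hnode hR hRω Ub hX hX').trans ?_
    calc _ ≤ 1 / 8 * (1 * t) + ω * (A * Λ₁ * (w₂ * t) + Λ₂ * (w₁ * t)) :=
          add_le_add (mul_le_mul_of_nonneg_left e3 (by norm_num))
            (mul_le_mul_of_nonneg_left (add_le_add (mul_le_mul_of_nonneg_left e2 (by positivity))
              (mul_le_mul_of_nonneg_left e1 hΛ₂)) hω)
      _ = (1 / 8 + ω * (A * Λ₁ * w₂ + Λ₂ * w₁)) * t := by ring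
      _ ≤ 1 / 2 * t := mul_le_mul_of_nonneg_right hw₃ ht
      _ = _ := by ring

/-- For small step sizes all nodes lie in the interval on which the solution is given. -/
lemma node_mem_Icc (hM : M.Structural) {T Tstar : ℝ} (hh : 0 ≤ h) (hTh : ((N : ℝ) + 1) * h = T)
    (hhT : (1 + ∑ i, M.c i) * h ≤ Tstar - T) (n : Fin (N + 1)) (i : Fin s) :
    M.node h n i ∈ Set.Icc 0 Tstar := by
  have hc := hM.nodes_nonneg
  have h1 : M.c i ≤ ∑ i, M.c i :=
    Finset.single_le_sum (fun i _ => hc i) (Finset.mem_univ i)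
  have h2 : (n : ℝ) ≤ N + 1 := by exact_mod_cast n.is_lt.le
  refine ⟨add_nonneg (by positivity) (mul_nonneg (hc i) hh), ?_⟩
  have h3 := mul_le_mul_of_nonneg_right h1 hh
  have h4 := mul_le_mul_of_nonneg_right h2 hh
  rw [node]
  linarith

end PeerTriplet

end

/-! ### Existence, uniqueness and order of convergence -/

theorem mainTheorem2 (s q r : ℕ) (hq : 2 ≤ q) (hqr : q ≤ r) (hrs : r ≤ s) (hqs : q < s)
    (M : PeerTriplet s) (hM : M.Structural) (hord : M.OrderConditions q r)
    (hpos : M.Positivity) (hsup : M.Superconvergence q r) (hdamp : M.Damping)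
    (hbd : M.BoundaryEigenvalues) :
    -- the constants `ζ` depend on the triplet only
    ∃ ζP₁ ζP₂ ζPc ζU₁ ζU₂ ζUc : ℝ,
      0 < ζP₁ ∧ 0 < ζP₂ ∧ 0 < ζPc ∧ 0 < ζU₁ ∧ 0 < ζU₂ ∧ 0 < ζUc ∧
      ∀ (m d : ℕ)
        (f : EuclideanSpace ℝ (Fin m) × EuclideanSpace ℝ (Fin d) → EuclideanSpace ℝ (Fin m))
        (C : EuclideanSpace ℝ (Fin m) → ℝ) (y₀ : EuclideanSpace ℝ (Fin m))
        (T Tstar : ℝ)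
        (y p : ℝ → EuclideanSpace ℝ (Fin m)) (u : ℝ → EuclideanSpace ℝ (Fin d))
        (ρ Λ₁ Λ₂ Λ₃ ε ω : ℝ),
        0 < T → T < Tstar →
        IsQuadraticObjective C →
        IsContinuousKKT f C y₀ T Tstar y p u →
        ContDiffOn ℝ (q + 1 : ℕ) y (Set.Icc 0 Tstar) →
        ContDiffOn ℝ (q + 1 : ℕ) p (Set.Icc 0 Tstar) →
        ContDiffOn ℝ q u (Set.Icc 0 Tstar) →
        0 < ρ → SmoothnessBounds f Tstar y p u ρ Λ₁ Λ₂ Λ₃ →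
        0 < ε → ε < 1 → ControlHessianBound f Tstar y p u ε ω →
        (ζP₁ * Λ₁ + ζP₂ * Λ₂ + ζPc * ‖fderiv ℝ (gradient C) (y T)‖ * Λ₁) * T ≤ 2 / 3 →
        (ζU₁ * Λ₁ + ζU₂ * Λ₂ + ζUc * ‖fderiv ℝ (gradient C) (y T)‖ * Λ₁) * Λ₁ * ω * T ≤ 1 / 3 →
        ∃ h₀ δ c : ℝ, 0 < h₀ ∧ 0 < δ ∧ 0 < c ∧
          ∀ (N : ℕ) (h : ℝ), h = T / (N + 1) → h ≤ h₀ →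
            -- existence in a tubular neighbourhood whose radius does not depend on the grid
            (∃ Y P U, IsDiscreteKKT f C M y₀ h N Y P U ∧ ErrorLE M y p u h N Y P U δ) ∧
            -- uniqueness there, up to the controls of blind stages
            (∀ Y P U Y' P' U',
              IsDiscreteKKT f C M y₀ h N Y P U → ErrorLE M y p u h N Y P U δ →
              IsDiscreteKKT f C M y₀ h N Y' P' U' → ErrorLE M y p u h N Y' P' U' δ →
              Y = Y' ∧ P = P' ∧
                ∀ (n : Fin (N + 1)) (i : Fin s), M.Active N n i → U n i = U' n i) ∧
            -- the error is of order `h ^ q` in state, adjoint and control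
            (∀ Y P U,
              IsDiscreteKKT f C M y₀ h N Y P U → ErrorLE M y p u h N Y P U δ →
              ErrorLE M y p u h N Y P U (c * h ^ q)) := by
  have hs : 0 < s := by omega
  have hq1 : 1 ≤ q := by omega
  have hstab := PeerTriplet.stableStep hq1 (hq1.trans hqr) hM hord hdamp
  obtain ⟨κ, hκ, hbdY⟩ := PeerTriplet.exists_stateOp_bound hM hstab
  obtain ⟨κ', hκ', hbdP⟩ := PeerTriplet.exists_adjointOp_bound hM hstab
  have hK := M.boundK_nonneg
  have hB := M.boundAverage_nonneg
  have hW : 0 ≤ (∑ k, |M.w k|) ^ 2 := sq_nonneg _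
  -- one constant of the triplet that dominates all its Lipschitz and stability constants
  obtain ⟨A, hA, hκA, hκA', hκB, hκw, hBA⟩ : ∃ A : ℝ, 0 < A ∧ κ * (1 + s) * M.boundK ≤ A ∧
      κ' * (1 + s) * M.boundK ≤ A ∧ κ' * (1 + s) * M.boundK * M.boundAverage ≤ A ∧
      κ' * (∑ k, |M.w k|) ^ 2 ≤ A ∧ M.boundAverage ≤ A := by
    have e1 : 0 ≤ κ * (1 + s) * M.boundK := by positivity
    have e2 : 0 ≤ κ' * (1 + s) * M.boundK := by positivity
    have e3 : 0 ≤ κ' * (1 + s) * M.boundK * M.boundAverage := by positivity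
    have e4 : 0 ≤ κ' * (∑ k, |M.w k|) ^ 2 := by positivity
    refine ⟨κ * (1 + s) * M.boundK + κ' * (1 + s) * M.boundK +
      κ' * (1 + s) * M.boundK * M.boundAverage + κ' * (∑ k, |M.w k|) ^ 2 + M.boundAverage + 1,
      ?_, ?_, ?_, ?_, ?_, ?_⟩ <;> linarith
  refine ⟨6 * A, 1, 1, 1, 24 * A + 48 * A ^ 2, 192 * A ^ 3, by positivity, one_pos, one_pos,
    one_pos, by positivity, by positivity, ?_⟩
  intro m d f C y₀ T Tstar y p u ρ Λ₁ Λ₂ Λ₃ ε ω hT hTT hC hkkt hy hp _ hρ hb hε _ hR hP hU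
  have hT0 : 0 < Tstar := hT.trans hTT
  have h0mem : (0 : ℝ) ∈ Set.Icc 0 Tstar := Set.left_mem_Icc.2 hT0.le
  obtain ⟨hΛ₁, hΛ₂, hΛ₃⟩ := hb.nonneg hρ h0mem
  have hHess : ∀ t ∈ Set.Icc 0 Tstar, ∃ R : EuclideanSpace ℝ (Fin d) →L[ℝ] EuclideanSpace ℝ (Fin d),
      (hessUU f (y t) (p t) (u t)).comp R = ContinuousLinearMap.id ℝ _ ∧
      R.comp (hessUU f (y t) (p t) (u t)) = ContinuousLinearMap.id ℝ _ ∧ ‖R‖ ≤ ω :=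
    fun t ht => hR t ht (p t) (by rw [sub_self, norm_zero]; exact hε.le)
  have hω : 0 ≤ ω := by
    obtain ⟨R, -, -, hRω⟩ := hHess 0 h0mem
    exact (norm_nonneg R).trans hRω
  obtain ⟨w₁, w₂, hw₁0, hw₂0, hw₁, hw₂, hw₃⟩ :=
    exists_weights hA hT hΛ₁ hΛ₂ (norm_nonneg (fderiv ℝ (gradient C) (y T))) hω hP hU
  obtain ⟨b₁, hb₁0, hb₁⟩ := PeerTriplet.exists_state_residual hq1 hqr hord hsup hT hTT hkkt hy hκ.le
    (hbdY m)
  obtain ⟨b₂, hb₂0, hb₂⟩ := PeerTriplet.exists_adjoint_residual hq1 hqr hM hord hpos hsup hT hTT hC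
    hkkt hy hp hρ hb hκ'.le (hbdP m)
  obtain ⟨ba, hba0, hba⟩ := PeerTriplet.exists_average_consistency hq1 hM hord hT0 hp hkkt.adjoint
  -- `δ₁` is the radius of the tube on which the Newton step contracts
  obtain ⟨δ₁, hδ₁0, hδ₁ρ, hδ₁⟩ : ∃ δ₁ : ℝ, 0 < δ₁ ∧ δ₁ ≤ ρ ∧ ω * ((Λ₃ + Λ₂) * δ₁) ≤ 1 / 8 := by
    refine ⟨min ρ (1 / (8 * (ω * (Λ₃ + Λ₂) + 1))), lt_min hρ (by positivity), min_le_left _ _, ?_⟩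
    have hk : 0 ≤ ω * (Λ₃ + Λ₂) := by positivity
    rw [← mul_assoc]
    refine (mul_le_mul_of_nonneg_left (min_le_right _ _) hk).trans ?_
    rw [mul_one_div, div_le_div_iff₀ (by positivity) (by norm_num)]
    linarith
  set δ := δ₁ / (4 * (1 + M.boundAverage)) with hδ
  have hδ0 : 0 < δ := by positivity
  have hδeq : δ + M.boundAverage * δ = δ₁ / 4 := by rw [hδ]; field_simp
  have hBδ : 0 ≤ M.boundAverage * δ := by positivity
  set W := w₁ + w₂ + 1 with hWdef
  have hW0 : 0 < W := by positivity
  set t₀ := δ / W with ht₀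
  have ht₀0 : 0 < t₀ := by positivity
  set c₀ := b₁ / w₁ + b₂ / w₂ + ω * (Λ₁ * ba) + ba + 1 with hc₀
  have d1 : 0 ≤ b₁ / w₁ := by positivity
  have d2 : 0 ≤ b₂ / w₂ := by positivity
  have d3 : 0 ≤ ω * (Λ₁ * ba) := by positivity
  have hc₀0 : 0 < c₀ := by positivity
  have hcs : 0 ≤ ∑ i, M.c i := Finset.sum_nonneg fun i _ => hM.nodes_nonneg i
  have hTd : 0 < Tstar - T := sub_pos.2 hTT
  refine ⟨min (min 1 (T / 3)) (min ((Tstar - T) / (1 + ∑ i, M.c i)) (min (δ₁ / 4) (t₀ / 2) / c₀)),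
    δ, W * (2 * c₀), by positivity, hδ0, by positivity, ?_⟩
  intro N h hNh hh₀
  simp only [le_min_iff] at hh₀
  obtain ⟨⟨hh1, hhT3⟩, hhs, hhc⟩ := hh₀
  have hh : 0 < h := by rw [hNh]; positivity
  have hTh : ((N : ℝ) + 1) * h = T := by rw [hNh]; field_simp
  have hN : 2 ≤ N := by
    have h3 : (3 : ℝ) * h ≤ (N + 1) * h := by rw [hTh]; linarith
    have h4 := le_of_mul_le_mul_right h3 hh
    have h5 : (2 : ℝ) ≤ N := by linarith
    exact_mod_cast h5
  rw [le_div_iff₀ (by positivity)] at hhs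
  rw [le_div_iff₀ hc₀0, le_min_iff] at hhc
  have hnode : ∀ (n : Fin (N + 1)) i, M.node h n i ∈ Set.Icc 0 Tstar :=
    PeerTriplet.node_mem_Icc hM hh.le hTh (by rw [mul_comm]; exact hhs)
  have hhq : h ^ q ≤ h := pow_le_of_le_one hh.le hh1 (by omega)
  have hhq0 : 0 ≤ h ^ q := pow_nonneg hh.le q
  have hτh : c₀ * h ^ q ≤ h * c₀ := by rw [mul_comm]; exact mul_le_mul_of_nonneg_right hhq hc₀0.le
  have hscale : ∀ {a : ℝ}, a ≤ c₀ → a * h ^ q ≤ c₀ * h ^ q :=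
    fun ha => mul_le_mul_of_nonneg_right ha hhq0
  obtain ⟨S, hS⟩ := exists_inverse_of_injective (M.stateOp m N) fun x hx => norm_le_zero_iff.1 <| by
    simpa [hx] using hbdY m N hN x 0 0 le_rfl (by simp [hx]) (by simp [hx])
  obtain ⟨S', hS'⟩ := exists_inverse_of_injective (M.adjointOp m N) fun x hx =>
    norm_le_zero_iff.1 <| by
      simpa [hx] using hbdP m N hN x 0 0 le_rfl (by simp [hx]) (by simp [hx])
  choose R hR₁ hR₂ hRω using fun (n : Fin (N + 1)) i => hHess _ (hnode n i)
  have hRinj : ∀ n i, Function.Injective (R n i) := fun n i =>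
    Function.LeftInverse.injective fun v => DFunLike.congr_fun (hR₁ n i) v
  have hNT : (N : ℝ) * h ≤ Tstar := by linarith
  have havg := hba N h hh.le hNT hnode
  have hres := PeerTriplet.norm_control_residual_le (M := M) hT0 hkkt hρ hb hω (by positivity) hnode havg hRω
  have key := PeerTriplet.existsUnique_discreteKKT_of_contraction (f := f) (C := C) (y₀ := y₀)
    (y := y) (p := p) (u := u) (τ := c₀ * h ^ q) (δ := δ) (δ₁ := δ₁) hM hpos hS hS' hRinj hw₁0 hw₂0
    ht₀0.le (by positivity) (hτh.trans hhc.2) hδ0.le (le_of_eq (mul_div_cancel₀ δ hW0.ne'))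
    (fun Y P U hE => PeerTriplet.InTube.of_errorLE hE hδ0.le (by linarith) havg (by
      have := hscale (show ba ≤ c₀ by linarith)
      linarith [hhc.1]))
    (fun x x' hX hX' t hxx => PeerTriplet.weightedLE_fixedPointMap hM hpos hb hρ hh.le hs hTh hκ.le
      hκ'.le hω hκA hκA' hκB hκw hBA hC (y T) (hbdY m N hN) (hbdP m N hN) hnode hS hS' hR₂ hRω hδ₁ρ
      hδ₁ hw₁ hw₂ hw₃ hX hX' hxx)
    ⟨?_, ?_, ?_⟩
  · have e : W * (2 * c₀) * h ^ q = W * (2 * (c₀ * h ^ q)) := by ring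
    rw [e]
    exact key
  · refine (hb₁ N h hN hh.le hTh hnode S hS).trans ?_
    calc b₁ * h ^ q = w₁ * (b₁ / w₁ * h ^ q) := by field_simp
      _ ≤ _ := mul_le_mul_of_nonneg_left (hscale (by linarith)) hw₁0.le
  · refine (hb₂ N h hN hh.le hh1 hTh hnode S' hS').trans ?_
    calc b₂ * h ^ q = w₂ * (b₂ / w₂ * h ^ q) := by field_simp
      _ ≤ _ := mul_le_mul_of_nonneg_left (hscale (by linarith)) hw₂0.le
  · refine hres.trans ?_
    rw [one_mul]
    calc ω * (Λ₁ * (ba * h ^ q)) = ω * (Λ₁ * ba) * h ^ q := by ring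
      _ ≤ _ := hscale (by linarith)
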